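/- Let $M,Q\in\mathbb R$ with $|Q|<M$ (the case $Q=0$ is Schwarzschild) and $\mu=\sqrt{M^2-Q^2}>0$. Let $\mathbb H^3$ be the unit ball of $\mathbb R^3$ with the Beltrami metric $h=\frac{d\rho^2}{(1-\rho^2)^2}+\frac{\rho^2}{1-\rho^2}\,d\omega^2$, $\rho=|x|$, let $O=0$, let $D$ be the hyperbolic distance, and put $$r=M+\frac{\mu}{\rho},\qquad \sqrt\mu\,H=M+\frac{\mu}{\rho},\qquad \Omega=\frac{\mu\sqrt{1-\rho^2}}{\mu+M\rho},\qquad \Phi_O=\frac{\Omega H}{4\pi\sqrt\mu}.$$ 1. The coordinate change $r=M+\mu/\rho$ is a smooth bijection from $\mathbb R_t\times(\mathbb H^3\setminus\{O\})$ onto the Reissner--Nordström exterior $\{r>M+\mu\}$, and it pulls the metric $-f\,dt^2+f^{-1}dr^2+r^2d\omega^2$, $f=1-\frac{2M}{r}+\frac{Q^2}{r^2}$, back to $g=\Omega^2(-dt^2+H^4h)$. The horizon is $\rho=1$ (that is, $D(x,O)\to\infty$) and spatial infinity is $O$. 2. $\Phi_O$ is locally integrable and satisfies $\Delta_h\Phi_O+\Phi_O=-\delta_O$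 on $\mathbb H^3$ in the sense of distributions; $\Phi_O$ and $d\Phi_O$ are bounded with respect to $h$ as $D(x,O)\to\infty$, and $\Phi_O/(\Omega H)$ is bounded near the horizon. There is no free constant: for $A\in\mathbb R$, $\Phi_O+A$ solves the same equation only if $A=0$; and every solution $\Phi$ that is continuous on $\mathbb H^3\setminus\{O\}$ and for which the scalar field $\Phi/(\Omega H)$ is bounded near the horizon equals $\Phi_O$ on $\mathbb H^3\setminus\{O\}$. 3. Let $x_0\in\mathbb H^3\setminus\{O\}$. There is an isometry $T_{x_0}$ of $(\mathbb H^3,h)$ with $T_{x_0}(x_0)=O$, and the function $$G(x,x_0)=\frac{\Phi_O(T_{x_0}(x))}{H(x)\,H(x_0)\,\Omega(x)}$$ does not depend on its choice. $G(\cdot,x_0)$ is smooth on $\mathbb H^3\setminus\{O,x_0\}$ and is the field of a static unit scalar charge at $x_0$: in the sense of distributions on $\mathbb R_t\times(\mathbb H^3\setminus\{O\})$, $$\Box_gG=-\int_{-\infty}^{\infty}\delta_{(g)}(\cdot,x'(\tau))\,d\tau,$$ where $x'(\tau)$ is the worldline of the static particle at $x_0$ and $\tau$ its proper time. The function $\Phi=\Omega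 HG=\Phi_O\circ T_{x_0}/H(x_0)$ solves $\Delta_h\Phi+\Phi=-H(x_0)^{-1}\delta_{x_0}$ on $\mathbb H^3$ with $\Phi/(\Omega H)$ bounded near the horizon, and every solution $\Phi$ of this equation that is continuous off $x_0$ and has $\Phi/(\Omega H)$ bounded near the horizon satisfies $\Phi/(\Omega H)=G(\cdot,x_0)$ on $\mathbb H^3\setminus\{O,x_0\}$. 4. As the charge nears the horizon, $G$ and its derivatives decay like $e^{-D(x_0,O)}$: for every compact $K\subset\mathbb H^3\setminus\{O\}$ and every $k\ge0$ there are $R,C$ such that $|\partial_x^kG(x,x_0)|\le C\,e^{-D(x_0,O)}$ for all $x\in K$ and all $x_0$ with $D(x_0,O)\ge R$; moreover there are $R$ and $c>0$ such that $G(x,x_0)\ge c\,e^{-D(x_0,O)}$ for all such $x,x_0$. No monopole hair remains: the monopole moment $\lim_{x\to O}r(x)\,G(x,x_0)$ exists, equals $\Omega(x_0)/(4\pi)$, and is $O(e^{-D(x_0,O)})$ as $D(x_0,O)\to\infty$. -/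

import Mathlib

open scoped ContDiff

noncomputable section

namespace StaticScalar

/-! ### Metrics in coordinates, Laplace–Beltrami operator, test functions -/

/-- Coordinate space with coordinates indexed by `ι`. -/
abbrev Coord (ι : Type) [Fintype ι] : Type := EuclideanSpace ℝ ι

section General

variable {ι : Type} [Fintype ι] [DecidableEq ι]

/-- The partial derivative `∂u/∂xⁱ`. -/
def partialDeriv (i : ι) (u : Coord ι → ℝ) (x : Coord ι) : ℝ :=
  fderiv ℝ u x (EuclideanSpace.single i 1)

/-- The density `√|det g|` of the volume measure of the metric `g = g_{ij} dxⁱ dxʲ`. -/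
def volDensity (g : Coord ι → Matrix ι ι ℝ) (x : Coord ι) : ℝ :=
  Real.sqrt |(g x).det|

/-- The Laplace–Beltrami operator `|g|^{-1/2} ∂ᵢ (|g|^{1/2} g^{ij} ∂ⱼ u)` of the metric `g`
(the wave operator when `g` is Lorentzian). -/
def laplaceBeltrami (g : Coord ι → Matrix ι ι ℝ) (u : Coord ι → ℝ) (x : Coord ι) : ℝ :=
  (volDensity g x)⁻¹ *
    ∑ i, partialDeriv i (fun y => volDensity g y * ∑ j, (g y)⁻¹ i j * partialDeriv j u y) x

/-- The value `g_x(v, w)` of the metric on tangent vectors. -/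
def metricForm (g : Coord ι → Matrix ι ι ℝ) (x v w : Coord ι) : ℝ :=
  ∑ i, ∑ j, g x i j * v i * w j

/-- The pointwise norm `√(g^{ij} ∂ᵢu ∂ⱼu)` of the differential `du` for a Riemannian metric. -/
def differentialNorm (g : Coord ι → Matrix ι ι ℝ) (u : Coord ι → ℝ) (x : Coord ι) : ℝ :=
  Real.sqrt (∑ i, ∑ j, (g x)⁻¹ i j * partialDeriv i u x * partialDeriv j u x)

/-- Smooth functions with compact support inside `U`. -/
def IsTestFunction (U : Set (Coord ι)) (φ : Coord ι → ℝ) : Prop :=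
  ContDiff ℝ ∞ φ ∧ HasCompactSupport φ ∧ tsupport φ ⊆ U

end General

/-! ### Hyperbolic three-space in Beltrami coordinates -/

/-- Three-dimensional coordinate space. -/
abbrev Space : Type := Coord (Fin 3)

/-- The Beltrami ball; its centre `0` is the base point `O`. -/
def hypBall : Set Space := Metric.ball 0 1

/-- The metric `h = dρ²/(1-ρ²)² + ρ²/(1-ρ²) dω²` of the unit hyperbolic space, in Cartesian
form: `h_{ij} = δ_{ij}/(1-|x|²) + xᵢxⱼ/(1-|x|²)²`. -/
def hypMetric (x : Space) : Matrix (Fin 3) (Fin 3) ℝ :=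
  Matrix.of fun i j =>
    (if i = j then 1 else 0) / (1 - ‖x‖ ^ 2) + x i * x j / (1 - ‖x‖ ^ 2) ^ 2

/-- Hyperbolic distance in Beltrami coordinates. -/
def hypDist (x y : Space) : ℝ :=
  Real.arcosh ((1 - inner ℝ x y) / (Real.sqrt (1 - ‖x‖ ^ 2) * Real.sqrt (1 - ‖y‖ ^ 2)))

/-- `T` is an isometry of hyperbolic space: a smooth bijection of the ball with `T^* h = h`. -/
def IsHypIsometry (T : Space → Space) : Prop :=
  Set.BijOn T hypBall hypBall ∧ ContDiffOn ℝ ∞ T hypBall ∧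
    ∀ x ∈ hypBall, ∀ v w : Space,
      metricForm hypMetric (T x) (fderiv ℝ T x v) (fderiv ℝ T x w) = metricForm hypMetric x v w

/-- `Φ` is a distributional solution of `Δ_h Φ + Φ = c δ_{(h)}(·, a)` on hyperbolic space. -/
def SolvesHelmholtz (Φ : Space → ℝ) (a : Space) (c : ℝ) : Prop :=
  MeasureTheory.LocallyIntegrableOn Φ hypBall ∧
    ∀ φ : Space → ℝ, IsTestFunction hypBall φ →
      ∫ x in hypBall, Φ x * (laplaceBeltrami hypMetric φ x + φ x) * volDensity hypMetric x
        = c * φ a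

/-- `Φ` and `dΦ` are bounded with respect to `h` as `D(x, O) → ∞`. -/
def BoundedAtInfinity (Φ : Space → ℝ) : Prop :=
  ∃ R C : ℝ, ∀ x ∈ hypBall, R ≤ hypDist x 0 →
    |Φ x| ≤ C ∧ DifferentiableAt ℝ Φ x ∧ differentialNorm hypMetric Φ x ≤ C

/-! ### The Reissner–Nordström exterior -/

/-- `μ = √(M² - Q²)`. -/
def mu (M Q : ℝ) : ℝ := Real.sqrt (M ^ 2 - Q ^ 2)

/-- The area radius `r = M + μ/ρ`, `ρ = |x|`, in terms of the Beltrami coordinate. -/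
def areaRadius (M Q : ℝ) (x : Space) : ℝ := M + mu M Q / ‖x‖

/-- `H`, with `√μ H = M + μ/ρ`. -/
def Hfun (M Q : ℝ) (x : Space) : ℝ := (M + mu M Q / ‖x‖) / Real.sqrt (mu M Q)

/-- `Ω = μ √(1-ρ²) / (μ + M ρ)`. -/
def Omega (M Q : ℝ) (x : Space) : ℝ :=
  mu M Q * Real.sqrt (1 - ‖x‖ ^ 2) / (mu M Q + M * ‖x‖)

/-- Coordinate space for the spacetime: one time and three space coordinates. -/
abbrev Spacetime : Type := Coord (Fin 1 ⊕ Fin 3)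

/-- The spacetime point `(t, x)`. -/
def event (t : ℝ) (x : Space) : Spacetime := WithLp.toLp 2 (Sum.elim (fun _ => t) (fun i => x i))

/-- The time coordinate. -/
def timeOf (X : Spacetime) : ℝ := X (Sum.inl 0)

/-- The space coordinates. -/
def spaceOf (X : Spacetime) : Space := WithLp.toLp 2 (fun i => X (Sum.inr i))

/-- The metric `g = Ω² (-dt² + H⁴ h)`. -/
def opticalFormMetric (M Q : ℝ) (X : Spacetime) : Matrix (Fin 1 ⊕ Fin 3) (Fin 1 ⊕ Fin 3) ℝ :=
  Omega M Q (spaceOf X) ^ 2 •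
    Matrix.fromBlocks (-1) 0 0 (Hfun M Q (spaceOf X) ^ 4 • hypMetric (spaceOf X))

/-- The range of the coordinates `(t, x)`: the point `O` (spatial infinity) is removed, the
horizon is the sphere `|x| = 1`. -/
def exterior : Set Spacetime := {X | spaceOf X ∈ hypBall ∧ spaceOf X ≠ 0}

/-- `f(r) = 1 - 2M/r + Q²/r²`. -/
def rnLapse (M Q r : ℝ) : ℝ := 1 - 2 * M / r + Q ^ 2 / r ^ 2

/-- The Reissner–Nordström metric `-f dt² + dr²/f + r² dω²` in the coordinates `(t, y)` with
`r = |y|`; its spatial part is `δ_{ij} + (1/f - 1) yᵢ yⱼ / r²`. -/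
def rnMetric (M Q : ℝ) (Y : Spacetime) : Matrix (Fin 1 ⊕ Fin 3) (Fin 1 ⊕ Fin 3) ℝ :=
  Matrix.fromBlocks (-(rnLapse M Q ‖spaceOf Y‖ • (1 : Matrix (Fin 1) (Fin 1) ℝ))) 0 0
    (Matrix.of fun i j => (if i = j then 1 else 0) +
      ((rnLapse M Q ‖spaceOf Y‖)⁻¹ - 1) * (spaceOf Y i * spaceOf Y j) / ‖spaceOf Y‖ ^ 2)

/-- The region outside the outer horizon `r = M + μ`. -/
def rnExterior (M Q : ℝ) : Set Spacetime := {Y | M + mu M Q < ‖spaceOf Y‖}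

/-- The coordinate change `r = M + μ/ρ`, with unchanged time and angular coordinates. -/
def rnChart (M Q : ℝ) (X : Spacetime) : Spacetime :=
  event (timeOf X) ((areaRadius M Q (spaceOf X) / ‖spaceOf X‖) • spaceOf X)

/-- The worldline of a static particle at `x₀`, parametrized by proper time. -/
def staticWorldline (M Q : ℝ) (x₀ : Space) (τ : ℝ) : Spacetime :=
  event (τ / Omega M Q x₀) x₀

/-- The time-independent function `G` is a distributional solution, on the black hole exterior,
of `□_g G = - ∫ δ_{(g)}(·, x'(τ)) dτ`, where `x'` is the worldline of a static particle at `x₀`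
and `τ` is its proper time. -/
def IsStaticChargeField (M Q : ℝ) (x₀ : Space) (G : Space → ℝ) : Prop :=
  MeasureTheory.LocallyIntegrableOn (fun X => G (spaceOf X)) exterior ∧
    ∀ φ : Spacetime → ℝ, IsTestFunction exterior φ →
      ∫ X in exterior, G (spaceOf X) * laplaceBeltrami (opticalFormMetric M Q) φ X *
          volDensity (opticalFormMetric M Q) X
        = -∫ τ : ℝ, φ (staticWorldline M Q x₀ τ)

/-! ### The field of the charge -/

/-- `Φ_O = Ω H / (4π √μ)`. -/
def PhiO (M Q : ℝ) (x : Space) : ℝ :=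
  Omega M Q x * Hfun M Q x / (4 * Real.pi * Real.sqrt (mu M Q))

/-- `G(x, x₀) = Φ_O(T x) / (H(x) H(x₀) Ω(x))`, for an isometry `T` that takes `x₀` to `O`. -/
def chargeField (M Q : ℝ) (T : Space → Space) (x₀ x : Space) : ℝ :=
  PhiO M Q (T x) / (Hfun M Q x * Hfun M Q x₀ * Omega M Q x)

/-- The scalar field `Φ / (Ω H)` that corresponds to `Φ` is bounded near the horizon. -/
def RegularAtHorizon (M Q : ℝ) (Φ : Space → ℝ) : Prop :=
  ∃ R C : ℝ, ∀ x ∈ hypBall, R ≤ hypDist x 0 → |Φ x / (Omega M Q x * Hfun M Q x)| ≤ C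

end StaticScalar

end

open StaticScalar

noncomputable section

namespace StaticScalar

open MeasureTheory Filter Topology

/-! ### The hyperbolic metric in Beltrami coordinates -/

/-! The weight `w = ΩH` equals `√μ √(1-ρ²)/ρ = √μ / sinh D`, where `D = artanh ρ` is the distance to
`O`, and it solves `Δ_h w + w = 0` off `O`. The density of `g` times its inverse spatial metric is
`w² √h h^{ij}`. Hence on static functions the wave operator is `∂ᵢ(w² √h h^{ij} ∂ⱼ)`, which is
conjugate through `w` to `√h (Δ_h + 1)` (`sum_partialDeriv_sq_mul_hypFlux`). The black hole problem
becomes the Helmholtz equation on a homogeneous space, where the pole can be moved by an isometry.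

In Beltrami coordinates `√h Δ_h` is the flat Laplacian on radial functions. Therefore `Δ_h + 1`
takes `g / sinh D` to `g'' / sinh D`, primes being derivatives in `D` (`helmholtz_radial`). The
choice `g = 1` gives the Green function `1 / (4π sinh D)`, which is `Φ_O`. The choice `g = D` gives
the solution without pole, which decays more slowly by a factor `D`; boundedness of `Φ / (ΩH)` at
the horizon rules it out.

Existence and uniqueness both test against `cutGreen`, a smoothed and truncated `1 / sinh D`. Its
source splits into a core, which tends to `-4π δ_O` (`tendsto_integral_coreSource`), and a tail on
the shell `1/ε ≤ D ≤ 2/ε`. If `ε` is small the tail misses the support of a test function, and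
`solvesHelmholtz_greenO` follows. Against a homogeneous solution of size `O(1 / sinh D)` the tail
contributes `O(ε² · 1/ε)`, so the solution vanishes at the centre
(`SolvesHelmholtz.eq_zero_at_center`) and, after a boost, at every point of continuity.

Isometries enter in two ways. The explicit boosts move the pole. An arbitrary isometry taking `x₀`
to `O` differs from the boost by one that fixes `O`, and such a map preserves the norm
(`IsHypIsometry.norm_eq_of_map_zero`), so `G` does not depend on the choice.

Finally `chargeField_eq` gives `G = √(1-|x₀|²) / (4π r(x₀)) · |x| / √(sepSq x₀ x)`. The last factor
is smooth up to and beyond `|x₀| = 1` for `x` in a compact set. The first carries the decay, since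
`√(1-|x₀|²) = 1 / cosh D(x₀, O)`. The monopole moment is read off as `x → O`. -/

lemma mem_hypBall {x : Space} : x ∈ hypBall ↔ ‖x‖ < 1 := by
  simp [hypBall]

lemma isOpen_hypBall : IsOpen hypBall := Metric.isOpen_ball

lemma one_sub_norm_sq_pos {x : Space} (hx : x ∈ hypBall) : 0 < 1 - ‖x‖ ^ 2 := by
  have h := mem_hypBall.1 hx
  nlinarith [norm_nonneg x]

lemma norm_sq_eq_three (x : Space) : ‖x‖ ^ 2 = x 0 ^ 2 + x 1 ^ 2 + x 2 ^ 2 := by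
  rw [EuclideanSpace.norm_sq_eq, Fin.sum_univ_three]
  simp

lemma inner_eq_three (x y : Space) : inner ℝ x y = x 0 * y 0 + x 1 * y 1 + x 2 * y 2 := by
  simp [PiLp.inner_apply, Fin.sum_univ_three, mul_comm]

lemma inner_lt_one {x y : Space} (hx : x ∈ hypBall) (hy : y ∈ hypBall) : inner ℝ x y < 1 := by
  have h := real_inner_le_norm x y
  have h1 := mem_hypBall.1 hx
  have h2 := mem_hypBall.1 hy
  nlinarith [norm_nonneg x, norm_nonneg y]

/-- With `q = 1 - ‖x‖²` the eigenvalues are `1/q` twice, across `x`, and `1/q + ‖x‖²/q² = 1/q²`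
along `x`. -/
lemma det_hypMetric {x : Space} (hx : x ∈ hypBall) :
    (hypMetric x).det = ((1 - ‖x‖ ^ 2) ^ 4)⁻¹ := by
  have hq := (one_sub_norm_sq_pos hx).ne'
  have h : 1 - ‖x‖ ^ 2 + x 0 ^ 2 + x 1 ^ 2 + x 2 ^ 2 = 1 := by rw [norm_sq_eq_three]; ring
  rw [Matrix.det_fin_three]
  simp only [hypMetric, Matrix.of_apply]
  -- From here `q` is a free nonzero variable, tied to the coordinates only by `h`; the claim
  -- becomes a polynomial identity.
  generalize 1 - ‖x‖ ^ 2 = q at hq h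
  simp only [Fin.isValue, Fin.reduceEq, if_true, if_false]
  have h0 : x 0 ^ 2 = 1 - q - x 1 ^ 2 - x 2 ^ 2 := by linarith
  field_simp
  ring_nf
  simp only [h0]
  ring

/-- The inverse of the hyperbolic metric. -/
def hypCometric (x : Space) : Matrix (Fin 3) (Fin 3) ℝ :=
  Matrix.of fun i j => (1 - ‖x‖ ^ 2) * ((if i = j then 1 else 0) - x i * x j)

lemma hypMetric_mul_hypCometric {x : Space} (hx : x ∈ hypBall) :
    hypMetric x * hypCometric x = 1 := by
  have hq := (one_sub_norm_sq_pos hx).ne'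
  have h : 1 - ‖x‖ ^ 2 + x 0 ^ 2 + x 1 ^ 2 + x 2 ^ 2 = 1 := by rw [norm_sq_eq_three]; ring
  ext i j
  simp only [hypMetric, hypCometric, Matrix.mul_apply, Matrix.of_apply, Fin.sum_univ_three]
  generalize 1 - ‖x‖ ^ 2 = q at hq h
  have h0 : q = 1 - x 0 ^ 2 - x 1 ^ 2 - x 2 ^ 2 := by linarith
  fin_cases i <;> fin_cases j <;> simp <;> field_simp <;> rw [h0] <;> ring

lemma inv_hypMetric {x : Space} (hx : x ∈ hypBall) : (hypMetric x)⁻¹ = hypCometric x :=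
  Matrix.inv_eq_right_inv (hypMetric_mul_hypCometric hx)

lemma volDensity_hypMetric {x : Space} (hx : x ∈ hypBall) :
    volDensity hypMetric x = ((1 - ‖x‖ ^ 2) ^ 2)⁻¹ := by
  have hq := one_sub_norm_sq_pos hx
  rw [volDensity, det_hypMetric hx, abs_of_pos (by positivity),
    show ((1 - ‖x‖ ^ 2) ^ 4)⁻¹ = (((1 - ‖x‖ ^ 2) ^ 2)⁻¹) ^ 2 by rw [inv_pow, ← pow_mul],
    Real.sqrt_sq (by positivity)]

lemma metricForm_hypMetric (x v w : Space) :
    metricForm hypMetric x v w =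
      inner ℝ v w / (1 - ‖x‖ ^ 2) + inner ℝ x v * inner ℝ x w / (1 - ‖x‖ ^ 2) ^ 2 := by
  simp only [metricForm, hypMetric, Matrix.of_apply, Fin.sum_univ_three, inner_eq_three]
  simp
  ring

/-- The flux `√h h^{ij} ∂ⱼu`, whose divergence is `√h Δ_h u`. -/
def hypFlux (u : Space → ℝ) (i : Fin 3) (x : Space) : ℝ :=
  volDensity hypMetric x * ∑ j, (hypMetric x)⁻¹ i j * partialDeriv j u x

/-- Multiplication by the density leaves a pure divergence, the form in which one integrates by
parts with respect to Lebesgue measure. -/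
lemma volDensity_mul_laplaceBeltrami {u : Space → ℝ} {x : Space} (hx : x ∈ hypBall) :
    volDensity hypMetric x * laplaceBeltrami hypMetric u x
      = ∑ i, partialDeriv i (hypFlux u i) x := by
  have h : volDensity hypMetric x ≠ 0 := by
    rw [volDensity_hypMetric hx]
    have := one_sub_norm_sq_pos hx
    positivity
  rw [laplaceBeltrami, ← mul_assoc, mul_inv_cancel₀ h, one_mul]
  rfl

lemma hypFlux_eq {u : Space → ℝ} {x : Space} (hx : x ∈ hypBall) (i : Fin 3) :
    hypFlux u i x
      = (1 - ‖x‖ ^ 2)⁻¹ * (partialDeriv i u x - x i * ∑ j, x j * partialDeriv j u x) := by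
  have hq := (one_sub_norm_sq_pos hx).ne'
  rw [hypFlux, volDensity_hypMetric hx, inv_hypMetric hx]
  simp only [hypCometric, Matrix.of_apply, Fin.sum_univ_three]
  field_simp
  fin_cases i <;> simp <;> ring

lemma fderiv_eq_sum_partialDeriv (u : Space → ℝ) (x v : Space) :
    fderiv ℝ u x v = ∑ j, v j * partialDeriv j u x := by
  have hv : v = ∑ j, v j • EuclideanSpace.single j (1 : ℝ) := by
    ext k
    fin_cases k <;> simp [Fin.sum_univ_three]
  conv_lhs => rw [hv]
  simp [partialDeriv]

/-! ### Lorentz boosts -/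

/-- Numerator of the boost that takes `a` to the centre. -/
def boostNum (a x : Space) : Space :=
  Real.sqrt (1 - ‖a‖ ^ 2) • x - a
    + (inner ℝ a x / (1 + Real.sqrt (1 - ‖a‖ ^ 2))) • a

/-- The linear part of `boostNum`. -/
def boostLin (a : Space) : Space →L[ℝ] Space :=
  Real.sqrt (1 - ‖a‖ ^ 2) • ContinuousLinearMap.id ℝ Space
    + (1 + Real.sqrt (1 - ‖a‖ ^ 2))⁻¹ • (innerSL ℝ a).smulRight a

/-- The hyperbolic isometry (Lorentz boost in Beltrami coordinates) that takes `a` to `O`. -/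
def boost (a x : Space) : Space := (1 - inner ℝ a x)⁻¹ • boostNum a x

lemma boostLin_apply (a v : Space) : boostLin a v =
    Real.sqrt (1 - ‖a‖ ^ 2) • v + (inner ℝ a v / (1 + Real.sqrt (1 - ‖a‖ ^ 2))) • a := by
  simp [boostLin, smul_smul, div_eq_inv_mul]

lemma boostNum_eq (a x : Space) : boostNum a x = boostLin a x - a := by
  rw [boostLin_apply, boostNum]; abel

/-- With `k = √(1-‖a‖²)` the map `boostLin a` is `k` times the identity across `a` and the identity
along `a`, because `k + (1-k²)/(1+k) = 1`. -/
lemma inner_boostLin_boostLin {a : Space} (ha : a ∈ hypBall) (v w : Space) :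
    inner ℝ (boostLin a v) (boostLin a w)
      = inner ℝ a v * inner ℝ a w + (1 - ‖a‖ ^ 2) * inner ℝ v w := by
  have hq := one_sub_norm_sq_pos ha
  simp only [boostLin_apply, inner_add_left, inner_add_right, real_inner_smul_left,
    real_inner_smul_right, real_inner_self_eq_norm_sq, real_inner_comm a]
  set k := Real.sqrt (1 - ‖a‖ ^ 2) with hk
  have hk0 : 0 < k := Real.sqrt_pos.2 hq
  have hk2 : ‖a‖ ^ 2 = 1 - k ^ 2 := by rw [hk, Real.sq_sqrt hq.le]; ring
  rw [hk2]
  field_simp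
  ring

lemma inner_boostLin_self {a : Space} (ha : a ∈ hypBall) (v : Space) :
    inner ℝ a (boostLin a v) = inner ℝ a v := by
  have hq := one_sub_norm_sq_pos ha
  simp only [boostLin_apply, inner_add_right, real_inner_smul_right, real_inner_self_eq_norm_sq]
  set k := Real.sqrt (1 - ‖a‖ ^ 2) with hk
  have hk0 : 0 < k := Real.sqrt_pos.2 hq
  have hk2 : ‖a‖ ^ 2 = 1 - k ^ 2 := by rw [hk, Real.sq_sqrt hq.le]; ring
  rw [hk2]
  field_simp
  ring

/-- Invariance of the Minkowski form. Up to the common factor `√(1-‖a‖²)`, the numbers `1 - ⟨a, x⟩`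
and `boostNum a x` are the time and space components of the boosted vector `(1, x)`. -/
lemma norm_boostNum_sq {a : Space} (ha : a ∈ hypBall) (x : Space) :
    ‖boostNum a x‖ ^ 2 = (1 - inner ℝ a x) ^ 2 - (1 - ‖a‖ ^ 2) * (1 - ‖x‖ ^ 2) := by
  rw [boostNum_eq, ← real_inner_self_eq_norm_sq (boostLin a x - a), inner_sub_left,
    inner_sub_right, inner_sub_right,
    inner_boostLin_boostLin ha, real_inner_comm a (boostLin a x), inner_boostLin_self ha,
    real_inner_self_eq_norm_sq, real_inner_self_eq_norm_sq]
  ring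

lemma one_sub_norm_boost_sq {a x : Space} (ha : a ∈ hypBall) (hx : x ∈ hypBall) :
    1 - ‖boost a x‖ ^ 2 = (1 - ‖a‖ ^ 2) * (1 - ‖x‖ ^ 2) / (1 - inner ℝ a x) ^ 2 := by
  have hd : 0 < 1 - inner ℝ a x := sub_pos.2 (inner_lt_one ha hx)
  rw [boost, norm_smul, mul_pow, norm_boostNum_sq ha, norm_inv, Real.norm_eq_abs, inv_pow, sq_abs]
  field_simp
  ring

lemma boost_mem {a x : Space} (ha : a ∈ hypBall) (hx : x ∈ hypBall) : boost a x ∈ hypBall := by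
  have hd : 0 < 1 - inner ℝ a x := sub_pos.2 (inner_lt_one ha hx)
  have h : 0 < 1 - ‖boost a x‖ ^ 2 := by
    rw [one_sub_norm_boost_sq ha hx]
    have := one_sub_norm_sq_pos ha
    have := one_sub_norm_sq_pos hx
    positivity
  rw [mem_hypBall]
  nlinarith [norm_nonneg (boost a x)]

lemma boost_self {a : Space} (ha : a ∈ hypBall) : boost a a = 0 := by
  have h := norm_boostNum_sq ha a
  rw [real_inner_self_eq_norm_sq] at h
  have : boostNum a a = 0 := by
    rw [← norm_eq_zero, ← sq_eq_zero_iff, h]; ring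
  simp [boost, this]

lemma boost_zero (a : Space) : boost a 0 = -a := by
  simp [boost, boostNum]

lemma neg_mem_hypBall {a : Space} (ha : a ∈ hypBall) : -a ∈ hypBall := by
  simpa [mem_hypBall] using ha

lemma zero_mem_hypBall : (0 : Space) ∈ hypBall := by simp [mem_hypBall]

lemma boost_neg_boost {a x : Space} (ha : a ∈ hypBall) (hx : x ∈ hypBall) :
    boost (-a) (boost a x) = x := by
  have hd : 0 < 1 - inner ℝ a x := sub_pos.2 (inner_lt_one ha hx)
  have hq := one_sub_norm_sq_pos ha
  have hin : inner ℝ a (boost a x) = (1 - inner ℝ a x)⁻¹ * (inner ℝ a x - ‖a‖ ^ 2) := by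
    rw [boost, real_inner_smul_right, boostNum_eq, inner_sub_right, inner_boostLin_self ha,
      real_inner_self_eq_norm_sq]
  have hden : 1 - inner ℝ (-a) (boost a x) = (1 - inner ℝ a x)⁻¹ * (1 - ‖a‖ ^ 2) := by
    rw [inner_neg_left, hin]; field_simp; ring
  rw [boost, hden, boostNum, norm_neg, inner_neg_left, hin, boost, boostNum]
  set k := Real.sqrt (1 - ‖a‖ ^ 2) with hk
  have hk0 : 0 < k := Real.sqrt_pos.2 hq
  have hk2 : ‖a‖ ^ 2 = 1 - k ^ 2 := by rw [hk, Real.sq_sqrt hq.le]; ring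
  rw [hk2]
  ext i
  simp
  field_simp
  ring

lemma boost_boost_neg {a x : Space} (ha : a ∈ hypBall) (hx : x ∈ hypBall) :
    boost a (boost (-a) x) = x := by
  simpa using boost_neg_boost (neg_mem_hypBall ha) hx

lemma bijOn_boost {a : Space} (ha : a ∈ hypBall) : Set.BijOn (boost a) hypBall hypBall := by
  refine ⟨fun x hx => boost_mem ha hx, fun x hx y hy h => ?_, fun y hy => ?_⟩
  · rw [← boost_neg_boost ha hx, ← boost_neg_boost ha hy, h]
  · exact ⟨boost (-a) y, boost_mem (neg_mem_hypBall ha) hy, boost_boost_neg ha hy⟩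

lemma contDiffOn_boost {a : Space} (ha : a ∈ hypBall) : ContDiffOn ℝ ∞ (boost a) hypBall := by
  have h1 : ContDiff ℝ ∞ (boostNum a) := by
    rw [show boostNum a = fun x => boostLin a x - a from funext (boostNum_eq a)]
    fun_prop
  have h2 : ContDiff ℝ ∞ (fun x : Space => 1 - inner ℝ a x) :=
    contDiff_const.sub (contDiff_const.inner ℝ contDiff_id)
  exact (h2.contDiffOn.inv fun x hx => (sub_pos.2 (inner_lt_one ha hx)).ne').smul h1.contDiffOn

lemma hasFDerivAt_boost {a x : Space} (ha : a ∈ hypBall) (hx : x ∈ hypBall) :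
    HasFDerivAt (boost a) ((1 - inner ℝ a x)⁻¹ • boostLin a
      + (((1 - inner ℝ a x) ^ 2)⁻¹ • innerSL ℝ a).smulRight (boostNum a x)) x := by
  have hd : 0 < 1 - inner ℝ a x := sub_pos.2 (inner_lt_one ha hx)
  have h1 : HasFDerivAt (boostNum a) (boostLin a) x := by
    rw [show boostNum a = fun x => boostLin a x - a from funext (boostNum_eq a)]
    exact (boostLin a).hasFDerivAt.sub_const a
  have h2 : HasFDerivAt (fun x : Space => 1 - inner ℝ a x) (-(innerSL ℝ a)) x :=
    ((innerSL ℝ a).hasFDerivAt).const_sub 1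
  have h3 := (hasDerivAt_inv hd.ne').comp_hasFDerivAt x h2
  have h4 := h3.smul h1
  refine h4.congr_fderiv ?_
  ext v
  simp

/-- The metric sees only inner products of `boostNum a x`, `boostLin a v` and `boostLin a w`. The
preceding identities express all of them through `a`, `x`, `v`, `w`, and a rational identity
remains. -/
lemma isHypIsometry_boost {a : Space} (ha : a ∈ hypBall) : IsHypIsometry (boost a) := by
  refine ⟨bijOn_boost ha, contDiffOn_boost ha, fun x hx v w => ?_⟩
  have hd : 0 < 1 - inner ℝ a x := sub_pos.2 (inner_lt_one ha hx)
  have hqa := one_sub_norm_sq_pos ha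
  have hqx := one_sub_norm_sq_pos hx
  have hD : ∀ v, fderiv ℝ (boost a) x v = (1 - inner ℝ a x)⁻¹ • boostLin a v
      + (((1 - inner ℝ a x) ^ 2)⁻¹ * inner ℝ a v) • boostNum a x := fun v => by
    rw [(hasFDerivAt_boost ha hx).fderiv]; simp
  have hNL : ∀ v, inner ℝ (boostNum a x) (boostLin a v)
      = -((1 - inner ℝ a x) * inner ℝ a v) + (1 - ‖a‖ ^ 2) * inner ℝ x v := fun v => by
    rw [boostNum_eq, inner_sub_left, inner_boostLin_boostLin ha, inner_boostLin_self ha]; ring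
  have hNN := norm_boostNum_sq ha x
  rw [metricForm_hypMetric, metricForm_hypMetric, one_sub_norm_boost_sq ha hx, hD, hD]
  simp only [boost, inner_add_left, inner_add_right, real_inner_smul_left, real_inner_smul_right,
    real_inner_self_eq_norm_sq, hNN, hNL, real_inner_comm (boostNum a x) (boostLin a _),
    inner_boostLin_boostLin ha]
  field_simp
  ring

/-! ### Rigidity of hyperbolic isometries -/

lemma IsHypIsometry.differentiableAt {T : Space → Space} (hT : IsHypIsometry T) {x : Space}
    (hx : x ∈ hypBall) : DifferentiableAt ℝ T x :=
  (hT.2.1.contDiffAt (isOpen_hypBall.mem_nhds hx)).differentiableAt (by simp)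

lemma IsHypIsometry.comp {S T : Space → Space} (hS : IsHypIsometry S) (hT : IsHypIsometry T) :
    IsHypIsometry (S ∘ T) := by
  refine ⟨hS.1.comp hT.1, hS.2.1.comp hT.2.1 hT.1.mapsTo, fun x hx v w => ?_⟩
  rw [fderiv_comp x (hS.differentiableAt (hT.1.mapsTo hx)) (hT.differentiableAt hx)]
  simp only [Function.comp_apply, ContinuousLinearMap.comp_apply]
  rw [hS.2.2 _ (hT.1.mapsTo hx), hT.2.2 x hx]

lemma hasDerivAt_artanh {s : ℝ} (hs : |s| < 1) :
    HasDerivAt Real.artanh (1 - s ^ 2)⁻¹ s := by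
  obtain ⟨h1, h2⟩ := abs_lt.1 hs
  have h3 : 0 < 1 + s := by linarith
  have h4 : 0 < 1 - s := by linarith
  have h : HasDerivAt (fun s : ℝ => 1 / 2 * Real.log ((1 + s) / (1 - s))) (1 - s ^ 2)⁻¹ s := by
    have hd : HasDerivAt (fun s : ℝ => (1 + s) / (1 - s))
        ((1 * (1 - s) - (1 + s) * (-1)) / (1 - s) ^ 2) s :=
      ((hasDerivAt_id s).const_add 1).div ((hasDerivAt_id s).const_sub 1) h4.ne'
    refine ((hd.log (by positivity)).const_mul (1 / 2)).congr_deriv ?_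
    have h5 : 1 - s ^ 2 ≠ 0 := by nlinarith
    field_simp
    ring
  refine h.congr_of_eventuallyEq ?_
  filter_upwards [Ioo_mem_nhds h1 h2] with t ht
  exact Real.artanh_eq_half_log ⟨ht.1.le, ht.2.le⟩

lemma metricForm_hypMetric_self_pos {y v : Space} (hy : y ∈ hypBall) (hv : v ≠ 0) :
    0 < metricForm hypMetric y v v := by
  have hq := one_sub_norm_sq_pos hy
  have hv' : 0 < ‖v‖ := norm_pos_iff.2 hv
  rw [metricForm_hypMetric, real_inner_self_eq_norm_sq, ← pow_two]
  positivity

/-- The function `artanh ⟨e, ·⟩` is 1-Lipschitz for the hyperbolic metric. -/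
lemma inner_le_mul_sqrt_metricForm {y e : Space} (hy : y ∈ hypBall) (he : ‖e‖ = 1) (v : Space) :
    inner ℝ e v ≤ (1 - inner ℝ e y ^ 2) * Real.sqrt (metricForm hypMetric y v v) := by
  rcases eq_or_ne v 0 with rfl | hv
  · simp [metricForm]
  have hq := one_sub_norm_sq_pos hy
  have hv' : 0 < ‖v‖ := norm_pos_iff.2 hv
  have hs : inner ℝ e y ^ 2 ≤ ‖y‖ ^ 2 := by
    have := abs_real_inner_le_norm e y
    rw [he, one_mul] at this
    exact sq_le_sq' (by linarith [neg_abs_le (inner ℝ e y)]) ((le_abs_self _).trans this)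
  set s := inner ℝ e y with hsd
  set m := inner ℝ y v with hm
  set c := inner ℝ e v with hc
  set q := 1 - ‖y‖ ^ 2 with hqd
  set b := ‖v‖ ^ 2 + m ^ 2 / q with hb
  have hb0 : 0 < b := by positivity
  have hM : metricForm hypMetric y v v = b / q := by
    rw [metricForm_hypMetric, real_inner_self_eq_norm_sq, hb, ← hqd, ← hm]
    field_simp
  have hy2 : ‖y‖ ^ 2 = 1 - q := by rw [hqd]; ring
  -- Cauchy–Schwarz for the rescaled metric `q h`. There `e - s y` is the gradient of `⟨e, ·⟩`, with
  -- square `1 - s²`, while `b` is the square of `v` and `c` is the product of the two vectors.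
  have hw : 0 ≤ ‖b • (e - s • y) - c • v‖ ^ 2
      + inner ℝ y (b • (e - s • y) - c • v) ^ 2 / q := by positivity
  have hexp : ‖b • (e - s • y) - c • v‖ ^ 2 + inner ℝ y (b • (e - s • y) - c • v) ^ 2 / q
      = b * (b * (1 - s ^ 2) - c ^ 2) := by
    rw [← real_inner_self_eq_norm_sq (b • (e - s • y) - c • v)]
    simp only [inner_sub_left, inner_sub_right, real_inner_smul_left, real_inner_smul_right]
    simp only [real_inner_self_eq_norm_sq, real_inner_comm e y, real_inner_comm y v, real_inner_comm e v,
      ← hsd, ← hm, ← hc, he, hy2]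
    rw [show ‖v‖ ^ 2 = b - m ^ 2 / q by rw [hb]; ring]
    field_simp
    ring
  rw [hexp] at hw
  have h1 : c ^ 2 ≤ b * (1 - s ^ 2) := by
    by_contra h
    push Not at h
    nlinarith
  have hqs : q ≤ 1 - s ^ 2 := by rw [hqd]; linarith
  have h2 : c ^ 2 ≤ (1 - s ^ 2) ^ 2 * (b / q) := by
    have : b ≤ (1 - s ^ 2) * (b / q) := by
      rw [mul_div_assoc', le_div_iff₀ hq]
      nlinarith
    calc c ^ 2 ≤ (1 - s ^ 2) * b := by linarith
      _ ≤ (1 - s ^ 2) * ((1 - s ^ 2) * (b / q)) := by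
          apply mul_le_mul_of_nonneg_left this; linarith
      _ = _ := by ring
  rw [hM, ← Real.sqrt_sq (show 0 ≤ 1 - s ^ 2 by linarith), ← Real.sqrt_mul (sq_nonneg _)]
  exact (le_abs_self c).trans (Real.abs_le_sqrt h2)

/-- A map that fixes the centre and preserves the hyperbolic metric infinitesimally does not
increase the distance to the centre. -/
lemma norm_le_of_preserves_metric {S : Space → Space} (hmaps : Set.MapsTo S hypBall hypBall)
    (hd : ∀ x ∈ hypBall, DifferentiableAt ℝ S x)
    (hm : ∀ x ∈ hypBall, ∀ v,
      metricForm hypMetric (S x) (fderiv ℝ S x v) (fderiv ℝ S x v) = metricForm hypMetric x v v)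
    (h0 : S 0 = 0) {x : Space} (hx : x ∈ hypBall) : ‖S x‖ ≤ ‖x‖ := by
  rcases eq_or_ne (S x) 0 with h | h
  · rw [h, norm_zero]; exact norm_nonneg x
  have hSx : 0 < ‖S x‖ := norm_pos_iff.2 h
  -- In this direction `artanh ⟨e, S x⟩` is the full distance from `S x` to the centre.
  set e : Space := ‖S x‖⁻¹ • S x with he
  have he1 : ‖e‖ = 1 := by rw [he, norm_smul, norm_inv, norm_norm, inv_mul_cancel₀ hSx.ne']
  have hin : ∀ y ∈ hypBall, |inner ℝ e y| < 1 := fun y hy => by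
    have := abs_real_inner_le_norm e y
    rw [he1, one_mul] at this
    exact this.trans_lt (mem_hypBall.1 hy)
  have hx1 := mem_hypBall.1 hx
  have htx : ∀ t ∈ Set.Icc (0 : ℝ) 1, t • x ∈ hypBall := fun t ht => by
    rw [mem_hypBall, norm_smul, Real.norm_of_nonneg ht.1]
    nlinarith [norm_nonneg x, ht.2]
  have htn : ∀ t ∈ Set.Icc (0 : ℝ) 1, |t * ‖x‖| < 1 := fun t ht => by
    rw [abs_of_nonneg (mul_nonneg ht.1 (norm_nonneg x))]
    nlinarith [norm_nonneg x, ht.2]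
  -- Along the ray `t x`, the first term grows at most at the hyperbolic speed of the image curve.
  -- `S` preserves that speed, and the second term grows exactly at the speed of the ray. So `F`
  -- decreases from `F 0 = 0`.
  set F : ℝ → ℝ := fun t => Real.artanh (inner ℝ e (S (t • x))) - Real.artanh (t * ‖x‖) with hF
  have hder : ∀ t ∈ Set.Icc (0 : ℝ) 1, HasDerivAt F
      ((1 - inner ℝ e (S (t • x)) ^ 2)⁻¹ * inner ℝ e (fderiv ℝ S (t • x) x)
        - (1 - (t * ‖x‖) ^ 2)⁻¹ * ‖x‖) t := fun t ht => by
    have h1 : HasDerivAt (fun t : ℝ => t • x) x t := by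
      simpa using (hasDerivAt_id t).smul_const x
    have h2 : HasDerivAt (fun t : ℝ => S (t • x)) (fderiv ℝ S (t • x) x) t :=
      (hd _ (htx t ht)).hasFDerivAt.comp_hasDerivAt t h1
    have h3 : HasDerivAt (fun t : ℝ => inner ℝ e (S (t • x)))
        (inner ℝ e (fderiv ℝ S (t • x) x)) t := (innerSL ℝ e).hasFDerivAt.comp_hasDerivAt t h2
    have h4 : HasDerivAt (fun t : ℝ => t * ‖x‖) ‖x‖ t := by
      simpa using (hasDerivAt_id t).mul_const ‖x‖
    exact ((hasDerivAt_artanh (hin _ (hmaps (htx t ht)))).comp t h3).sub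
      ((hasDerivAt_artanh (htn t ht)).comp t h4)
  have hanti : AntitoneOn F (Set.Icc 0 1) := by
    refine antitoneOn_of_deriv_nonpos (convex_Icc 0 1)
      (fun t ht => (hder t ht).continuousAt.continuousWithinAt)
      (fun t ht => (hder t (interior_subset ht)).differentiableAt.differentiableWithinAt)
      fun t ht => ?_
    have ht := interior_subset ht
    rw [(hder t ht).deriv, sub_nonpos]
    have hs := hin _ (hmaps (htx t ht))
    have hs' : 0 < 1 - inner ℝ e (S (t • x)) ^ 2 := by
      have := (sq_lt_one_iff_abs_lt_one _).2 hs; linarith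
    have hr' : 0 < 1 - (t * ‖x‖) ^ 2 := by
      have := (sq_lt_one_iff_abs_lt_one _).2 (htn t ht); linarith
    rw [inv_mul_le_iff₀ hs']
    refine (inner_le_mul_sqrt_metricForm (hmaps (htx t ht)) he1 _).trans_eq ?_
    have hxx : inner ℝ (t • x) x = t * ‖x‖ ^ 2 := by
      rw [real_inner_smul_left, real_inner_self_eq_norm_sq]
    rw [hm _ (htx t ht), metricForm_hypMetric, norm_smul, Real.norm_of_nonneg ht.1, hxx,
      real_inner_self_eq_norm_sq]
    congr 1
    rw [show ‖x‖ ^ 2 / (1 - (t * ‖x‖) ^ 2)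
        + t * ‖x‖ ^ 2 * (t * ‖x‖ ^ 2) / (1 - (t * ‖x‖) ^ 2) ^ 2
        = ((1 - (t * ‖x‖) ^ 2)⁻¹ * ‖x‖) ^ 2 by field_simp; ring]
    exact Real.sqrt_sq (by positivity)
  have hle := hanti (Set.left_mem_Icc.2 zero_le_one) (Set.right_mem_Icc.2 zero_le_one) zero_le_one
  have hex : inner ℝ e (S x) = ‖S x‖ := by
    rw [he, real_inner_smul_left, real_inner_self_eq_norm_sq]; field_simp
  simp only [hF, one_smul, one_mul, zero_smul, zero_mul, h0, inner_zero_right, sub_self,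
    hex, Real.artanh_zero, sub_nonpos] at hle
  have hS1 := mem_hypBall.1 (hmaps hx)
  exact (Real.artanh_le_artanh_iff ⟨by linarith, hS1⟩
    ⟨by linarith [norm_nonneg x], hx1⟩).1 hle

/-- Isometries that fix the centre preserve the distance to the centre. -/
lemma IsHypIsometry.norm_eq_of_map_zero {S : Space → Space} (hS : IsHypIsometry S)
    (h0 : S 0 = 0) {x : Space} (hx : x ∈ hypBall) : ‖S x‖ = ‖x‖ := by
  refine le_antisymm (norm_le_of_preserves_metric hS.1.mapsTo (fun _ h => hS.differentiableAt h)
    (fun x hx v => hS.2.2 x hx v v) h0 hx) ?_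
  -- The reverse inequality is the same estimate for the inverse map. Its differentiability is not
  -- part of `IsHypIsometry`. It follows from the inverse function theorem, `dS` being injective
  -- because the metric is positive definite.
  set R := Function.invFunOn S hypBall with hR
  have hRS : ∀ z ∈ hypBall, R (S z) = z := fun z hz => hS.1.injOn.leftInvOn_invFunOn hz
  have hSR : ∀ z ∈ hypBall, S (R z) = z := fun z hz => hS.1.surjOn.rightInvOn_invFunOn hz
  have hRm : Set.MapsTo R hypBall hypBall := hS.1.surjOn.mapsTo_invFunOn
  have hinj : ∀ z ∈ hypBall, Function.Injective (fderiv ℝ S z) := fun z hz => by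
    rw [injective_iff_map_eq_zero]
    intro v hv
    by_contra hne
    have h1 := metricForm_hypMetric_self_pos hz hne
    rw [← hS.2.2 z hz v v, hv] at h1
    simp [metricForm] at h1
  have hder : ∀ y ∈ hypBall, ∃ f' : Space ≃L[ℝ] Space, (f' : Space →L[ℝ] Space)
      = fderiv ℝ S (R y) ∧ HasFDerivAt R (f'.symm : Space →L[ℝ] Space) y := fun y hy => by
    have hz := hRm hy
    set f' : Space ≃L[ℝ] Space := (LinearEquiv.ofInjectiveEndo
      ((fderiv ℝ S (R y)) : Space →ₗ[ℝ] Space) (hinj _ hz)).toContinuousLinearEquiv with hf'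
    have hf : (f' : Space →L[ℝ] Space) = fderiv ℝ S (R y) := by
      ext1 v
      simp [hf', LinearEquiv.coe_ofInjectiveEndo]
    have hstrict : HasStrictFDerivAt S (f' : Space →L[ℝ] Space) (R y) := by
      rw [hf]
      exact (hS.2.1.contDiffAt (isOpen_hypBall.mem_nhds hz)).hasStrictFDerivAt (by simp)
    -- `S` carries the neighbourhoods of `R y` exactly to those of `y`, which is continuity of `R`
    -- at `y`.
    have hmap := hstrict.map_nhds_eq_of_equiv
    rw [hSR y hy] at hmap
    have hcont : ContinuousAt R y := by
      rw [ContinuousAt, ← hmap, Filter.tendsto_map'_iff]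
      refine Filter.Tendsto.congr' ?_ Filter.tendsto_id
      filter_upwards [isOpen_hypBall.mem_nhds hz] with z hz
      exact (hRS z hz).symm
    refine ⟨f', hf, HasFDerivAt.of_local_left_inverse hcont hstrict.hasFDerivAt ?_⟩
    filter_upwards [isOpen_hypBall.mem_nhds hy] with z hz
    exact hSR z hz
  have key := norm_le_of_preserves_metric hRm (fun y hy => by
      obtain ⟨f', -, h⟩ := hder y hy
      exact h.differentiableAt) (fun y hy v => by
      obtain ⟨f', hf, h⟩ := hder y hy
      have h2 := hS.2.2 (R y) (hRm hy) (f'.symm v) (f'.symm v)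
      rw [h.fderiv]
      simp only [ContinuousLinearEquiv.coe_coe]
      rw [← h2, hSR y hy, ← hf]
      simp) (by simpa [h0] using hRS 0 zero_mem_hypBall) (hS.1.mapsTo hx)
  rwa [hRS x hx] at key

/-- `T ∘ boost (-x₀)` fixes the centre and so preserves norms. Since `PhiO` is radial, the explicit
boost may stand in for any admissible `T`. -/
lemma IsHypIsometry.norm_eq_norm_boost {T : Space → Space} (hT : IsHypIsometry T) {x₀ x : Space}
    (hx₀ : x₀ ∈ hypBall) (hT0 : T x₀ = 0) (hx : x ∈ hypBall) : ‖T x‖ = ‖boost x₀ x‖ := by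
  have hS := hT.comp (isHypIsometry_boost (neg_mem_hypBall hx₀))
  have h := hS.norm_eq_of_map_zero (by simp [boost_zero, hT0]) (boost_mem hx₀ hx)
  simpa [boost_neg_boost hx₀ hx] using h

/-! ### Calculus of test functions -/

section TestFunctions

variable {ι : Type} [Fintype ι]

/-- Off the compact `K` the function vanishes near each point, so smoothness has to be checked only
on `U`, where the metric coefficients and the weights are smooth. -/
lemma isTestFunction_of_contDiffOn {U K : Set (Coord ι)} {f : Coord ι → ℝ} (hU : IsOpen U)
    (hf : ContDiffOn ℝ ∞ f U) (hK : IsCompact K) (hKU : K ⊆ U) (h0 : ∀ x, x ∉ K → f x = 0) :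
    IsTestFunction U f := by
  have hs : tsupport f ⊆ K := by
    refine closure_minimal (fun x hx => ?_) hK.isClosed
    by_contra h
    exact hx (h0 x h)
  refine ⟨contDiff_iff_contDiffAt.2 fun x => ?_, HasCompactSupport.intro hK h0, hs.trans hKU⟩
  by_cases hx : x ∈ K
  · exact hf.contDiffAt (hU.mem_nhds (hKU hx))
  · have : f =ᶠ[nhds x] fun _ => 0 := by
      filter_upwards [hK.isClosed.isOpen_compl.mem_nhds hx] with y hy
      exact h0 y hy
    exact contDiffAt_const.congr_of_eventuallyEq this

lemma IsTestFunction.isCompact {U : Set (Coord ι)} {φ : Coord ι → ℝ} (h : IsTestFunction U φ) :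
    IsCompact (tsupport φ) := h.2.1

lemma IsTestFunction.mono {U V : Set (Coord ι)} {φ : Coord ι → ℝ} (h : IsTestFunction U φ)
    (hUV : U ⊆ V) : IsTestFunction V φ := ⟨h.1, h.2.1, h.2.2.trans hUV⟩

lemma IsTestFunction.integrable {U : Set (Coord ι)} {φ : Coord ι → ℝ} (h : IsTestFunction U φ) :
    Integrable φ := h.1.continuous.integrable_of_hasCompactSupport h.2.1

lemma IsTestFunction.add {U : Set (Coord ι)} {φ ψ : Coord ι → ℝ} (hφ : IsTestFunction U φ)
    (hψ : IsTestFunction U ψ) : IsTestFunction U (fun x => φ x + ψ x) :=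
  ⟨hφ.1.add hψ.1, hφ.2.1.add hψ.2.1, (tsupport_add φ ψ).trans (Set.union_subset hφ.2.2 hψ.2.2)⟩

lemma IsTestFunction.mul_contDiffOn {U : Set (Coord ι)} {φ f : Coord ι → ℝ} (hU : IsOpen U)
    (hφ : IsTestFunction U φ) (hf : ContDiffOn ℝ ∞ f U) : IsTestFunction U (fun x => f x * φ x) :=
  isTestFunction_of_contDiffOn hU (hf.mul hφ.1.contDiffOn) hφ.isCompact hφ.2.2 fun x hx => by
    rw [image_eq_zero_of_notMem_tsupport hx, mul_zero]

lemma IsTestFunction.setIntegral_eq {U : Set (Coord ι)} {φ : Coord ι → ℝ}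
    (hφ : IsTestFunction U φ) : ∫ x in U, φ x = ∫ x, φ x :=
  setIntegral_eq_integral_of_forall_compl_eq_zero fun _ hx =>
    image_eq_zero_of_notMem_tsupport fun h => hx (hφ.2.2 h)

variable [DecidableEq ι]

lemma contDiffOn_partialDeriv {U : Set (Coord ι)} {u : Coord ι → ℝ} (hU : IsOpen U)
    (hu : ContDiffOn ℝ ∞ u U) (i : ι) : ContDiffOn ℝ ∞ (partialDeriv i u) U :=
  (hu.fderiv_of_isOpen hU (by simp)).clm_apply contDiffOn_const

lemma partialDeriv_eq_zero_of_notMem {u : Coord ι → ℝ} {x : Coord ι} (hx : x ∉ tsupport u) (i : ι) :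
    partialDeriv i u x = 0 := by
  have : x ∉ tsupport (fderiv ℝ u) := fun h => hx (tsupport_fderiv_subset ℝ h)
  rw [partialDeriv, image_eq_zero_of_notMem_tsupport this]
  simp

lemma IsTestFunction.pderiv {U : Set (Coord ι)} {φ : Coord ι → ℝ} (h : IsTestFunction U φ)
    (i : ι) : IsTestFunction U (partialDeriv i φ) := by
  have h1 : IsTestFunction Set.univ (partialDeriv i φ) :=
    isTestFunction_of_contDiffOn isOpen_univ
      (contDiffOn_partialDeriv isOpen_univ h.1.contDiffOn i) h.isCompact (Set.subset_univ _)
      fun x hx => partialDeriv_eq_zero_of_notMem hx i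
  refine ⟨h1.1, h1.2.1, subset_trans (closure_minimal (fun x hx => ?_) h.isCompact.isClosed) h.2.2⟩
  by_contra hx'
  exact hx (partialDeriv_eq_zero_of_notMem hx' i)

lemma partialDeriv_congr {u v : Coord ι → ℝ} {x : Coord ι} (h : u =ᶠ[nhds x] v) (i : ι) :
    partialDeriv i u x = partialDeriv i v x := by
  rw [partialDeriv, partialDeriv, h.fderiv_eq]

lemma IsTestFunction.integral_mul_partialDeriv {U V : Set (Coord ι)} {φ ψ : Coord ι → ℝ}
    (hφ : IsTestFunction U φ) (hψ : IsTestFunction V ψ) (i : ι) :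
    ∫ x, φ x * partialDeriv i ψ x = -∫ x, partialDeriv i φ x * ψ x := by
  have h1 := hφ.pderiv i
  have h2 := hψ.pderiv i
  refine integral_mul_fderiv_eq_neg_fderiv_mul_of_integrable ?_ ?_ ?_
    (fun x _ => hφ.1.differentiable (by simp) x) (fun x _ => hψ.1.differentiable (by simp) x)
  · exact (h1.1.continuous.mul hψ.1.continuous).integrable_of_hasCompactSupport h1.2.1.mul_right
  · exact (hφ.1.continuous.mul h2.1.continuous).integrable_of_hasCompactSupport hφ.2.1.mul_right
  · exact (hφ.1.continuous.mul hψ.1.continuous).integrable_of_hasCompactSupport hφ.2.1.mul_right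

lemma IsTestFunction.integral_partialDeriv {U : Set (Coord ι)} {φ : Coord ι → ℝ}
    (hφ : IsTestFunction U φ) (i : ι) : ∫ x, partialDeriv i φ x = 0 := by
  have h := integral_mul_fderiv_eq_neg_fderiv_mul_of_integrable (μ := volume) (f := fun _ => (1 : ℝ))
    (g := φ) (v := EuclideanSpace.single i 1) (by simp)
    (by simp only [one_mul]; exact (hφ.pderiv i).integrable)
    (by simpa using hφ.integrable) (fun x _ => differentiableAt_const _)
    (fun x _ => hφ.1.differentiable (by simp) x)
  simpa [partialDeriv] using h

end TestFunctions

/-! ### Integration by parts for the hyperbolic Laplacian -/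

lemma contDiffOn_volDensity : ContDiffOn ℝ ∞ (volDensity hypMetric) hypBall := by
  have h : ContDiffOn ℝ ∞ (fun x : Space => ((1 - ‖x‖ ^ 2) ^ 2)⁻¹) hypBall :=
    ((contDiff_const.sub (contDiff_norm_sq ℝ)).pow 2).contDiffOn.inv fun x hx => by
      have := one_sub_norm_sq_pos hx; positivity
  exact h.congr fun x hx => volDensity_hypMetric hx

lemma volDensity_pos {x : Space} (hx : x ∈ hypBall) : 0 < volDensity hypMetric x := by
  have := one_sub_norm_sq_pos hx
  rw [volDensity_hypMetric hx]
  positivity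

lemma contDiff_coord (i : Fin 3) : ContDiff ℝ ∞ (fun x : Space => x i) :=
  (EuclideanSpace.proj (𝕜 := ℝ) i).contDiff

lemma contDiffOn_hypMetric_inv (i j : Fin 3) :
    ContDiffOn ℝ ∞ (fun x => (hypMetric x)⁻¹ i j) hypBall := by
  have h : ContDiffOn ℝ ∞ (fun x : Space => hypCometric x i j) hypBall := by
    simp only [hypCometric, Matrix.of_apply]
    exact ((contDiff_const.sub (contDiff_norm_sq ℝ)).mul
      (contDiff_const.sub ((contDiff_coord i).mul (contDiff_coord j)))).contDiffOn
  exact h.congr fun x hx => by rw [inv_hypMetric hx]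

lemma contDiffOn_hypFlux {U : Set Space} (hU : IsOpen U) (hUb : U ⊆ hypBall) {u : Space → ℝ}
    (hu : ContDiffOn ℝ ∞ u U) (i : Fin 3) : ContDiffOn ℝ ∞ (hypFlux u i) U :=
  (contDiffOn_volDensity.mono hUb).mul (ContDiffOn.sum fun j _ =>
    ((contDiffOn_hypMetric_inv i j).mono hUb).mul (contDiffOn_partialDeriv hU hu j))

lemma hypFlux_eq_zero_of_notMem {u : Space → ℝ} {x : Space} (hx : x ∉ tsupport u) (i : Fin 3) :
    hypFlux u i x = 0 := by
  simp [hypFlux, partialDeriv_eq_zero_of_notMem hx]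

lemma IsTestFunction.flux {φ : Space → ℝ} (h : IsTestFunction hypBall φ) (i : Fin 3) :
    IsTestFunction hypBall (hypFlux φ i) :=
  isTestFunction_of_contDiffOn isOpen_hypBall
    (contDiffOn_hypFlux isOpen_hypBall subset_rfl h.1.contDiffOn i) h.isCompact h.2.2
    fun _ hx => hypFlux_eq_zero_of_notMem hx i

lemma hypFlux_congr {u v : Space → ℝ} {x : Space} (h : u =ᶠ[nhds x] v) (i : Fin 3) :
    hypFlux u i x = hypFlux v i x := by
  simp only [hypFlux, partialDeriv_congr h]

lemma laplaceBeltrami_congr {u v : Space → ℝ} {x : Space} (h : u =ᶠ[nhds x] v) :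
    laplaceBeltrami hypMetric u x = laplaceBeltrami hypMetric v x := by
  have : ∀ i, hypFlux u i =ᶠ[nhds x] hypFlux v i := fun i => by
    filter_upwards [h.eventuallyEq_nhds] with y hy
    exact hypFlux_congr hy i
  change _ * ∑ i, partialDeriv i (hypFlux u i) x = _ * ∑ i, partialDeriv i (hypFlux v i) x
  simp only [partialDeriv_congr (this _)]

lemma contDiffOn_laplaceBeltrami {U : Set Space} (hU : IsOpen U) (hUb : U ⊆ hypBall)
    {u : Space → ℝ} (hu : ContDiffOn ℝ ∞ u U) :
    ContDiffOn ℝ ∞ (laplaceBeltrami hypMetric u) U :=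
  ((contDiffOn_volDensity.mono hUb).inv fun _ hx => (volDensity_pos (hUb hx)).ne').mul
    (ContDiffOn.sum fun i _ => contDiffOn_partialDeriv hU (contDiffOn_hypFlux hU hUb hu i) i)

lemma laplaceBeltrami_eq_zero_of_notMem {u : Space → ℝ} {x : Space} (hx : x ∉ tsupport u) :
    laplaceBeltrami hypMetric u x = 0 := by
  have h : u =ᶠ[nhds x] fun _ => 0 := notMem_tsupport_iff_eventuallyEq.1 hx
  rw [laplaceBeltrami_congr h]
  simp [laplaceBeltrami, partialDeriv]

lemma IsTestFunction.laplacian {φ : Space → ℝ} (h : IsTestFunction hypBall φ) :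
    IsTestFunction hypBall (laplaceBeltrami hypMetric φ) :=
  isTestFunction_of_contDiffOn isOpen_hypBall
    (contDiffOn_laplaceBeltrami isOpen_hypBall subset_rfl h.1.contDiffOn) h.isCompact h.2.2
    fun _ hx => laplaceBeltrami_eq_zero_of_notMem hx

/-- The energy density `√h h^{ij} ∂ᵢψ ∂ⱼφ`. -/
def hypEnergy (ψ φ : Space → ℝ) (x : Space) : ℝ := ∑ i, partialDeriv i ψ x * hypFlux φ i x

lemma hypEnergy_comm {ψ φ : Space → ℝ} {x : Space} (hx : x ∈ hypBall) :
    hypEnergy ψ φ x = hypEnergy φ ψ x := by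
  simp only [hypEnergy, hypFlux_eq hx, Fin.sum_univ_three]
  ring

lemma IsTestFunction.integral_mul_laplaceBeltrami {φ ψ : Space → ℝ}
    (hψ : IsTestFunction hypBall ψ) (hφ : IsTestFunction hypBall φ) :
    ∫ x in hypBall, ψ x * (volDensity hypMetric x * laplaceBeltrami hypMetric φ x)
      = -∫ x in hypBall, hypEnergy ψ φ x := by
  have h1 : ∀ i, IsTestFunction hypBall (fun x => ψ x * partialDeriv i
      (hypFlux φ i) x) := fun i =>
    ((hφ.flux i).pderiv i).mul_contDiffOn isOpen_hypBall hψ.1.contDiffOn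
  have h2 : ∀ i, IsTestFunction hypBall (fun x => partialDeriv i ψ x *
      hypFlux φ i x) := fun i =>
    (hφ.flux i).mul_contDiffOn isOpen_hypBall (hψ.pderiv i).1.contDiffOn
  calc _ = ∫ x in hypBall, ∑ i, ψ x * partialDeriv i (hypFlux φ i) x := by
        refine setIntegral_congr_fun isOpen_hypBall.measurableSet fun x hx => ?_
        simp only [volDensity_mul_laplaceBeltrami hx, Finset.mul_sum]
    _ = ∑ i, ∫ x in hypBall, ψ x * partialDeriv i (hypFlux φ i) x :=
        integral_finsetSum _ fun i _ => (h1 i).integrable.integrableOn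
    _ = ∑ i, -∫ x in hypBall, partialDeriv i ψ x * hypFlux φ i x := by
        refine Finset.sum_congr rfl fun i _ => ?_
        rw [(h1 i).setIntegral_eq, (h2 i).setIntegral_eq,
          hψ.integral_mul_partialDeriv (hφ.flux i)]
    _ = _ := by
        rw [Finset.sum_neg_distrib]
        congr 1
        exact (integral_finsetSum _ fun i _ => (h2 i).integrable.integrableOn).symm

/-- Green's second identity. -/
lemma IsTestFunction.integral_laplaceBeltrami_comm {φ ψ : Space → ℝ}
    (hψ : IsTestFunction hypBall ψ) (hφ : IsTestFunction hypBall φ) :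
    ∫ x in hypBall, ψ x * (volDensity hypMetric x * laplaceBeltrami hypMetric φ x)
      = ∫ x in hypBall,
          φ x * (volDensity hypMetric x * laplaceBeltrami hypMetric ψ x) := by
  rw [hψ.integral_mul_laplaceBeltrami hφ, hφ.integral_mul_laplaceBeltrami hψ]
  congr 1
  exact setIntegral_congr_fun isOpen_hypBall.measurableSet fun x hx => hypEnergy_comm hx

lemma IsTestFunction.integral_laplaceBeltrami {φ : Space → ℝ} (hφ : IsTestFunction hypBall φ) :
    ∫ x in hypBall, volDensity hypMetric x * laplaceBeltrami hypMetric φ x = 0 := by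
  calc _ = ∫ x in hypBall, ∑ i, partialDeriv i (hypFlux φ i) x :=
        setIntegral_congr_fun isOpen_hypBall.measurableSet fun x hx =>
          volDensity_mul_laplaceBeltrami hx
    _ = ∑ i, ∫ x in hypBall, partialDeriv i (hypFlux φ i) x :=
        integral_finsetSum _ fun i _ => ((hφ.flux i).pderiv i).integrable.integrableOn
    _ = 0 := Finset.sum_eq_zero fun i _ => by
        rw [((hφ.flux i).pderiv i).setIntegral_eq, (hφ.flux i).integral_partialDeriv]

/-! ### Invariance under isometries -/

/-- The Jacobian matrix of `T`. -/
def jacobian (T : Space → Space) (x : Space) : Matrix (Fin 3) (Fin 3) ℝ :=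
  Matrix.of fun i k => fderiv ℝ T x (EuclideanSpace.single k 1) i

lemma det_jacobian (T : Space → Space) (x : Space) :
    (jacobian T x).det = (fderiv ℝ T x).det := by
  rw [ContinuousLinearMap.det, ← LinearMap.det_toMatrix (EuclideanSpace.basisFun (Fin 3) ℝ).toBasis]
  congr 1

lemma metricForm_single (g : Space → Matrix (Fin 3) (Fin 3) ℝ) (x : Space) (k l : Fin 3) :
    metricForm g x (EuclideanSpace.single k 1) (EuclideanSpace.single l 1) = g x k l := by
  simp [metricForm]

lemma IsHypIsometry.jacobian_pullback {T : Space → Space} (hT : IsHypIsometry T) {x : Space}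
    (hx : x ∈ hypBall) :
    (jacobian T x).transpose * hypMetric (T x) * jacobian T x = hypMetric x := by
  ext k l
  rw [← metricForm_single hypMetric x k l, ← hT.2.2 x hx, metricForm]
  simp only [Matrix.mul_apply, Matrix.transpose_apply, jacobian, Matrix.of_apply,
    Fin.sum_univ_three]
  ring

/-- Determinants are taken in `Jᵀ h(T x) J = h(x)`. -/
lemma IsHypIsometry.abs_det_mul_volDensity {T : Space → Space} (hT : IsHypIsometry T) {x : Space}
    (hx : x ∈ hypBall) :
    |(fderiv ℝ T x).det| * volDensity hypMetric (T x) = volDensity hypMetric x := by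
  rw [volDensity, volDensity, ← hT.jacobian_pullback hx, Matrix.det_mul, Matrix.det_mul,
    Matrix.det_transpose, ← det_jacobian, ← Real.sqrt_sq (abs_nonneg (jacobian T x).det),
    ← Real.sqrt_mul (sq_nonneg _), sq_abs, abs_mul, abs_mul]
  congr 1
  rw [mul_right_comm, ← abs_mul, ← pow_two, abs_of_nonneg (sq_nonneg (jacobian T x).det)]

lemma IsHypIsometry.det_jacobian_ne_zero {T : Space → Space} (hT : IsHypIsometry T) {x : Space}
    (hx : x ∈ hypBall) : (jacobian T x).det ≠ 0 := fun h => by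
  have h1 := hT.abs_det_mul_volDensity hx
  rw [← det_jacobian, h, abs_zero, zero_mul] at h1
  exact (volDensity_pos hx).ne h1

/-- The inverse of the pull-back identity. Energies are built from the inverse metric, so this is
the form they need. -/
lemma IsHypIsometry.jacobian_pushforward {T : Space → Space} (hT : IsHypIsometry T) {x : Space}
    (hx : x ∈ hypBall) :
    jacobian T x * (hypMetric x)⁻¹ * (jacobian T x).transpose = (hypMetric (T x))⁻¹ := by
  symm
  have hA : IsUnit (jacobian T x).transpose.det := by
    rw [Matrix.det_transpose]; exact (hT.det_jacobian_ne_zero hx).isUnit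
  have hH : IsUnit (hypMetric x).det := by
    rw [det_hypMetric hx]
    have := one_sub_norm_sq_pos hx
    exact (by positivity : ((1 - ‖x‖ ^ 2) ^ 4)⁻¹ ≠ 0).isUnit
  refine Matrix.inv_eq_right_inv ?_
  have h : (jacobian T x).transpose * (hypMetric (T x) *
      (jacobian T x * (hypMetric x)⁻¹ * (jacobian T x).transpose))
      = (jacobian T x).transpose * 1 := by
    rw [← Matrix.mul_assoc, ← Matrix.mul_assoc, ← Matrix.mul_assoc, hT.jacobian_pullback hx,
      Matrix.mul_nonsing_inv _ hH, Matrix.one_mul, Matrix.mul_one]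
  have h2 := congrArg (fun B => (jacobian T x).transpose⁻¹ * B) h
  simpa only [← Matrix.mul_assoc, Matrix.nonsing_inv_mul _ hA, Matrix.one_mul] using h2

lemma partialDeriv_comp {T : Space → Space} {φ : Space → ℝ} {x : Space}
    (hT : DifferentiableAt ℝ T x) (hφ : DifferentiableAt ℝ φ (T x)) (k : Fin 3) :
    partialDeriv k (φ ∘ T) x = ∑ i, jacobian T x i k * partialDeriv i φ (T x) := by
  rw [partialDeriv, fderiv_comp x hφ hT, ContinuousLinearMap.comp_apply,
    fderiv_eq_sum_partialDeriv]
  rfl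

lemma IsHypIsometry.hypEnergy_comp {T : Space → Space} (hT : IsHypIsometry T) {φ ψ : Space → ℝ}
    {x : Space} (hx : x ∈ hypBall) (hφ : DifferentiableAt ℝ φ (T x))
    (hψ : DifferentiableAt ℝ ψ (T x)) :
    hypEnergy (ψ ∘ T) (φ ∘ T) x = |(fderiv ℝ T x).det| * hypEnergy ψ φ (T x) := by
  have h := hT.jacobian_pushforward hx
  have h' : ∀ i j, (hypMetric (T x))⁻¹ i j
      = ∑ l, (∑ k, jacobian T x i k * (hypMetric x)⁻¹ k l) * jacobian T x j l := fun i j => by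
    rw [← h]; simp only [Matrix.mul_apply, Matrix.transpose_apply]
  simp only [hypEnergy, hypFlux, partialDeriv_comp (hT.differentiableAt hx) hφ,
    partialDeriv_comp (hT.differentiableAt hx) hψ]
  rw [← hT.abs_det_mul_volDensity hx]
  simp only [h', Fin.sum_univ_three]
  ring

/-- The pull-back of a function on the ball, extended by zero. -/
def pullback (T : Space → Space) (φ : Space → ℝ) : Space → ℝ := hypBall.indicator (φ ∘ T)

lemma pullback_apply {T : Space → Space} {φ : Space → ℝ} {x : Space} (hx : x ∈ hypBall) :
    pullback T φ x = φ (T x) := by simp [pullback, hx]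

lemma pullback_eventuallyEq {T : Space → Space} {φ : Space → ℝ} {x : Space} (hx : x ∈ hypBall) :
    pullback T φ =ᶠ[nhds x] φ ∘ T := by
  filter_upwards [isOpen_hypBall.mem_nhds hx] with y hy
  exact pullback_apply hy

/-- `T` and `R` are mutually inverse isometries. -/
structure IsometryPair (T R : Space → Space) : Prop where
  left : IsHypIsometry T
  right : IsHypIsometry R
  inv_left : ∀ x ∈ hypBall, R (T x) = x
  inv_right : ∀ x ∈ hypBall, T (R x) = x

lemma isometryPair_boost {a : Space} (ha : a ∈ hypBall) :
    IsometryPair (boost a) (boost (-a)) :=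
  ⟨isHypIsometry_boost ha, isHypIsometry_boost (neg_mem_hypBall ha),
    fun _ hx => boost_neg_boost ha hx, fun _ hx => boost_boost_neg ha hx⟩

lemma IsometryPair.symm {T R : Space → Space} (h : IsometryPair T R) :
    IsometryPair R T := ⟨h.2, h.1, h.4, h.3⟩

lemma IsometryPair.isTestFunction_pullback {T R : Space → Space} (h : IsometryPair T R)
    {φ : Space → ℝ} (hφ : IsTestFunction hypBall φ) :
    IsTestFunction hypBall (pullback T φ) := by
  refine isTestFunction_of_contDiffOn (K := R '' tsupport φ) isOpen_hypBall ?_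
    (hφ.isCompact.image_of_continuousOn (h.right.2.1.continuousOn.mono hφ.2.2)) ?_ ?_
  · exact (hφ.1.comp_contDiffOn h.left.2.1).congr fun x hx => pullback_apply hx
  · rintro _ ⟨y, hy, rfl⟩
    exact h.right.1.mapsTo (hφ.2.2 hy)
  · intro x hx
    by_cases hxb : x ∈ hypBall
    · rw [pullback_apply hxb]
      by_contra hne
      exact hx ⟨T x, subset_tsupport _ hne, h.inv_left x hxb⟩
    · simp [pullback, hxb]

lemma IsometryPair.setIntegral_comp {T R : Space → Space} (h : IsometryPair T R)
    (f : Space → ℝ) :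
    ∫ x in hypBall, f x = ∫ x in hypBall, |(fderiv ℝ T x).det| * f (T x) := by
  have := integral_image_eq_integral_abs_det_fderiv_smul volume isOpen_hypBall.measurableSet
    (fun x hx => (h.left.differentiableAt hx).hasFDerivAt.hasFDerivWithinAt) h.left.1.injOn f
  rw [h.left.1.image_eq] at this
  simpa using this

lemma IsometryPair.setIntegral_comp_volDensity {T R : Space → Space} (h : IsometryPair T R)
    (f : Space → ℝ) :
    ∫ x in hypBall, f x * volDensity hypMetric x
      = ∫ x in hypBall, f (T x) * volDensity hypMetric x := by
  rw [h.setIntegral_comp]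
  refine setIntegral_congr_fun isOpen_hypBall.measurableSet fun x hx => ?_
  simp only [← h.left.abs_det_mul_volDensity hx]
  ring

/-- The hyperbolic Laplacian commutes with isometries. -/
lemma IsometryPair.laplaceBeltrami_pullback {T R : Space → Space} (h : IsometryPair T R)
    {φ : Space → ℝ} (hφ : IsTestFunction hypBall φ) :
    ∀ᵐ x : Space, x ∈ hypBall →
      laplaceBeltrami hypMetric (pullback T φ) x = laplaceBeltrami hypMetric φ (T x) := by
  have hpφ := h.isTestFunction_pullback hφ
  have hcont : ContinuousOn (fun x => volDensity hypMetric x *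
      (laplaceBeltrami hypMetric (pullback T φ) x - laplaceBeltrami hypMetric φ (T x))) hypBall :=
    contDiffOn_volDensity.continuousOn.mul (hpφ.laplacian.1.continuous.continuousOn.sub
      (hφ.laplacian.1.continuous.comp_continuousOn h.left.2.1.continuousOn))
  -- The comparison is weak: tested against `ψ`, both Laplacians give minus the same energy
  -- integral. The energy contains first derivatives only, so second derivatives of `T` never
  -- appear. Equality almost everywhere is enough under an integral.
  have key := isOpen_hypBall.ae_eq_zero_of_integral_contDiff_smul_eq_zero (μ := volume)
    (hcont.locallyIntegrableOn isOpen_hypBall.measurableSet) (fun ψ hψ1 hψ2 hψ3 => by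
    have hψ : IsTestFunction hypBall ψ := ⟨hψ1, hψ2, hψ3⟩
    have hpψ := h.symm.isTestFunction_pullback hψ
    have hback : ∀ x ∈ hypBall, pullback R ψ (T x) = ψ x := fun x hx => by
      rw [pullback_apply (h.left.1.mapsTo hx), h.inv_left x hx]
    have e1 := hψ.integral_mul_laplaceBeltrami hpφ
    have e2 := hpψ.integral_mul_laplaceBeltrami hφ
    have e3 : ∫ x in hypBall, hypEnergy (pullback R ψ) φ x
        = ∫ x in hypBall, hypEnergy ψ (pullback T φ) x := by
      rw [h.setIntegral_comp]
      refine setIntegral_congr_fun isOpen_hypBall.measurableSet fun x hx => ?_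
      have d1 := hφ.1.differentiable (by simp) (T x)
      have d2 := hpψ.1.differentiable (by simp) (T x)
      simp only [← h.left.hypEnergy_comp hx d1 d2]
      have g1 : pullback R ψ ∘ T =ᶠ[nhds x] ψ := by
        filter_upwards [isOpen_hypBall.mem_nhds hx] with y hy using hback y hy
      simp only [hypEnergy, partialDeriv_congr g1, hypFlux_congr (pullback_eventuallyEq hx)]
    have e4 : ∫ x in hypBall, pullback R ψ x *
        (volDensity hypMetric x * laplaceBeltrami hypMetric φ x)
        = ∫ x in hypBall, ψ x * (volDensity hypMetric x * laplaceBeltrami hypMetric φ (T x)) := by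
      have := h.setIntegral_comp_volDensity
        (fun x => pullback R ψ x * laplaceBeltrami hypMetric φ x)
      refine Eq.trans (integral_congr_ae (.of_forall fun x => by ring)) (this.trans ?_)
      refine setIntegral_congr_fun isOpen_hypBall.measurableSet fun x hx => ?_
      simp only [hback x hx]
      ring
    have e5 : ∫ x in hypBall, ψ x * (volDensity hypMetric x *
          laplaceBeltrami hypMetric (pullback T φ) x)
        = ∫ x in hypBall, ψ x * (volDensity hypMetric x * laplaceBeltrami hypMetric φ (T x)) := by
      rw [e1, ← e3, ← e2, e4]
    have i1 : IsTestFunction hypBall (fun x => (volDensity hypMetric x *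
        laplaceBeltrami hypMetric (pullback T φ) x) * ψ x) :=
      hψ.mul_contDiffOn isOpen_hypBall (contDiffOn_volDensity.mul hpφ.laplacian.1.contDiffOn)
    have i2 : IsTestFunction hypBall (fun x => (volDensity hypMetric x *
        laplaceBeltrami hypMetric φ (T x)) * ψ x) :=
      hψ.mul_contDiffOn isOpen_hypBall (contDiffOn_volDensity.mul
        (hφ.laplacian.1.comp_contDiffOn h.left.2.1))
    calc ∫ x, ψ x • (volDensity hypMetric x *
      (laplaceBeltrami hypMetric (pullback T φ) x - laplaceBeltrami hypMetric φ (T x)))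
        = (∫ x, (volDensity hypMetric x * laplaceBeltrami hypMetric (pullback T φ) x) * ψ x)
          - ∫ x, (volDensity hypMetric x * laplaceBeltrami hypMetric φ (T x)) * ψ x := by
          rw [← integral_sub i1.integrable i2.integrable]
          refine integral_congr_ae (.of_forall fun x => ?_)
          simp only [smul_eq_mul]
          ring
      _ = 0 := by
          rw [← i1.setIntegral_eq, ← i2.setIntegral_eq, sub_eq_zero]
          simpa only [mul_comm (ψ _)] using e5)
  filter_upwards [key] with x hx hxb
  have := (mul_eq_zero.1 (hx hxb)).resolve_left (volDensity_pos hxb).ne'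
  linarith

lemma IsometryPair.locallyIntegrableOn_comp {T R : Space → Space} (h : IsometryPair T R)
    {Φ : Space → ℝ}
    (hΦ : LocallyIntegrableOn Φ hypBall) : LocallyIntegrableOn (fun x => Φ (T x)) hypBall := by
  rw [locallyIntegrableOn_iff isOpen_hypBall.isLocallyClosed] at hΦ ⊢
  intro K hKb hK
  have hTK := hΦ (T '' K) ((Set.image_mono hKb).trans h.left.1.image_eq.subset)
    (hK.image_of_continuousOn (h.left.2.1.continuousOn.mono hKb))
  rw [integrableOn_image_iff_integrableOn_abs_det_fderiv_smul volume hK.measurableSet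
    (fun x hx => (h.left.differentiableAt (hKb hx)).hasFDerivAt.hasFDerivWithinAt)
    (h.left.1.injOn.mono hKb)] at hTK
  -- This quotient is the reciprocal of `|det dT|`; multiplying by it removes the Jacobian from
  -- `hTK`.
  have hc : ContinuousOn (fun x => volDensity hypMetric (T x) / volDensity hypMetric x) K :=
    ((contDiffOn_volDensity.continuousOn.comp h.left.2.1.continuousOn h.left.1.mapsTo).div
      contDiffOn_volDensity.continuousOn fun x hx => (volDensity_pos hx).ne').mono hKb
  have := hTK.continuousOn_mul hc hK
  refine this.congr_fun (fun x hx => ?_) hK.measurableSet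
  have h1 := h.left.abs_det_mul_volDensity (hKb hx)
  have h2 := volDensity_pos (hKb hx)
  have h3 : volDensity hypMetric (T x) / volDensity hypMetric x * |(fderiv ℝ T x).det| = 1 := by
    rw [div_mul_eq_mul_div, mul_comm, h1, div_self h2.ne']
  simp only [smul_eq_mul]
  rw [← mul_assoc, h3, one_mul]

/-- Isometries take solutions of the Helmholtz equation to solutions. -/
lemma IsometryPair.solvesHelmholtz_comp {T R : Space → Space} (h : IsometryPair T R)
    {Φ : Space → ℝ} {a : Space} {c : ℝ} (ha : a ∈ hypBall)
    (hΦ : SolvesHelmholtz Φ a c) : SolvesHelmholtz (fun x => Φ (T x)) (R a) c := by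
  refine ⟨h.locallyIntegrableOn_comp hΦ.1, fun φ hφ => ?_⟩
  have hp := h.symm.isTestFunction_pullback hφ
  have e := hΦ.2 _ hp
  rw [pullback_apply ha] at e
  rw [← e, h.symm.setIntegral_comp_volDensity
    (fun x => Φ (T x) * (laplaceBeltrami hypMetric φ x + φ x))]
  refine setIntegral_congr_ae isOpen_hypBall.measurableSet ?_
  filter_upwards [h.symm.laplaceBeltrami_pullback hφ] with x hx hxb
  rw [hx hxb, pullback_apply hxb, h.inv_right x hxb]

/-! ### Radial functions -/

lemma hasFDerivAt_norm_of_ne_zero {x : Space} (hx : x ≠ 0) :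
    HasFDerivAt (fun y : Space => ‖y‖) (‖x‖⁻¹ • innerSL ℝ x) x := by
  have hx' : 0 < ‖x‖ := norm_pos_iff.2 hx
  have h := (hasStrictFDerivAt_norm_sq x).hasFDerivAt.sqrt (by positivity)
  simp only [Real.sqrt_sq (norm_nonneg _)] at h
  refine h.congr_fderiv ?_
  ext v
  simp
  field_simp

lemma partialDeriv_radial {U : ℝ → ℝ} {U₁ : ℝ} {x : Space} (hx : x ≠ 0)
    (hU : HasDerivAt U U₁ ‖x‖) (i : Fin 3) :
    partialDeriv i (fun y => U ‖y‖) x = U₁ * (x i / ‖x‖) := by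
  have h := hU.comp_hasFDerivAt x (hasFDerivAt_norm_of_ne_zero hx)
  rw [partialDeriv, show (fun y : Space => U ‖y‖) = U ∘ fun y => ‖y‖ from rfl, h.fderiv]
  have hin : inner ℝ x (EuclideanSpace.single i (1 : ℝ)) = x i := by
    simp [EuclideanSpace.inner_single_right]
  change U₁ * (‖x‖⁻¹ * inner ℝ x (EuclideanSpace.single i (1 : ℝ))) = _
  rw [hin]
  ring

/-- Along `x` the matrix `√h h^{ij}` has eigenvalue `(1-ρ²)⁻¹ (1-ρ²) = 1`, so the flux of a radial
function is its flat gradient. -/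
lemma hypFlux_radial {U : ℝ → ℝ} {U₁ : ℝ} {x : Space} (hx : x ≠ 0) (hxb : x ∈ hypBall)
    (hU : HasDerivAt U U₁ ‖x‖) (i : Fin 3) :
    hypFlux (fun y => U ‖y‖) i x = U₁ * (x i / ‖x‖) := by
  have hx' : 0 < ‖x‖ := norm_pos_iff.2 hx
  have hq := one_sub_norm_sq_pos hxb
  have hs : ∑ j, x j * (U₁ * (x j / ‖x‖)) = U₁ * ‖x‖ := by
    have := norm_sq_eq_three x
    rw [Fin.sum_univ_three]
    field_simp
    linear_combination (-U₁) * this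
  rw [hypFlux_eq hxb]
  simp only [partialDeriv_radial hx hU]
  rw [hs]
  field_simp

/-- On radial functions `√h Δ_h` is the flat radial Laplacian. -/
lemma volDensity_mul_laplaceBeltrami_radial {U U₁ : ℝ → ℝ} {U₂ : ℝ} {x : Space} (hx : x ≠ 0)
    (hxb : x ∈ hypBall) (hU : ∀ᶠ r in nhds ‖x‖, HasDerivAt U (U₁ r) r)
    (hU₁ : HasDerivAt U₁ U₂ ‖x‖) :
    volDensity hypMetric x * laplaceBeltrami hypMetric (fun y => U ‖y‖) x
      = U₂ + 2 * U₁ ‖x‖ / ‖x‖ := by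
  have hx' : 0 < ‖x‖ := norm_pos_iff.2 hx
  rw [volDensity_mul_laplaceBeltrami hxb]
  have h1 : ∀ i, hypFlux (fun y => U ‖y‖) i =ᶠ[nhds x] fun y => U₁ ‖y‖ / ‖y‖ * y i := fun i => by
    filter_upwards [continuous_norm.continuousAt.eventually hU, isOpen_hypBall.mem_nhds hxb,
      isOpen_compl_singleton.mem_nhds hx] with y hy hyb hy0
    rw [hypFlux_radial hy0 hyb hy]
    ring
  have hW : HasDerivAt (fun r => U₁ r / r) ((U₂ * ‖x‖ - U₁ ‖x‖ * 1) / ‖x‖ ^ 2) ‖x‖ :=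
    hU₁.div (hasDerivAt_id _) hx'.ne'
  have h2 : ∀ i, partialDeriv i (fun y : Space => U₁ ‖y‖ / ‖y‖ * y i) x
      = (U₂ * ‖x‖ - U₁ ‖x‖) / ‖x‖ ^ 2 * (x i / ‖x‖) * x i + U₁ ‖x‖ / ‖x‖ := fun i => by
    have d1 := hW.comp_hasFDerivAt x (hasFDerivAt_norm_of_ne_zero hx)
    have d2 : HasFDerivAt (fun y : Space => y i) (EuclideanSpace.proj i : Space →L[ℝ] ℝ) x :=
      (EuclideanSpace.proj (𝕜 := ℝ) i).hasFDerivAt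
    have d3 : HasFDerivAt (fun y : Space => U₁ ‖y‖ / ‖y‖ * y i) _ x := d1.mul d2
    rw [partialDeriv, d3.fderiv]
    simp [EuclideanSpace.inner_single_right]
    field_simp
    ring
  simp only [partialDeriv_congr (h1 _), h2, Fin.sum_univ_three]
  have := norm_sq_eq_three x
  field_simp
  linear_combination (U₁ ‖x‖ - U₂ * ‖x‖) * this

/-- The Helmholtz operator on the functions `√(1-ρ²) g(ρ)/ρ`. -/
lemma helmholtz_radial {g g₁ : ℝ → ℝ} {g₂ : ℝ} {x : Space} (hx : x ≠ 0)
    (hxb : x ∈ hypBall) (hg : ∀ᶠ r in nhds ‖x‖, HasDerivAt g (g₁ r) r)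
    (hg₁ : HasDerivAt g₁ g₂ ‖x‖) :
    volDensity hypMetric x *
        (laplaceBeltrami hypMetric (fun y => Real.sqrt (1 - ‖y‖ ^ 2) * (g ‖y‖ / ‖y‖)) x
          + Real.sqrt (1 - ‖x‖ ^ 2) * (g ‖x‖ / ‖x‖))
      = ((1 - ‖x‖ ^ 2) * g₂ - 2 * ‖x‖ * g₁ ‖x‖) / (‖x‖ * Real.sqrt (1 - ‖x‖ ^ 2)) := by
  have hx' : 0 < ‖x‖ := norm_pos_iff.2 hx
  have hq := one_sub_norm_sq_pos hxb
  have hS : ∀ r : ℝ, 0 < 1 - r ^ 2 → HasDerivAt (fun r : ℝ => Real.sqrt (1 - r ^ 2))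
      (-r / Real.sqrt (1 - r ^ 2)) r := fun r hr => by
    have h1 : HasDerivAt (fun r : ℝ => 1 - r ^ 2) (-(2 * r)) r := by
      simpa using (hasDerivAt_pow 2 r).const_sub 1
    refine (h1.sqrt hr.ne').congr_deriv ?_
    have := Real.sqrt_pos.2 hr
    field_simp
  have hU : ∀ᶠ r in nhds ‖x‖, HasDerivAt (fun r => Real.sqrt (1 - r ^ 2) * (g r / r))
      (-r / Real.sqrt (1 - r ^ 2) * (g r / r)
        + Real.sqrt (1 - r ^ 2) * ((g₁ r * r - g r * 1) / r ^ 2)) r := by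
    have hc : ContinuousAt (fun r : ℝ => 1 - r ^ 2) ‖x‖ := by fun_prop
    filter_upwards [hg, hc.eventually_const_lt hq, lt_mem_nhds hx'] with r h1 h2 h3
    exact (hS r h2).mul (h1.div (hasDerivAt_id r) h3.ne')
  have hs := Real.sqrt_pos.2 hq
  have d1 := hg.self_of_nhds
  have d2 := hS _ hq
  have dn := hasDerivAt_id (‖x‖ : ℝ)
  have hU₁ : HasDerivAt (fun r : ℝ => -r / Real.sqrt (1 - r ^ 2) * (g r / r)
      + Real.sqrt (1 - r ^ 2) * ((g₁ r * r - g r * 1) / r ^ 2)) _ ‖x‖ :=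
    ((dn.neg.div d2 hs.ne').mul (d1.div dn hx'.ne')).add
      (d2.mul (((hg₁.mul dn).sub (d1.mul_const 1)).div (hasDerivAt_pow 2 _) (by positivity)))
  rw [mul_add, volDensity_mul_laplaceBeltrami_radial (U := fun r => Real.sqrt (1 - r ^ 2) * (g r / r))
    hx hxb hU hU₁, volDensity_hypMetric hxb]
  simp only [id_eq, Pi.neg_apply, Pi.mul_apply, Pi.sub_apply, Pi.div_apply, Nat.cast_ofNat]
  have hs2 : Real.sqrt (1 - ‖x‖ ^ 2) ^ 2 = 1 - ‖x‖ ^ 2 := Real.sq_sqrt hq.le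
  generalize Real.sqrt (1 - ‖x‖ ^ 2) = s at hs hs2 ⊢
  generalize ‖x‖ = r at *
  rw [← hs2]
  -- The identity holds only modulo `r² + s² = 1`, so the higher powers of `r` are reduced by this
  -- relation.
  have hr2 : r ^ 2 = 1 - s ^ 2 := by rw [hs2]; ring
  field_simp
  ring_nf
  have h4 : r ^ 4 = (1 - s ^ 2) ^ 2 := by rw [← hr2]; ring
  have h3 : r ^ 3 = r * (1 - s ^ 2) := by rw [← hr2]; ring
  have h5 : r ^ 5 = r * (1 - s ^ 2) ^ 2 := by rw [← hr2]; ring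
  simp only [h3, h4, h5]
  ring

/-! ### A regularized and truncated Green function -/

/-- A smooth step from `0` (for `s ≤ 1/3`) to `1` (for `s ≥ 2/3`). -/
def coreCutoff (s : ℝ) : ℝ := Real.smoothTransition (3 * s - 1)

/-- A smooth function equal to `s` for `s ≤ 1/3` and to `1` for `s ≥ 2/3`. -/
def coreProfile (s : ℝ) : ℝ := s * (1 - coreCutoff s) + coreCutoff s

/-- A smooth step from `1` (for `t ≤ 1`) to `0` (for `t ≥ 2`). -/
def tailCutoff (t : ℝ) : ℝ := 1 - Real.smoothTransition (t - 1)

lemma contDiff_coreCutoff : ContDiff ℝ ∞ coreCutoff :=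
  Real.smoothTransition.contDiff.comp ((contDiff_const.mul contDiff_id).sub contDiff_const)

lemma contDiff_coreProfile : ContDiff ℝ ∞ coreProfile :=
  (contDiff_id.mul (contDiff_const.sub contDiff_coreCutoff)).add contDiff_coreCutoff

lemma contDiff_tailCutoff : ContDiff ℝ ∞ tailCutoff :=
  contDiff_const.sub (Real.smoothTransition.contDiff.comp (contDiff_id.sub contDiff_const))

lemma coreCutoff_of_le {s : ℝ} (hs : s ≤ 1 / 3) : coreCutoff s = 0 :=
  Real.smoothTransition.zero_of_nonpos (by linarith)

lemma coreCutoff_of_ge {s : ℝ} (hs : 2 / 3 ≤ s) : coreCutoff s = 1 :=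
  Real.smoothTransition.one_of_one_le (by linarith)

lemma coreProfile_of_le {s : ℝ} (hs : s ≤ 1 / 3) : coreProfile s = s := by
  simp [coreProfile, coreCutoff_of_le hs]

lemma coreProfile_of_ge {s : ℝ} (hs : 2 / 3 ≤ s) : coreProfile s = 1 := by
  simp [coreProfile, coreCutoff_of_ge hs]

lemma coreProfile_nonneg {s : ℝ} (hs : 0 ≤ s) : 0 ≤ coreProfile s := by
  have h1 := Real.smoothTransition.nonneg (3 * s - 1)
  have h2 := Real.smoothTransition.le_one (3 * s - 1)
  unfold coreProfile coreCutoff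
  nlinarith

lemma coreProfile_le_one {s : ℝ} : coreProfile s ≤ 1 := by
  rcases le_total (2 / 3) s with h | h
  · rw [coreProfile_of_ge h]
  have h1 := Real.smoothTransition.nonneg (3 * s - 1)
  have h2 := Real.smoothTransition.le_one (3 * s - 1)
  unfold coreProfile coreCutoff
  nlinarith

lemma tailCutoff_of_le {t : ℝ} (ht : t ≤ 1) : tailCutoff t = 1 := by
  simp [tailCutoff, Real.smoothTransition.zero_of_nonpos (show t - 1 ≤ 0 by linarith)]

lemma tailCutoff_of_ge {t : ℝ} (ht : 2 ≤ t) : tailCutoff t = 0 := by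
  simp [tailCutoff, Real.smoothTransition.one_of_one_le (show 1 ≤ t - 1 by linarith)]

lemma tailCutoff_nonneg (t : ℝ) : 0 ≤ tailCutoff t :=
  sub_nonneg.2 (Real.smoothTransition.le_one _)

lemma tailCutoff_le_one (t : ℝ) : tailCutoff t ≤ 1 := by
  have := Real.smoothTransition.nonneg (t - 1)
  unfold tailCutoff
  linarith

lemma contDiff_deriv_of_contDiff {f : ℝ → ℝ} (hf : ContDiff ℝ ∞ f) : ContDiff ℝ ∞ (deriv f) :=
  (contDiff_infty_iff_deriv.1 hf).2

lemma hasDerivAt_of_contDiff {f : ℝ → ℝ} (hf : ContDiff ℝ ∞ f) (s : ℝ) :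
    HasDerivAt f (deriv f s) s :=
  (hf.differentiable (by simp) s).hasDerivAt

lemma deriv_coreProfile_of_gt {s : ℝ} (hs : 2 / 3 < s) : deriv coreProfile s = 0 := by
  have : coreProfile =ᶠ[nhds s] fun _ => 1 := by
    filter_upwards [lt_mem_nhds hs] with t ht using coreProfile_of_ge ht.le
  rw [this.deriv_eq, deriv_const]

lemma deriv_coreProfile_of_lt {s : ℝ} (hs : s < 1 / 3) : deriv coreProfile s = 1 := by
  have : coreProfile =ᶠ[nhds s] id := by
    filter_upwards [gt_mem_nhds hs] with t ht using coreProfile_of_le ht.le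
  rw [this.deriv_eq, deriv_id]

lemma deriv_deriv_coreProfile_of_gt {s : ℝ} (hs : 2 / 3 < s) :
    deriv (deriv coreProfile) s = 0 := by
  have : deriv coreProfile =ᶠ[nhds s] fun _ => 0 := by
    filter_upwards [lt_mem_nhds hs] with t ht using deriv_coreProfile_of_gt ht
  rw [this.deriv_eq, deriv_const]

lemma deriv_deriv_coreProfile_of_lt {s : ℝ} (hs : s < 1 / 3) :
    deriv (deriv coreProfile) s = 0 := by
  have : deriv coreProfile =ᶠ[nhds s] fun _ => 1 := by
    filter_upwards [gt_mem_nhds hs] with t ht using deriv_coreProfile_of_lt ht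
  rw [this.deriv_eq, deriv_const]

lemma deriv_deriv_eq_zero_of_eventually_const {f : ℝ → ℝ} {c s : ℝ}
    (h : f =ᶠ[nhds s] fun _ => c) : deriv (deriv f) s = 0 := by
  have : deriv f =ᶠ[nhds s] fun _ => 0 := by
    filter_upwards [h.eventuallyEq_nhds] with t ht
    rw [ht.deriv_eq, deriv_const]
  rw [this.deriv_eq, deriv_const]

lemma deriv_deriv_tailCutoff_of_lt {t : ℝ} (ht : t < 1) : deriv (deriv tailCutoff) t = 0 :=
  deriv_deriv_eq_zero_of_eventually_const (c := 1) (by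
    filter_upwards [gt_mem_nhds ht] with t ht using tailCutoff_of_le ht.le)

lemma deriv_deriv_tailCutoff_of_gt {t : ℝ} (ht : 2 < t) : deriv (deriv tailCutoff) t = 0 :=
  deriv_deriv_eq_zero_of_eventually_const (c := 0) (by
    filter_upwards [lt_mem_nhds ht] with t ht using tailCutoff_of_ge ht.le)

lemma continuous_deriv_deriv_tailCutoff : Continuous (deriv (deriv tailCutoff)) :=
  (contDiff_deriv_of_contDiff (contDiff_deriv_of_contDiff contDiff_tailCutoff)).continuous

lemma exists_bound_deriv_deriv_tailCutoff : ∃ K, 0 ≤ K ∧ ∀ t, |deriv (deriv tailCutoff) t| ≤ K := by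
  obtain ⟨K, hK⟩ := isCompact_Icc.exists_bound_of_continuousOn (s := Set.Icc (1 : ℝ) 2)
    continuous_deriv_deriv_tailCutoff.continuousOn
  have hK0 : 0 ≤ K := (norm_nonneg _).trans (hK 1 ⟨le_rfl, by norm_num⟩)
  refine ⟨K, hK0, fun t => ?_⟩
  rcases lt_or_ge t 1 with h | h
  · simpa [deriv_deriv_tailCutoff_of_lt h] using hK0
  rcases lt_or_ge 2 t with ht | ht
  · simpa [deriv_deriv_tailCutoff_of_gt ht] using hK0
  · exact hK t ⟨h, ht⟩

/-- The function `√(1-ρ²)/ρ`, smoothed inside `ρ < δ` and cut off at distance of order `1/ε`. -/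
def cutGreen (δ ε : ℝ) (x : Space) : ℝ :=
  Real.sqrt (1 - ‖x‖ ^ 2) *
    ((1 - coreCutoff (‖x‖ / δ)) / δ + coreCutoff (‖x‖ / δ) / ‖x‖) *
    tailCutoff (ε * Real.artanh ‖x‖)

/-- This is the shape `√(1-ρ²) g(ρ)/ρ` required by `helmholtz_radial`; the form in the definition is
the one that makes sense at the centre. -/
lemma cutGreen_eq {δ ε : ℝ} (hδ : δ ≠ 0) {x : Space} (hx : x ≠ 0) :
    cutGreen δ ε x = Real.sqrt (1 - ‖x‖ ^ 2) *
      (coreProfile (‖x‖ / δ) * tailCutoff (ε * Real.artanh ‖x‖) / ‖x‖) := by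
  have hx' : ‖x‖ ≠ 0 := norm_ne_zero_iff.2 hx
  rw [cutGreen, coreProfile]
  field_simp

lemma contDiffAt_artanh {s : ℝ} (hs : |s| < 1) : ContDiffAt ℝ ∞ Real.artanh s := by
  obtain ⟨h1, h2⟩ := abs_lt.1 hs
  have h3 : 0 < 1 + s := by linarith
  have h4 : 0 < 1 - s := by linarith
  have h : ContDiffAt ℝ ∞ (fun s : ℝ => 1 / 2 * Real.log ((1 + s) / (1 - s))) s := by
    refine contDiffAt_const.mul (ContDiffAt.log ?_ (by positivity))
    exact (contDiffAt_const.add contDiffAt_id).div (contDiffAt_const.sub contDiffAt_id) h4.ne'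
  refine h.congr_of_eventuallyEq ?_
  filter_upwards [Ioo_mem_nhds h1 h2] with t ht
  exact Real.artanh_eq_half_log ⟨ht.1.le, ht.2.le⟩

lemma abs_norm_lt_one {x : Space} (hx : x ∈ hypBall) : |‖x‖| < 1 := by
  rw [abs_norm]; exact mem_hypBall.1 hx

lemma isTestFunction_cutGreen {δ ε : ℝ} (hε : 0 < ε) :
    IsTestFunction hypBall (cutGreen δ ε) := by
  have ht : Real.tanh (2 / ε) < 1 := Real.tanh_lt_one _
  have hsq : ContDiffOn ℝ ∞ (fun x : Space => Real.sqrt (1 - ‖x‖ ^ 2)) hypBall :=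
    ContDiffOn.sqrt (contDiff_const.sub (contDiff_norm_sq ℝ)).contDiffOn
      fun x hx => (one_sub_norm_sq_pos hx).ne'
  -- Beyond radius `tanh (2/ε)` one has `ε artanh ρ > 2`, where `tailCutoff` is zero.
  refine isTestFunction_of_contDiffOn (K := Metric.closedBall 0 (Real.tanh (2 / ε)))
    isOpen_hypBall (fun x hx => ContDiffAt.contDiffWithinAt ?_) (isCompact_closedBall _ _)
    (fun x hx => ?_) (fun x hx => ?_)
  · have hsq' := hsq.contDiffAt (isOpen_hypBall.mem_nhds hx)
    rcases eq_or_ne x 0 with rfl | hx0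
    · refine (hsq'.mul (contDiffAt_const (c := 1 / δ))).congr_of_eventuallyEq ?_
      have hc1 : ContinuousAt (fun x : Space => ‖x‖ / δ) 0 := by fun_prop
      have hc2 : ContinuousAt (fun x : Space => ε * Real.artanh ‖x‖) 0 :=
        continuousAt_const.mul (ContinuousAt.comp (f := fun x : Space => ‖x‖)
          (contDiffAt_artanh (abs_norm_lt_one hx)).continuousAt continuous_norm.continuousAt)
      filter_upwards [hc1.eventually_lt_const (show ‖(0 : Space)‖ / δ < 1 / 3 by simp),
        hc2.eventually_lt_const (show ε * Real.artanh ‖(0 : Space)‖ < 1 by simp)] with y h1 h2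
      rw [cutGreen, coreCutoff_of_le h1.le, tailCutoff_of_le h2.le]
      simp
    · have hn : ContDiffAt ℝ ∞ (fun x : Space => ‖x‖) x := contDiffAt_norm ℝ hx0
      have hcc : ContDiffAt ℝ ∞ (fun x : Space => coreCutoff (‖x‖ / δ)) x :=
        contDiff_coreCutoff.contDiffAt.comp x (hn.div_const δ)
      have htc : ContDiffAt ℝ ∞ (fun x : Space => tailCutoff (ε * Real.artanh ‖x‖)) x :=
        contDiff_tailCutoff.contDiffAt.comp x (contDiffAt_const.mul
          (ContDiffAt.comp (f := fun x : Space => ‖x‖) (g := Real.artanh) x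
            (contDiffAt_artanh (abs_norm_lt_one hx)) hn))
      exact (hsq'.mul (((contDiffAt_const.sub hcc).div_const δ).add
        (hcc.div hn (norm_ne_zero_iff.2 hx0)))).mul htc
  · rw [mem_closedBall_zero_iff] at hx
    exact mem_hypBall.2 (hx.trans_lt ht)
  · rw [mem_closedBall_zero_iff, not_le] at hx
    rcases lt_or_ge ‖x‖ 1 with h1 | h1
    · have h0 : -1 < Real.tanh (2 / ε) := Real.neg_one_lt_tanh _
      have := Real.artanh_lt_artanh h0 h1 hx
      rw [Real.artanh_tanh, div_lt_iff₀' hε] at this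
      rw [cutGreen, tailCutoff_of_ge this.le, mul_zero]
    -- `Real.sqrt` is `0` on nonpositive numbers, so the value of `artanh` outside the unit ball is
    -- irrelevant.
    · rw [cutGreen, Real.sqrt_eq_zero_of_nonpos (by nlinarith), zero_mul, zero_mul]

/-- The source of `cutGreen` near the pole. -/
def coreSource (δ r : ℝ) : ℝ :=
  ((1 - r ^ 2) * (deriv (deriv coreProfile) (r / δ) / δ ^ 2)
    - 2 * r * (deriv coreProfile (r / δ) / δ)) / (r * Real.sqrt (1 - r ^ 2))

/-- The source of `cutGreen` far from the pole. -/
def tailSource (ε r : ℝ) : ℝ :=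
  ε ^ 2 * deriv (deriv tailCutoff) (ε * Real.artanh r) / ((1 - r ^ 2) * (r * Real.sqrt (1 - r ^ 2)))

/-- The condition `ε artanh δ < 1` separates the two cutoffs: the tail cutoff is constantly `1` for
`ρ < δ`, so only the core profile is differentiated. -/
lemma helmholtz_cutGreen_core {δ ε : ℝ} (hδ : 0 < δ) (hδ1 : δ < 1) (hε : 0 < ε)
    (hεδ : ε * Real.artanh δ < 1) {x : Space} (hx : x ≠ 0) (hxδ : ‖x‖ < δ) :
    volDensity hypMetric x * (laplaceBeltrami hypMetric (cutGreen δ ε) x + cutGreen δ ε x)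
      = coreSource δ ‖x‖ := by
  have hxb : x ∈ hypBall := mem_hypBall.2 (hxδ.trans hδ1)
  have hE : cutGreen δ ε =ᶠ[nhds x]
      fun y => Real.sqrt (1 - ‖y‖ ^ 2) * (coreProfile (‖y‖ / δ) / ‖y‖) := by
    filter_upwards [isOpen_compl_singleton.mem_nhds hx,
      continuous_norm.continuousAt.eventually_lt_const hxδ] with y hy0 hyδ
    have h1 : Real.artanh ‖y‖ < Real.artanh δ :=
      Real.artanh_lt_artanh (by linarith [norm_nonneg y]) hδ1 hyδ
    have h2 : ε * Real.artanh ‖y‖ ≤ 1 := by nlinarith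
    rw [cutGreen_eq hδ.ne' hy0, tailCutoff_of_le h2, mul_one]
  have hs : ∀ r : ℝ, HasDerivAt (fun r : ℝ => r / δ) (1 / δ) r := fun r =>
    (hasDerivAt_id r).div_const δ
  have d1 : ∀ r : ℝ, HasDerivAt (fun r => coreProfile (r / δ))
      (deriv coreProfile (r / δ) * (1 / δ)) r := fun r =>
    HasDerivAt.comp (h := fun r => r / δ) r
      (hasDerivAt_of_contDiff contDiff_coreProfile (r / δ)) (hs r)
  have d2 : HasDerivAt (fun r => deriv coreProfile (r / δ))
      (deriv (deriv coreProfile) (‖x‖ / δ) * (1 / δ)) ‖x‖ :=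
    HasDerivAt.comp (h := fun r => r / δ) ‖x‖
      (hasDerivAt_of_contDiff (contDiff_deriv_of_contDiff contDiff_coreProfile) (‖x‖ / δ))
      (hs ‖x‖)
  rw [laplaceBeltrami_congr hE, hE.eq_of_nhds,
    helmholtz_radial hx hxb (.of_forall d1) (d2.mul_const (1 / δ))]
  rw [coreSource]
  congr 1
  field_simp

/-- The core profile is `1` from `ρ = 2δ/3` on, hence in a neighbourhood of every point with `ρ ≥
δ`. Only second derivatives of `tailCutoff` with respect to distance survive. -/
lemma helmholtz_cutGreen_tail {δ ε : ℝ} (hδ : 0 < δ) {x : Space} (hxb : x ∈ hypBall)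
    (hxδ : δ ≤ ‖x‖) :
    volDensity hypMetric x * (laplaceBeltrami hypMetric (cutGreen δ ε) x + cutGreen δ ε x)
      = tailSource ε ‖x‖ := by
  have hx' : 0 < ‖x‖ := hδ.trans_le hxδ
  have hx : x ≠ 0 := norm_pos_iff.1 hx'
  have hq := one_sub_norm_sq_pos hxb
  have hE : cutGreen δ ε =ᶠ[nhds x]
      fun y => Real.sqrt (1 - ‖y‖ ^ 2) * (tailCutoff (ε * Real.artanh ‖y‖) / ‖y‖) := by
    filter_upwards [isOpen_compl_singleton.mem_nhds hx, continuous_norm.continuousAt.eventually_const_lt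
      (show 2 / 3 * δ < ‖x‖ by linarith)] with y hy0 hyδ
    rw [cutGreen_eq hδ.ne' hy0, coreProfile_of_ge ((le_div_iff₀ hδ).2 hyδ.le), one_mul]
  have ha : ∀ r : ℝ, |r| < 1 → HasDerivAt (fun r => ε * Real.artanh r) (ε * (1 - r ^ 2)⁻¹) r :=
    fun r hr => (hasDerivAt_artanh hr).const_mul ε
  have d1 : ∀ᶠ r in nhds ‖x‖, HasDerivAt (fun r => tailCutoff (ε * Real.artanh r))
      (deriv tailCutoff (ε * Real.artanh r) * (ε * (1 - r ^ 2)⁻¹)) r := by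
    filter_upwards [continuous_abs.continuousAt.eventually_lt_const (abs_norm_lt_one hxb)] with r hr
    exact (hasDerivAt_of_contDiff contDiff_tailCutoff _).comp r (ha r hr)
  have d2 := (hasDerivAt_of_contDiff (contDiff_deriv_of_contDiff contDiff_tailCutoff)
    (ε * Real.artanh ‖x‖)).comp ‖x‖ (ha ‖x‖ (abs_norm_lt_one hxb))
  have d3 : HasDerivAt (fun r : ℝ => ε * (1 - r ^ 2)⁻¹)
      (ε * (2 * ‖x‖ / (1 - ‖x‖ ^ 2) ^ 2)) ‖x‖ := by
    have h1 : HasDerivAt (fun r : ℝ => 1 - r ^ 2) (-(2 * ‖x‖)) ‖x‖ := by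
      simpa using (hasDerivAt_pow 2 ‖x‖).const_sub 1
    have := (h1.inv hq.ne').const_mul ε
    simpa using this
  rw [laplaceBeltrami_congr hE, hE.eq_of_nhds,
    helmholtz_radial (g := fun r => tailCutoff (ε * Real.artanh r)) hx hxb d1 (d2.mul d3)]
  simp only [Function.comp_apply]
  rw [tailSource]
  have hs := Real.sqrt_pos.2 hq
  field_simp
  ring

/-! ### Concentration of the regularized source -/

lemma integral_radial (f : ℝ → ℝ) :
    ∫ x : Space, f ‖x‖ = 4 * Real.pi * ∫ y in Set.Ioi (0 : ℝ), y ^ 2 * f y := by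
  have h := integral_fun_norm_addHaar (volume : Measure Space) f
  have hv : (volume : Measure Space).real (Metric.ball 0 1) = Real.pi * 4 / 3 := by
    rw [Measure.real, EuclideanSpace.volume_ball_fin_three]
    simp
    positivity
  rw [h, hv, finrank_euclideanSpace]
  simp
  ring

/-- The integrand is the flat Laplacian of the smoothed Coulomb potential `coreProfile ρ / ρ`.
Radially the integral is `4π ∫ s κ''(s) ds`, where `κ = coreProfile` and `s κ' - κ` is a primitive.
-/
lemma integral_deriv_deriv_coreProfile :
    ∫ y : Space, deriv (deriv coreProfile) ‖y‖ / ‖y‖ = -(4 * Real.pi) := by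
  have hc := (contDiff_deriv_of_contDiff (contDiff_deriv_of_contDiff contDiff_coreProfile)).continuous
  have h1 : ∫ y in Set.Ioi (0 : ℝ), y ^ 2 * (deriv (deriv coreProfile) y / y)
      = ∫ y in Set.Ioc (0 : ℝ) 1, y * deriv (deriv coreProfile) y := by
    symm
    rw [← integral_indicator measurableSet_Ioc, ← integral_indicator measurableSet_Ioi]
    congr 1
    ext y
    rcases le_or_gt y 0 with hy | hy
    · rw [Set.indicator_of_notMem (by simp [hy]), Set.indicator_of_notMem (by simp [hy])]
    rw [Set.indicator_of_mem (Set.mem_Ioi.2 hy)]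
    rcases le_or_gt y 1 with hy1 | hy1
    · rw [Set.indicator_of_mem (Set.mem_Ioc.2 ⟨hy, hy1⟩)]; field_simp
    · rw [Set.indicator_of_notMem (by simp [hy1]),
        deriv_deriv_coreProfile_of_gt (by linarith)]
      simp
  have h2 : ∫ y in (0 : ℝ)..1, y * deriv (deriv coreProfile) y = -1 := by
    rw [intervalIntegral.integral_eq_sub_of_hasDerivAt
      (f := fun y => y * deriv coreProfile y - coreProfile y)]
    · rw [deriv_coreProfile_of_gt (by norm_num), coreProfile_of_ge (by norm_num),
        coreProfile_of_le (by norm_num)]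
      simp
    · intro y _
      have := ((hasDerivAt_id y).mul (hasDerivAt_of_contDiff
        (contDiff_deriv_of_contDiff contDiff_coreProfile) y)).sub
        (hasDerivAt_of_contDiff contDiff_coreProfile y)
      refine this.congr_deriv ?_
      simp
    · exact (continuous_id.mul hc).intervalIntegrable _ _
  rw [integral_radial (fun r => deriv (deriv coreProfile) r / r), h1,
    ← intervalIntegral.integral_of_le zero_le_one, h2]
  ring

/-- The source near the pole in the rescaled variable `s = r/δ`. -/
def scaledSource (δ s : ℝ) : ℝ :=
  ((1 - (δ * s) ^ 2) * deriv (deriv coreProfile) s - 2 * δ ^ 2 * s * deriv coreProfile s)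
    / (s * Real.sqrt (1 - (δ * s) ^ 2))

/-- The factor `δ³` is the Jacobian of the dilation `x = δ y` in three dimensions. -/
lemma cube_mul_coreSource {δ : ℝ} (hδ : 0 < δ) (s : ℝ) :
    δ ^ 3 * coreSource δ (δ * s) = scaledSource δ s := by
  rw [coreSource, scaledSource, mul_div_cancel_left₀ _ hδ.ne']
  field_simp

lemma exists_bound_scaledSource : ∃ C, 0 ≤ C ∧ ∀ δ s : ℝ, 0 < δ → δ ≤ 1 / 2 → 0 ≤ s → s ≤ 1 →
    |scaledSource δ s| ≤ C := by
  have hc1 := (contDiff_deriv_of_contDiff contDiff_coreProfile).continuous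
  have hc2 := (contDiff_deriv_of_contDiff (contDiff_deriv_of_contDiff contDiff_coreProfile)).continuous
  obtain ⟨K₁, hK₁⟩ := isCompact_Icc.exists_bound_of_continuousOn (s := Set.Icc (0 : ℝ) 1)
    hc1.continuousOn
  obtain ⟨K₂, hK₂⟩ := isCompact_Icc.exists_bound_of_continuousOn (s := Set.Icc (0 : ℝ) 1)
    hc2.continuousOn
  have hK₁0 : 0 ≤ K₁ := (norm_nonneg _).trans (hK₁ 0 ⟨le_rfl, by norm_num⟩)
  have hK₂0 : 0 ≤ K₂ := (norm_nonneg _).trans (hK₂ 0 ⟨le_rfl, by norm_num⟩)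
  refine ⟨2 * (3 * K₂ + K₁), by positivity, fun δ s hδ hδ2 hs hs1 => ?_⟩
  rcases hs.eq_or_lt with rfl | hs0
  · simp [scaledSource]; positivity
  have hds : δ * s ≤ 1 / 2 := by nlinarith
  have hds0 : 0 < δ * s := by positivity
  have hq : (1 / 2) ^ 2 ≤ 1 - (δ * s) ^ 2 := by nlinarith
  have hsq : 1 / 2 ≤ Real.sqrt (1 - (δ * s) ^ 2) := Real.le_sqrt_of_sq_le hq
  -- The second derivative vanishes for `s < 1/3`, which absorbs the factor `1/s`. The root is at
  -- least `1/2` since `δ s ≤ 1/2`, whence the `2` in the constant.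
  have h2 : |deriv (deriv coreProfile) s| ≤ 3 * K₂ * s := by
    rcases lt_or_ge s (1 / 3) with h | h
    · rw [deriv_deriv_coreProfile_of_lt h, abs_zero]; positivity
    · refine (hK₂ s ⟨hs, hs1⟩).trans ?_
      nlinarith
  have h1 : |deriv coreProfile s| ≤ K₁ := hK₁ s ⟨hs, hs1⟩
  rw [scaledSource, abs_div, abs_of_pos (by positivity : 0 < s * Real.sqrt (1 - (δ * s) ^ 2)),
    div_le_iff₀ (by positivity)]
  have h3 : |(1 - (δ * s) ^ 2) * deriv (deriv coreProfile) s| ≤ 3 * K₂ * s := by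
    rw [abs_mul, abs_of_nonneg (by nlinarith : 0 ≤ 1 - (δ * s) ^ 2)]
    exact (mul_le_of_le_one_left (abs_nonneg _) (by nlinarith)).trans h2
  have h4 : |2 * δ ^ 2 * s * deriv coreProfile s| ≤ s * K₁ := by
    rw [abs_mul, abs_of_nonneg (by positivity : 0 ≤ 2 * δ ^ 2 * s)]
    have : 2 * δ ^ 2 * s ≤ s := by nlinarith
    gcongr
  calc _ ≤ 3 * K₂ * s + s * K₁ := (abs_sub _ _).trans (add_le_add h3 h4)
    _ = 2 * (3 * K₂ + K₁) * (s * (1 / 2)) := by ring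
    _ ≤ _ := by gcongr

lemma tendsto_scaledSource (s : ℝ) :
    Tendsto (fun δ => scaledSource δ s) (𝓝[>] 0) (𝓝 (deriv (deriv coreProfile) s / s)) := by
  rcases eq_or_ne s 0 with rfl | hs
  -- At `s = 0` both sides are `0`, as quotients by zero.
  · simp [scaledSource]
  have hc : ContinuousAt (fun δ => scaledSource δ s) 0 := by
    unfold scaledSource
    refine ContinuousAt.div (by fun_prop) (by fun_prop) ?_
    simp [hs]
  have h := hc.tendsto.mono_left (nhdsWithin_le_nhds (s := Set.Ioi 0))
  simpa [scaledSource] using h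

lemma measurable_scaledSource (δ : ℝ) : Measurable (scaledSource δ) := by
  have hc1 := (contDiff_deriv_of_contDiff contDiff_coreProfile).continuous.measurable
  have hc2 := (contDiff_deriv_of_contDiff
    (contDiff_deriv_of_contDiff contDiff_coreProfile)).continuous.measurable
  unfold scaledSource
  fun_prop

lemma aestronglyMeasurable_comp_smul {f : Space → ℝ} (hf : AEStronglyMeasurable f volume) {δ : ℝ}
    (hδ : δ ≠ 0) : AEStronglyMeasurable (fun x => f (δ • x)) volume := by
  refine hf.comp_quasiMeasurePreserving ⟨measurable_const_smul δ, ?_⟩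
  rw [Measure.map_addHaar_smul _ hδ]
  exact Measure.smul_absolutelyContinuous

/-- The source of the regularized Green function converges to `-4πδ_O`. -/
lemma tendsto_integral_coreSource {f : Space → ℝ} (hf : AEStronglyMeasurable f volume)
    (hf0 : ContinuousAt f 0) :
    Tendsto (fun δ => ∫ x in Metric.ball 0 δ, f x * coreSource δ ‖x‖) (𝓝[>] 0)
      (𝓝 (-(4 * Real.pi) * f 0)) := by
  obtain ⟨C, hC0, hC⟩ := exists_bound_scaledSource
  have hscale : ∀ δ : ℝ, 0 < δ → ∫ x in Metric.ball 0 δ, f x * coreSource δ ‖x‖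
      = ∫ y, (Metric.ball (0 : Space) 1).indicator
          (fun y => f (δ • y) * scaledSource δ ‖y‖) y := fun δ hδ => by
    have h := Measure.integral_comp_smul (volume : Measure Space)
      ((Metric.ball (0 : Space) δ).indicator fun x => f x * coreSource δ ‖x‖) δ
    rw [integral_indicator Metric.isOpen_ball.measurableSet, finrank_euclideanSpace] at h
    simp only [Fintype.card_fin, smul_eq_mul] at h
    rw [abs_of_pos (by positivity), inv_mul_eq_div, eq_div_iff (by positivity),
      mul_comm, ← integral_const_mul] at h
    rw [← h]
    congr 1
    ext y
    have hmem : δ • y ∈ Metric.ball (0 : Space) δ ↔ y ∈ Metric.ball (0 : Space) 1 := by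
      rw [mem_ball_zero_iff, mem_ball_zero_iff, norm_smul, Real.norm_of_nonneg hδ.le]
      exact mul_lt_iff_lt_one_right hδ
    by_cases hy : y ∈ Metric.ball (0 : Space) 1
    · rw [Set.indicator_of_mem (hmem.2 hy), Set.indicator_of_mem hy, norm_smul,
        Real.norm_of_nonneg hδ.le, ← cube_mul_coreSource hδ]
      ring
    · rw [Set.indicator_of_notMem (fun h => hy (hmem.1 h)), Set.indicator_of_notMem hy, mul_zero]
  have hlim : ∫ y, (Metric.ball (0 : Space) 1).indicator
      (fun y => f 0 * (deriv (deriv coreProfile) ‖y‖ / ‖y‖)) y = -(4 * Real.pi) * f 0 := by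
    rw [mul_comm, ← integral_deriv_deriv_coreProfile, ← integral_const_mul]
    congr 1
    ext y
    by_cases hy : y ∈ Metric.ball (0 : Space) 1
    · rw [Set.indicator_of_mem hy]
    · rw [mem_ball_zero_iff, not_lt] at hy
      rw [Set.indicator_of_notMem (by simpa using hy),
        deriv_deriv_coreProfile_of_gt (by linarith)]
      simp
  rw [← hlim]
  refine Tendsto.congr' (f₁ := fun δ => ∫ y, (Metric.ball (0 : Space) 1).indicator
          (fun y => f (δ • y) * scaledSource δ ‖y‖) y) ?_ ?_
  · filter_upwards [self_mem_nhdsWithin] with δ hδ using (hscale δ hδ).symm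
  -- Continuity at the centre alone bounds `f (δ y)` by `|f 0| + 1` for small `δ`. No more is
  -- available when `f` is a distributional solution rather than a test function.
  obtain ⟨η, hη, hηf⟩ := Metric.continuousAt_iff.1 hf0 1 one_pos
  refine tendsto_integral_filter_of_dominated_convergence
    ((Metric.ball (0 : Space) 1).indicator fun _ => (|f 0| + 1) * C) ?_ ?_ ?_ ?_
  · filter_upwards [self_mem_nhdsWithin] with δ hδ
    refine AEStronglyMeasurable.indicator ?_ Metric.isOpen_ball.measurableSet
    exact (aestronglyMeasurable_comp_smul hf (ne_of_gt hδ)).mul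
      ((measurable_scaledSource δ).comp measurable_norm).aestronglyMeasurable
  · filter_upwards [self_mem_nhdsWithin, mem_nhdsWithin_of_mem_nhds (gt_mem_nhds hη),
      mem_nhdsWithin_of_mem_nhds (gt_mem_nhds (show (0 : ℝ) < 1 / 2 by norm_num))] with δ hδ hδη hδ2
    refine .of_forall fun y => ?_
    have hδ : 0 < δ := hδ
    by_cases hy : y ∈ Metric.ball (0 : Space) 1
    · rw [Set.indicator_of_mem hy, Set.indicator_of_mem hy, norm_mul]
      rw [mem_ball_zero_iff] at hy
      refine mul_le_mul ?_ (hC δ _ hδ (le_of_lt hδ2) (norm_nonneg y) hy.le) (norm_nonneg _)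
        (by positivity)
      have h1 : dist (δ • y) 0 < η := by
        rw [dist_zero_right, norm_smul, Real.norm_of_nonneg hδ.le]
        nlinarith [norm_nonneg y]
      have h2 := hηf h1
      rw [Real.dist_eq] at h2
      have h3 := abs_sub_abs_le_abs_sub (f (δ • y)) (f 0)
      rw [Real.norm_eq_abs]
      linarith
    · rw [Set.indicator_of_notMem hy, Set.indicator_of_notMem hy, norm_zero]
  · rw [integrable_indicator_iff Metric.isOpen_ball.measurableSet]
    exact integrableOn_const measure_ball_lt_top.ne
  · refine .of_forall fun y => ?_
    by_cases hy : y ∈ Metric.ball (0 : Space) 1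
    · simp only [Set.indicator_of_mem hy]
      refine Tendsto.mul ?_ (tendsto_scaledSource ‖y‖)
      have h1 : Tendsto (fun δ : ℝ => δ • y) (𝓝[>] 0) (𝓝 0) := by
        have : Tendsto (fun δ : ℝ => δ • y) (𝓝 0) (𝓝 ((0 : ℝ) • y)) :=
          (continuous_id.smul continuous_const).tendsto 0
        rw [zero_smul] at this
        exact this.mono_left nhdsWithin_le_nhds
      exact hf0.tendsto.comp h1
    · simp only [Set.indicator_of_notMem hy]
      exact tendsto_const_nhds

/-! ### Solutions of the Helmholtz equation -/

lemma IsTestFunction.integrable_mul {ι : Type} [Fintype ι] {U : Set (Coord ι)}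
    {u W : Coord ι → ℝ} (hu : LocallyIntegrableOn u U) (hW : IsTestFunction U W) :
    Integrable (fun x => u x * W x) := by
  have h := (hu.integrableOn_compact_subset hW.2.2 hW.isCompact).continuousOn_mul
    hW.1.continuous.continuousOn hW.isCompact
  simp only [mul_comm (W _)] at h
  refine (integrableOn_iff_integrable_of_support_subset fun x hx => ?_).1 h
  by_contra hx'
  exact hx (by simp [image_eq_zero_of_notMem_tsupport hx'])

lemma IsTestFunction.helmholtz {φ : Space → ℝ} (hφ : IsTestFunction hypBall φ) :
    IsTestFunction hypBall
      (fun x => volDensity hypMetric x * (laplaceBeltrami hypMetric φ x + φ x)) :=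
  (hφ.laplacian.add hφ).mul_contDiffOn isOpen_hypBall contDiffOn_volDensity

lemma ae_ne (p : Space) : ∀ᵐ x : Space, x ≠ p := by
  simp [ae_iff]

/-- A point is a null set. The explicit formulas take arbitrary values at their pole, where they
divide by zero. -/
lemma SolvesHelmholtz.congr_off {Φ Ψ : Space → ℝ} {a : Space} {c : ℝ} (p : Space)
    (h : SolvesHelmholtz Φ a c) (he : ∀ x ∈ hypBall, x ≠ p → Φ x = Ψ x) :
    SolvesHelmholtz Ψ a c := by
  have hae : ∀ᵐ x : Space, x ∈ hypBall → Φ x = Ψ x := by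
    filter_upwards [ae_ne p] with x hx hxb using he x hxb hx
  constructor
  · have h1 := h.1
    rw [locallyIntegrableOn_iff isOpen_hypBall.isLocallyClosed] at h1 ⊢
    intro K hKb hK
    refine (h1 K hKb hK).congr ?_
    filter_upwards [ae_restrict_of_ae hae, ae_restrict_mem hK.measurableSet] with x hx hxK
    exact hx (hKb hxK)
  · intro φ hφ
    rw [← h.2 φ hφ]
    refine setIntegral_congr_ae isOpen_hypBall.measurableSet ?_
    filter_upwards [hae] with x hx hxb
    rw [hx hxb]

lemma integrableOn_inv_norm : IntegrableOn (fun x : Space => ‖x‖⁻¹) hypBall := by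
  have h := integrableOn_fun_norm_addHaar (volume : Measure Space) (f := fun r => r⁻¹) (r := 1)
  refine h.2 ?_
  rw [finrank_euclideanSpace]
  have hc : IntegrableOn (fun y : ℝ => y) (Set.Ioo 0 1) :=
    (continuous_id.integrableOn_Icc (a := (0 : ℝ)) (b := 1)).mono_set Set.Ioo_subset_Icc_self
  refine hc.congr_fun (fun y hy => ?_) measurableSet_Ioo
  have : y ≠ 0 := hy.1.ne'
  simp
  field_simp

/-- The Green function `√(1-ρ²)/(4πρ)` with pole at the centre. -/
def greenO (x : Space) : ℝ := (4 * Real.pi)⁻¹ * (Real.sqrt (1 - ‖x‖ ^ 2) / ‖x‖)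

lemma integrableOn_greenO : IntegrableOn greenO hypBall := by
  refine (integrableOn_inv_norm.const_mul (4 * Real.pi)⁻¹).mono' ?_ (.of_forall fun x => ?_)
  · refine Measurable.aestronglyMeasurable ?_
    unfold greenO
    fun_prop
  · rw [greenO, norm_mul, Real.norm_of_nonneg (by positivity), Real.norm_of_nonneg (by positivity),
      div_eq_mul_inv]
    have : Real.sqrt (1 - ‖x‖ ^ 2) ≤ 1 := Real.sqrt_le_one.2 (by nlinarith [norm_nonneg x])
    gcongr
    exact mul_le_of_le_one_left (by positivity) this

lemma exists_radius {K : Set Space} (hK : IsCompact K) (hKb : K ⊆ hypBall) :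
    ∃ r, 0 < r ∧ r < 1 ∧ ∀ x ∈ K, ‖x‖ < r := by
  obtain ⟨r, hr, h⟩ := exists_lt_subset_ball hK.isClosed hKb
  refine ⟨max r (1 / 2), by positivity, max_lt hr (by norm_num), fun x hx => ?_⟩
  have := h hx
  rw [mem_ball_zero_iff] at this
  exact this.trans_le (le_max_left _ _)

lemma abs_cutGreen_le {δ ε : ℝ} (hδ : 0 < δ) {x : Space} (hx : x ≠ 0) :
    |cutGreen δ ε x| ≤ ‖x‖⁻¹ := by
  have hx' : 0 < ‖x‖ := norm_pos_iff.2 hx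
  have h1 := coreProfile_nonneg (s := ‖x‖ / δ) (by positivity)
  have h2 := coreProfile_le_one (s := ‖x‖ / δ)
  have h3 := tailCutoff_nonneg (ε * Real.artanh ‖x‖)
  have h4 := tailCutoff_le_one (ε * Real.artanh ‖x‖)
  have h5 : Real.sqrt (1 - ‖x‖ ^ 2) ≤ 1 := Real.sqrt_le_one.2 (by nlinarith [norm_nonneg x])
  rw [cutGreen_eq hδ.ne' hx, abs_of_nonneg (by positivity), ← mul_div_assoc, div_eq_mul_inv]
  refine mul_le_of_le_one_left (by positivity) ?_
  exact mul_le_one₀ h5 (by positivity) (mul_le_one₀ h2 h3 h4)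

/-- Green's second identity moves the operator to `cutGreen`. Since `ε artanh r < 1`, the tail of
its source lies beyond the support of `φ`, and only the core contributes. -/
lemma integral_cutGreen_mul_helmholtz {φ : Space → ℝ} (hφ : IsTestFunction hypBall φ) {r δ ε : ℝ}
    (hr1 : r < 1) (hr : ∀ x ∈ tsupport φ, ‖x‖ < r) (hε : 0 < ε)
    (hεr : ε * Real.artanh r < 1) (hδ : 0 < δ) (hδ1 : δ < 1) (hεδ : ε * Real.artanh δ < 1) :
    ∫ x in hypBall, cutGreen δ ε x *
        (volDensity hypMetric x * (laplaceBeltrami hypMetric φ x + φ x))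
      = ∫ x in Metric.ball 0 δ, φ x * coreSource δ ‖x‖ := by
  have hu := isTestFunction_cutGreen (δ := δ) hε
  have hswap : ∫ x in hypBall, cutGreen δ ε x *
        (volDensity hypMetric x * (laplaceBeltrami hypMetric φ x + φ x))
      = ∫ x in hypBall, φ x * (volDensity hypMetric x *
        (laplaceBeltrami hypMetric (cutGreen δ ε) x + cutGreen δ ε x)) := by
    have e := hu.integral_laplaceBeltrami_comm hφ
    have i1 := ((hφ.laplacian.mul_contDiffOn isOpen_hypBall contDiffOn_volDensity).mul_contDiffOn
      isOpen_hypBall hu.1.contDiffOn).integrable.integrableOn (s := hypBall)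
    have i2 := ((hu.laplacian.mul_contDiffOn isOpen_hypBall contDiffOn_volDensity).mul_contDiffOn
      isOpen_hypBall hφ.1.contDiffOn).integrable.integrableOn (s := hypBall)
    have i3 := ((hφ.mul_contDiffOn isOpen_hypBall contDiffOn_volDensity).mul_contDiffOn
      isOpen_hypBall hu.1.contDiffOn).integrable.integrableOn (s := hypBall)
    have i4 := ((hu.mul_contDiffOn isOpen_hypBall contDiffOn_volDensity).mul_contDiffOn
      isOpen_hypBall hφ.1.contDiffOn).integrable.integrableOn (s := hypBall)
    simp only [mul_add]
    rw [integral_add i1 i3, integral_add i2 i4, e]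
    congr 1
    refine integral_congr_ae (.of_forall fun x => ?_)
    ring
  rw [hswap, ← integral_indicator isOpen_hypBall.measurableSet,
    ← integral_indicator Metric.isOpen_ball.measurableSet]
  refine integral_congr_ae ?_
  filter_upwards [ae_ne 0] with x hx
  by_cases hxδ : ‖x‖ < δ
  · rw [Set.indicator_of_mem (mem_hypBall.2 (hxδ.trans hδ1)),
      Set.indicator_of_mem (mem_ball_zero_iff.2 hxδ),
      helmholtz_cutGreen_core hδ hδ1 hε hεδ hx hxδ]
  · rw [Set.indicator_of_notMem (s := Metric.ball 0 δ) (by simpa using hxδ)]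
    by_cases hxb : x ∈ hypBall
    · rw [Set.indicator_of_mem hxb, helmholtz_cutGreen_tail hδ hxb (not_lt.1 hxδ)]
      by_cases hxs : x ∈ tsupport φ
      · have h1 := Real.artanh_lt_artanh (by linarith [norm_nonneg x]) hr1 (hr x hxs)
        rw [tailSource, deriv_deriv_tailCutoff_of_lt (by nlinarith)]
        simp
      · rw [image_eq_zero_of_notMem_tsupport hxs, zero_mul]
    · rw [Set.indicator_of_notMem hxb]

lemma exists_scale (r : ℝ) (hr0 : 0 < r) : ∃ ε, 0 < ε ∧ ε * Real.artanh r < 1 := by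
  have h := Real.artanh_nonneg hr0.le
  refine ⟨(Real.artanh r + 1)⁻¹, by positivity, ?_⟩
  rw [inv_mul_lt_iff₀ (by positivity)]
  linarith

lemma eventually_small_artanh (ε : ℝ) :
    ∀ᶠ δ in 𝓝[>] (0 : ℝ), 0 < δ ∧ δ < 1 ∧ ε * Real.artanh δ < 1 := by
  have hc : ContinuousAt (fun δ => ε * Real.artanh δ) 0 :=
    continuousAt_const.mul (contDiffAt_artanh (by simp)).continuousAt
  filter_upwards [self_mem_nhdsWithin, mem_nhdsWithin_of_mem_nhds (gt_mem_nhds one_pos),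
    mem_nhdsWithin_of_mem_nhds (hc.eventually_lt_const (show ε * Real.artanh 0 < 1 by simp))]
    with δ h1 h2 h3 using ⟨h1, h2, h3⟩

/-- The fundamental solution with pole at the centre. -/
lemma solvesHelmholtz_greenO : SolvesHelmholtz greenO 0 (-1) := by
  refine ⟨integrableOn_greenO.locallyIntegrableOn, fun φ hφ => ?_⟩
  obtain ⟨r, hr0, hr1, hr⟩ := exists_radius hφ.isCompact hφ.2.2
  obtain ⟨ε, hε, hεr⟩ := exists_scale r hr0
  set W := fun x => volDensity hypMetric x * (laplaceBeltrami hypMetric φ x + φ x) with hW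
  have hWt : IsTestFunction hypBall W := hφ.helmholtz
  -- Now `δ → 0` with `ε` fixed. One side concentrates at the pole. On the other, `cutGreen` equals
  -- `√(1-ρ²)/ρ` at each `x ≠ 0` of the support as soon as `δ < ‖x‖`, with majorant a multiple of
  -- `1/ρ`.
  have lim1 := tendsto_integral_coreSource hφ.1.continuous.aestronglyMeasurable
    hφ.1.continuous.continuousAt
  have lim2 : Tendsto (fun δ => ∫ x in hypBall, cutGreen δ ε x * W x) (𝓝[>] 0)
      (𝓝 (∫ x in hypBall, Real.sqrt (1 - ‖x‖ ^ 2) / ‖x‖ * W x)) := by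
    obtain ⟨C, hC⟩ := hWt.2.1.exists_bound_of_continuous hWt.1.continuous
    refine tendsto_integral_filter_of_dominated_convergence (fun x => ‖x‖⁻¹ * C) ?_ ?_ ?_ ?_
    · refine .of_forall fun δ => ?_
      exact ((isTestFunction_cutGreen hε).1.continuous.mul hWt.1.continuous).aestronglyMeasurable
    · filter_upwards [self_mem_nhdsWithin] with δ hδ
      filter_upwards [ae_restrict_of_ae (ae_ne 0)] with x hx
      rw [norm_mul]
      exact mul_le_mul (abs_cutGreen_le hδ hx) (hC x) (norm_nonneg _) (by positivity)
    · exact integrableOn_inv_norm.mul_const C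
    · filter_upwards [ae_restrict_of_ae (ae_ne 0)] with x hx
      have hx' : 0 < ‖x‖ := norm_pos_iff.2 hx
      refine tendsto_const_nhds.congr' ?_
      filter_upwards [self_mem_nhdsWithin, mem_nhdsWithin_of_mem_nhds (gt_mem_nhds hx')]
        with δ hδ hδx
      have hδ : 0 < δ := hδ
      by_cases hxs : x ∈ tsupport φ
      · have h1 := Real.artanh_lt_artanh (by linarith [norm_nonneg x]) hr1 (hr x hxs)
        have h2 : (2 : ℝ) / 3 ≤ ‖x‖ / δ := by
          rw [le_div_iff₀ hδ]; linarith
        rw [cutGreen_eq hδ.ne' hx, tailCutoff_of_le (by nlinarith), coreProfile_of_ge h2]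
        ring
      · have : W x = 0 := by
          simp only [hW]
          rw [laplaceBeltrami_eq_zero_of_notMem hxs, image_eq_zero_of_notMem_tsupport hxs]
          simp
        simp [this]
  have heq : ∫ x in hypBall, Real.sqrt (1 - ‖x‖ ^ 2) / ‖x‖ * W x = -(4 * Real.pi) * φ 0 := by
    refine tendsto_nhds_unique lim2 (lim1.congr' ?_)
    filter_upwards [eventually_small_artanh ε] with δ hδ
    exact (integral_cutGreen_mul_helmholtz hφ hr1 hr hε hεr hδ.1 hδ.2.1 hδ.2.2).symm
  calc ∫ x in hypBall, greenO x * (laplaceBeltrami hypMetric φ x + φ x) * volDensity hypMetric x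
      = ∫ x in hypBall, (4 * Real.pi)⁻¹ * (Real.sqrt (1 - ‖x‖ ^ 2) / ‖x‖ * W x) := by
        refine integral_congr_ae (.of_forall fun x => ?_)
        simp only [hW, greenO]
        ring
    _ = -1 * φ 0 := by
        rw [integral_const_mul, heq]
        have := Real.pi_pos
        field_simp

/-! ### Uniqueness -/

/-- The radial majorant of the source far from the pole. -/
def shellWeight (ε r : ℝ) : ℝ :=
  (Set.Icc (Real.tanh (1 / ε)) (Real.tanh (2 / ε))).indicator (fun r => (r ^ 2 * (1 - r ^ 2))⁻¹) r

lemma tanh_pos_of_pos {t : ℝ} (ht : 0 < t) : 0 < Real.tanh t := by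
  rw [Real.tanh_eq_sinh_div_cosh]
  exact div_pos (Real.sinh_pos_iff.2 ht) (Real.cosh_pos t)

lemma shellWeight_nonneg {ε : ℝ} (hε : 0 < ε) (r : ℝ) : 0 ≤ shellWeight ε r :=
  Set.indicator_nonneg (fun y hy => by
    have h1 : 0 < y := (tanh_pos_of_pos (show 0 < 1 / ε by positivity)).trans_le hy.1
    have h2 : y < 1 := hy.2.trans_lt (Real.tanh_lt_one _)
    have : 0 < 1 - y ^ 2 := by nlinarith
    positivity) r

lemma tanh_le_of_le_artanh {t r : ℝ} (hr0 : 0 ≤ r) (h : t ≤ Real.artanh r) :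
    Real.tanh t ≤ r := by
  by_contra hc
  push Not at hc
  have := Real.artanh_lt_artanh (by linarith) (Real.tanh_lt_one t) hc
  rw [Real.artanh_tanh] at this
  linarith

lemma le_tanh_of_artanh_le {t r : ℝ} (hr : r < 1) (h : Real.artanh r ≤ t) :
    r ≤ Real.tanh t := by
  by_contra hc
  push Not at hc
  have := Real.artanh_lt_artanh (Real.neg_one_lt_tanh t) hr hc
  rw [Real.artanh_tanh] at this
  linarith

lemma integrable_shellWeight {ε : ℝ} (hε : 0 < ε) :
    Integrable (fun x : Space => shellWeight ε ‖x‖) := by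
  have ha := tanh_pos_of_pos (show 0 < 1 / ε by positivity)
  have hb := Real.tanh_lt_one (2 / ε)
  set S : Set Space := (fun x : Space => ‖x‖) ⁻¹' Set.Icc (Real.tanh (1 / ε)) (Real.tanh (2 / ε))
    with hS
  have hSc : IsCompact S := by
    refine (isCompact_closedBall (0 : Space) (Real.tanh (2 / ε))).of_isClosed_subset
      (isClosed_Icc.preimage continuous_norm) fun x hx => ?_
    rw [mem_closedBall_zero_iff]
    exact hx.2
  have hc : ContinuousOn (fun x : Space => (‖x‖ ^ 2 * (1 - ‖x‖ ^ 2))⁻¹) S := by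
    refine ContinuousOn.inv₀ (by fun_prop) fun x hx => ?_
    have h1 : 0 < ‖x‖ := ha.trans_le hx.1
    have h2 : ‖x‖ < 1 := lt_of_le_of_lt hx.2 hb
    have : 0 < 1 - ‖x‖ ^ 2 := by nlinarith
    positivity
  have hi := hc.integrableOn_compact hSc (μ := volume)
  rw [← integrable_indicator_iff hSc.measurableSet] at hi
  refine hi.congr (.of_forall fun x => ?_)
  by_cases hx : ‖x‖ ∈ Set.Icc (Real.tanh (1 / ε)) (Real.tanh (2 / ε))
  · simp only [shellWeight]
    rw [Set.indicator_of_mem hx, Set.indicator_of_mem (show x ∈ S from hx)]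
  · simp only [shellWeight]
    rw [Set.indicator_of_notMem hx, Set.indicator_of_notMem (show x ∉ S from hx)]

/-- The `ρ²` of polar coordinates cancels the one in the weight, leaving `(1-ρ²)⁻¹`, the derivative
of `artanh`. The integral is `4π` times the thickness `2/ε - 1/ε` of the shell. -/
lemma integral_shellWeight {ε : ℝ} (hε : 0 < ε) :
    ∫ x : Space, shellWeight ε ‖x‖ = 4 * Real.pi / ε := by
  have ha := tanh_pos_of_pos (show 0 < 1 / ε by positivity)
  have hb := Real.tanh_lt_one (2 / ε)
  have hab : Real.tanh (1 / ε) ≤ Real.tanh (2 / ε) := by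
    refine tanh_le_of_le_artanh (tanh_pos_of_pos (by positivity)).le ?_
    rw [Real.artanh_tanh]
    gcongr
    norm_num
  rw [integral_radial]
  have h1 : ∫ y in Set.Ioi (0 : ℝ), y ^ 2 * shellWeight ε y
      = ∫ y in Set.Icc (Real.tanh (1 / ε)) (Real.tanh (2 / ε)), (1 - y ^ 2)⁻¹ := by
    symm
    rw [← integral_indicator measurableSet_Icc, ← integral_indicator measurableSet_Ioi]
    congr 1
    ext y
    by_cases hy : y ∈ Set.Icc (Real.tanh (1 / ε)) (Real.tanh (2 / ε))
    · have hy0 : 0 < y := ha.trans_le hy.1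
      rw [Set.indicator_of_mem hy, Set.indicator_of_mem (Set.mem_Ioi.2 hy0), shellWeight,
        Set.indicator_of_mem hy, mul_inv, ← mul_assoc, mul_inv_cancel₀ (by positivity), one_mul]
    · rw [Set.indicator_of_notMem hy]
      by_cases hy0 : y ∈ Set.Ioi (0 : ℝ)
      · rw [Set.indicator_of_mem hy0, shellWeight, Set.indicator_of_notMem hy, mul_zero]
      · rw [Set.indicator_of_notMem hy0]
  have habs : ∀ y ∈ Set.uIcc (Real.tanh (1 / ε)) (Real.tanh (2 / ε)), |y| < 1 := fun y hy => by
    rw [Set.uIcc_of_le hab] at hy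
    rw [abs_of_pos (ha.trans_le hy.1)]
    exact hy.2.trans_lt hb
  have h2 : ∫ y in Real.tanh (1 / ε)..Real.tanh (2 / ε), (1 - y ^ 2)⁻¹ = 1 / ε := by
    rw [intervalIntegral.integral_eq_sub_of_hasDerivAt (f := Real.artanh)
      (fun y hy => hasDerivAt_artanh (habs y hy)), Real.artanh_tanh, Real.artanh_tanh]
    · ring
    · refine ContinuousOn.intervalIntegrable (ContinuousOn.inv₀ (by fun_prop) fun y hy => ?_)
      have := (sq_lt_one_iff_abs_lt_one y).2 (habs y hy)
      linarith
  rw [h1, integral_Icc_eq_integral_Ioc, ← intervalIntegral.integral_of_le hab, h2]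
  ring

/-- The decay of `u` cancels the root in the denominator of the source, and two derivatives of the
cutoff give `ε²`. The condition `ε artanh r₀ < 1` places the shell inside the region where the decay
is known. -/
lemma abs_mul_tailSource_le {u C K r₀ ε r : ℝ} (hε : 0 < ε) (hr0 : 0 < r) (hr1 : r < 1)
    (hK : ∀ t, |deriv (deriv tailCutoff) t| ≤ K) (hK0 : 0 ≤ K) (hC : 0 ≤ C) (hr₀1 : r₀ < 1)
    (hεr₀ : ε * Real.artanh r₀ < 1) (hu : r₀ ≤ r → |u| ≤ C * Real.sqrt (1 - r ^ 2)) :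
    |u * tailSource ε r| ≤ ε ^ 2 * (C * K) * shellWeight ε r := by
  have hq : 0 < 1 - r ^ 2 := by nlinarith
  have hs := Real.sqrt_pos.2 hq
  have hw := shellWeight_nonneg hε r
  rcases lt_or_ge (ε * Real.artanh r) 1 with h1 | h1
  · rw [tailSource, deriv_deriv_tailCutoff_of_lt h1]
    simp
    positivity
  rcases lt_or_ge 2 (ε * Real.artanh r) with h2 | h2
  · rw [tailSource, deriv_deriv_tailCutoff_of_gt h2]
    simp
    positivity
  have hmem : r ∈ Set.Icc (Real.tanh (1 / ε)) (Real.tanh (2 / ε)) :=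
    ⟨tanh_le_of_le_artanh hr0.le ((div_le_iff₀' hε).2 h1),
      le_tanh_of_artanh_le hr1 ((le_div_iff₀' hε).2 h2)⟩
  have hrr : r₀ ≤ r := by
    by_contra hc
    push Not at hc
    have := Real.artanh_lt_artanh (by linarith) hr₀1 hc
    nlinarith
  rw [shellWeight, Set.indicator_of_mem hmem, tailSource, abs_mul, abs_div, abs_mul,
    abs_of_pos (by positivity : 0 < ε ^ 2),
    abs_of_pos (by positivity : 0 < (1 - r ^ 2) * (r * Real.sqrt (1 - r ^ 2)))]
  calc |u| * (ε ^ 2 * |deriv (deriv tailCutoff) (ε * Real.artanh r)|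
        / ((1 - r ^ 2) * (r * Real.sqrt (1 - r ^ 2))))
      ≤ (C * Real.sqrt (1 - r ^ 2)) * (ε ^ 2 * K
        / ((1 - r ^ 2) * (r * Real.sqrt (1 - r ^ 2)))) := by
        gcongr
        · exact hu hrr
        · exact hK _
    _ = ε ^ 2 * (C * K) * (r * (1 - r ^ 2))⁻¹ := by field_simp
    _ ≤ ε ^ 2 * (C * K) * (r ^ 2 * (1 - r ^ 2))⁻¹ := by
        gcongr
        nlinarith

/-- A homogeneous solution that decays like `√(1-ρ²)` vanishes at the centre. -/
lemma SolvesHelmholtz.eq_zero_at_center {u : Space → ℝ} {a : Space} (hu : SolvesHelmholtz u a 0)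
    (hcont : ContinuousAt u 0) {r₀ C : ℝ} (hr₀1 : r₀ < 1)
    (hdecay : ∀ x ∈ hypBall, r₀ ≤ ‖x‖ → |u x| ≤ C * Real.sqrt (1 - ‖x‖ ^ 2)) : u 0 = 0 := by
  obtain ⟨K, hK0, hK⟩ := exists_bound_deriv_deriv_tailCutoff
  set C' := max C 0 with hC'
  have hdecay' : ∀ x ∈ hypBall, r₀ ≤ ‖x‖ → |u x| ≤ C' * Real.sqrt (1 - ‖x‖ ^ 2) :=
    fun x hx h => (hdecay x hx h).trans (by gcongr; exact le_max_left _ _)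
  -- Local integrability on the ball gives measurability there only, so `u` is extended by zero.
  set f := hypBall.indicator u with hf
  have hfm : AEStronglyMeasurable f volume :=
    (aestronglyMeasurable_indicator_iff isOpen_hypBall.measurableSet).2 hu.1.aestronglyMeasurable
  have hfe : f =ᶠ[𝓝 0] u := by
    filter_upwards [isOpen_hypBall.mem_nhds zero_mem_hypBall] with x hx
    exact Set.indicator_of_mem hx u
  have hfc : ContinuousAt f 0 := hcont.congr hfe.symm
  -- Tested with `cutGreen`, the homogeneous equation makes the core integral equal to minus the
  -- tail integral. The latter is at most `ε² C' K · 4π/ε`.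
  have hbound : ∀ δ ε : ℝ, 0 < δ → δ < 1 → 0 < ε → ε * Real.artanh δ < 1 →
      ε * Real.artanh r₀ < 1 →
      |∫ x in Metric.ball 0 δ, f x * coreSource δ ‖x‖| ≤ 4 * Real.pi * (C' * K) * ε := by
    intro δ ε hδ hδ1 hε hεδ hεr
    have ht := isTestFunction_cutGreen (δ := δ) hε
    set W := fun x => volDensity hypMetric x *
      (laplaceBeltrami hypMetric (cutGreen δ ε) x + cutGreen δ ε x) with hW
    have hWt : IsTestFunction hypBall W := ht.helmholtz
    have hint : Integrable (fun x => u x * W x) := hWt.integrable_mul hu.1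
    have h0 : ∫ x in hypBall, u x * W x = 0 := by
      have := hu.2 _ ht
      rw [zero_mul] at this
      rw [← this]
      refine integral_congr_ae (.of_forall fun x => ?_)
      simp only [hW]
      ring
    have hsub : Metric.ball (0 : Space) δ ⊆ hypBall := Metric.ball_subset_ball hδ1.le
    have hsplit := setIntegral_union (μ := volume) (f := fun x => u x * W x)
      (s := Metric.ball (0 : Space) δ) (t := hypBall \ Metric.ball 0 δ) Set.disjoint_sdiff_right
      (isOpen_hypBall.measurableSet.diff Metric.isOpen_ball.measurableSet) hint.integrableOn
      hint.integrableOn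
    rw [Set.union_sdiff_cancel hsub, h0] at hsplit
    have hcore : ∫ x in Metric.ball 0 δ, u x * W x
        = ∫ x in Metric.ball 0 δ, f x * coreSource δ ‖x‖ := by
      refine setIntegral_congr_ae Metric.isOpen_ball.measurableSet ?_
      filter_upwards [ae_ne 0] with x hx hxδ
      rw [hf, Set.indicator_of_mem (hsub hxδ), hW]
      simp only
      rw [helmholtz_cutGreen_core hδ hδ1 hε hεδ hx (mem_ball_zero_iff.1 hxδ)]
    have htail : |∫ x in hypBall \ Metric.ball 0 δ, u x * W x|
        ≤ ∫ x in hypBall \ Metric.ball 0 δ, ε ^ 2 * (C' * K) * shellWeight ε ‖x‖ := by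
      rw [← Real.norm_eq_abs]
      refine norm_integral_le_of_norm_le ((integrable_shellWeight hε).const_mul _).integrableOn ?_
      refine (ae_restrict_mem (isOpen_hypBall.measurableSet.diff
        Metric.isOpen_ball.measurableSet)).mono fun x hx => ?_
      have hxδ : δ ≤ ‖x‖ := by simpa using hx.2
      simp only [hW]
      rw [helmholtz_cutGreen_tail hδ hx.1 hxδ]
      exact abs_mul_tailSource_le hε (hδ.trans_le hxδ) (mem_hypBall.1 hx.1) hK hK0
        (le_max_right _ _) hr₀1 hεr (hdecay' x hx.1)
    have hnn : ∀ x : Space, 0 ≤ ε ^ 2 * (C' * K) * shellWeight ε ‖x‖ := fun x => by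
      have hw := shellWeight_nonneg hε ‖x‖
      have : 0 ≤ C' := le_max_right _ _
      positivity
    have hle := setIntegral_le_integral (s := hypBall \ Metric.ball (0 : Space) δ)
      ((integrable_shellWeight hε).const_mul (ε ^ 2 * (C' * K))) (.of_forall hnn)
    have htot : ∫ x : Space, ε ^ 2 * (C' * K) * shellWeight ε ‖x‖
        = ε ^ 2 * (C' * K) * (4 * Real.pi / ε) := by
      rw [integral_const_mul, integral_shellWeight hε]
    rw [htot] at hle
    rw [← hcore]
    have : ∫ x in Metric.ball 0 δ, u x * W x = -∫ x in hypBall \ Metric.ball 0 δ, u x * W x := by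
      linarith
    rw [this, abs_neg]
    refine htail.trans (hle.trans_eq ?_)
    field_simp
  -- The core integral does not involve `ε`, so `ε → 0` at fixed `δ` makes it vanish. Afterwards `δ
  -- → 0` turns it into `-4π u(0)`.
  have hzero : ∀ δ : ℝ, 0 < δ → δ < 1 →
      ∫ x in Metric.ball 0 δ, f x * coreSource δ ‖x‖ = 0 := by
    intro δ hδ hδ1
    have hc : ∀ c : ℝ, ∀ᶠ ε in 𝓝[>] (0 : ℝ), ε * c < 1 := fun c => by
      have : ContinuousAt (fun ε : ℝ => ε * c) 0 := by fun_prop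
      exact mem_nhdsWithin_of_mem_nhds (this.eventually_lt_const (by simp))
    have hlim : Tendsto (fun ε : ℝ => 4 * Real.pi * (C' * K) * ε) (𝓝[>] 0) (𝓝 0) := by
      have : Tendsto (fun ε : ℝ => 4 * Real.pi * (C' * K) * ε) (𝓝 0)
          (𝓝 (4 * Real.pi * (C' * K) * 0)) := (continuous_const.mul continuous_id).tendsto 0
      rw [mul_zero] at this
      exact this.mono_left nhdsWithin_le_nhds
    have := ge_of_tendsto hlim (b := |∫ x in Metric.ball 0 δ, f x * coreSource δ ‖x‖|) (by
      filter_upwards [self_mem_nhdsWithin, hc (Real.artanh δ), hc (Real.artanh r₀)] with ε h1 h2 h3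
      exact hbound δ ε hδ hδ1 h1 h2 h3)
    exact abs_eq_zero.1 (le_antisymm this (abs_nonneg _))
  have hlim := tendsto_integral_coreSource hfm hfc
  have hlim0 : Tendsto (fun δ => ∫ x in Metric.ball 0 δ, f x * coreSource δ ‖x‖) (𝓝[>] 0)
      (𝓝 0) := by
    refine tendsto_const_nhds.congr' ?_
    filter_upwards [self_mem_nhdsWithin, mem_nhdsWithin_of_mem_nhds (gt_mem_nhds one_pos)]
      with δ h1 h2 using (hzero δ h1 h2).symm
  have h := tendsto_nhds_unique hlim hlim0
  rw [hfe.eq_of_nhds] at h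
  exact (mul_eq_zero.1 h).resolve_left (by simp [Real.pi_ne_zero])

/-- A homogeneous solution that decays like `√(1-ρ²)` vanishes at all points of continuity. -/
lemma SolvesHelmholtz.eq_zero {u : Space → ℝ} {a p : Space} (ha : a ∈ hypBall) (hp : p ∈ hypBall)
    (hu : SolvesHelmholtz u a 0) (hcont : ContinuousAt u p) {r₀ C : ℝ} (hr₀1 : r₀ < 1)
    (hdecay : ∀ x ∈ hypBall, r₀ ≤ ‖x‖ → |u x| ≤ C * Real.sqrt (1 - ‖x‖ ^ 2)) : u p = 0 := by
  have hpair := (isometryPair_boost hp).symm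
  have hsol := hpair.solvesHelmholtz_comp ha hu
  have hp0 : boost (-p) 0 = p := by simp [boost_zero]
  have hqp := one_sub_norm_sq_pos hp
  have hpn : ‖p‖ < 1 := mem_hypBall.1 hp
  -- `κ` bounds the denominator of the boost from below, so the boost enlarges `1 - ρ²` by at most
  -- `κ⁻²` and keeps the decay hypothesis with a larger constant.
  set κ := 1 - ‖p‖ with hκ
  have hκ0 : 0 < κ := by rw [hκ]; linarith
  have hcc : ContinuousAt (fun x => u (boost (-p) x)) 0 := by
    have hb : ContinuousAt (boost (-p)) 0 :=
      (contDiffOn_boost (neg_mem_hypBall hp)).continuousOn.continuousAt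
        (isOpen_hypBall.mem_nhds zero_mem_hypBall)
    exact ContinuousAt.comp (by rwa [hp0]) hb
  have hden : ∀ x ∈ hypBall, κ ≤ 1 - inner ℝ (-p) x := fun x hx => by
    have h1 := real_inner_le_norm (-p) x
    rw [norm_neg] at h1
    have h2 := mem_hypBall.1 hx
    rw [hκ]
    nlinarith [norm_nonneg p, norm_nonneg x]
  -- points near the sphere stay near the sphere
  set q := (1 - (max r₀ 0) ^ 2) * κ ^ 2 with hq
  have hr₀' : 0 ≤ max r₀ 0 := le_max_right _ _
  have hr₀'1 : max r₀ 0 < 1 := max_lt hr₀1 one_pos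
  have hq0 : 0 < q := by
    have : 0 < 1 - (max r₀ 0) ^ 2 := by nlinarith
    positivity
  have hκ1 : κ ≤ 1 := by rw [hκ]; linarith [norm_nonneg p]
  have hq1 : q ≤ 1 := by
    rw [hq]
    exact mul_le_one₀ (by nlinarith) (by positivity) (pow_le_one₀ hκ0.le hκ1)
  set r₁ := max (Real.sqrt (1 - q)) (1 / 2) with hr₁
  have hr₁1 : r₁ < 1 := by
    refine max_lt ?_ (by norm_num)
    rw [Real.sqrt_lt' one_pos]
    linarith
  have key := hsol.eq_zero_at_center hcc (r₀ := r₁) (C := |C| / κ) hr₁1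
    fun x hx hxr => by
      have hqx := one_sub_norm_sq_pos hx
      have hd := hden x hx
      have hd0 : 0 < 1 - inner ℝ (-p) x := hκ0.trans_le hd
      have hb := one_sub_norm_boost_sq (neg_mem_hypBall hp) hx
      rw [norm_neg] at hb
      have hle : 1 - ‖boost (-p) x‖ ^ 2 ≤ (1 - ‖x‖ ^ 2) / κ ^ 2 := by
        rw [hb]
        gcongr
        exact mul_le_of_le_one_left hqx.le (by nlinarith [norm_nonneg p])
      have hxr' : Real.sqrt (1 - q) ≤ ‖x‖ := (le_max_left _ _).trans hxr
      have hx2 : 1 - q ≤ ‖x‖ ^ 2 := by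
        rw [← Real.sq_sqrt (show 0 ≤ 1 - q by linarith)]
        exact pow_le_pow_left₀ (Real.sqrt_nonneg _) hxr' 2
      have hbr : r₀ ≤ ‖boost (-p) x‖ := by
        have h1 : (1 - ‖x‖ ^ 2) / κ ^ 2 ≤ 1 - (max r₀ 0) ^ 2 := by
          rw [div_le_iff₀ (by positivity), ← hq]
          linarith
        have h2 : (max r₀ 0) ^ 2 ≤ ‖boost (-p) x‖ ^ 2 := by linarith
        exact (le_max_left _ _).trans (abs_le_of_sq_le_sq' h2 (norm_nonneg _)).2
      refine (hdecay _ (boost_mem (neg_mem_hypBall hp) hx) hbr).trans ?_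
      calc C * Real.sqrt (1 - ‖boost (-p) x‖ ^ 2)
          ≤ |C| * Real.sqrt ((1 - ‖x‖ ^ 2) / κ ^ 2) := by
            gcongr
            exact le_abs_self C
        _ = |C| / κ * Real.sqrt (1 - ‖x‖ ^ 2) := by
            rw [Real.sqrt_div hqx.le, Real.sqrt_sq hκ0.le]
            ring
  simpa [hp0] using key

/-! ### Hyperbolic distance to the centre -/

lemma hypDist_zero {x : Space} (hx : x ∈ hypBall) : hypDist x 0 = Real.artanh ‖x‖ := by
  have h1 := mem_hypBall.1 hx
  have h0 := norm_nonneg x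
  rw [hypDist, inner_zero_right, norm_zero]
  simp only [sub_zero, ne_eq, OfNat.ofNat_ne_zero, not_false_eq_true, zero_pow, Real.sqrt_one,
    mul_one]
  rw [← Real.cosh_artanh ⟨by linarith, h1⟩, Real.arcosh_cosh (Real.artanh_nonneg h0)]

lemma le_hypDist_of_le_norm {x : Space} (hx : x ∈ hypBall) {R : ℝ} (h : Real.tanh R ≤ ‖x‖) :
    R ≤ hypDist x 0 := by
  rw [hypDist_zero hx, ← Real.artanh_tanh R]
  exact Real.artanh_le_artanh (Real.neg_one_lt_tanh R) (mem_hypBall.1 hx) h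

lemma le_norm_of_le_hypDist {x : Space} (hx : x ∈ hypBall) {r : ℝ} (hr1 : r < 1)
    (h : Real.artanh r ≤ hypDist x 0) : r ≤ ‖x‖ := by
  rw [hypDist_zero hx] at h
  by_contra hc
  push Not at hc
  have := Real.artanh_lt_artanh (by linarith [norm_nonneg x]) hr1 hc
  linarith

/-- This links the algebraic factor `√(1-ρ²)` to `e^{-D}`, through `e^{-D} ≤ 1 / cosh D ≤ 2 e^{-D}`.
-/
lemma sqrt_eq_inv_cosh {x : Space} (hx : x ∈ hypBall) :
    Real.sqrt (1 - ‖x‖ ^ 2) = (Real.cosh (hypDist x 0))⁻¹ := by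
  rw [hypDist_zero hx, Real.cosh_artanh ⟨by linarith [norm_nonneg x], mem_hypBall.1 hx⟩, one_div,
    inv_inv]

lemma hypDist_zero_nonneg {x : Space} (hx : x ∈ hypBall) : 0 ≤ hypDist x 0 := by
  rw [hypDist_zero hx]; exact Real.artanh_nonneg (norm_nonneg x)

lemma exp_neg_hypDist_le {x : Space} (hx : x ∈ hypBall) :
    Real.exp (-hypDist x 0) ≤ Real.sqrt (1 - ‖x‖ ^ 2) := by
  rw [sqrt_eq_inv_cosh hx, Real.exp_neg]
  refine inv_anti₀ (Real.cosh_pos _) ?_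
  rw [Real.cosh_eq]
  have := Real.exp_le_exp.2 (show -hypDist x 0 ≤ hypDist x 0 by linarith [hypDist_zero_nonneg hx])
  linarith

lemma sqrt_le_two_mul_exp {x : Space} (hx : x ∈ hypBall) :
    Real.sqrt (1 - ‖x‖ ^ 2) ≤ 2 * Real.exp (-hypDist x 0) := by
  rw [sqrt_eq_inv_cosh hx, Real.exp_neg, ← div_eq_mul_inv, inv_le_comm₀ (Real.cosh_pos _)
    (by positivity), inv_div, Real.cosh_eq]
  have := Real.exp_pos (-hypDist x 0)
  linarith

/-! ### The Reissner–Nordström functions -/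

section RN

variable {M Q : ℝ}

lemma mass_pos (hMQ : |Q| < M) : 0 < M := (abs_nonneg Q).trans_lt hMQ

lemma sq_sub_sq_pos (hMQ : |Q| < M) : 0 < M ^ 2 - Q ^ 2 := by
  have := sq_lt_sq' (by linarith [abs_nonneg Q]) hMQ
  rw [sq_abs] at this
  linarith

lemma mu_pos (hMQ : |Q| < M) : 0 < mu M Q := Real.sqrt_pos.2 (sq_sub_sq_pos hMQ)

lemma mu_sq (hMQ : |Q| < M) : mu M Q ^ 2 = M ^ 2 - Q ^ 2 := Real.sq_sqrt (sq_sub_sq_pos hMQ).le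

lemma Omega_pos (hMQ : |Q| < M) {x : Space} (hx : x ∈ hypBall) : 0 < Omega M Q x := by
  have h1 := mu_pos hMQ
  have h2 := mass_pos hMQ
  have h3 := Real.sqrt_pos.2 (one_sub_norm_sq_pos hx)
  rw [Omega]
  positivity

lemma Hfun_pos (hMQ : |Q| < M) (x : Space) : 0 < Hfun M Q x := by
  have h1 := mu_pos hMQ
  have h2 := mass_pos hMQ
  rw [Hfun]
  positivity

lemma sqrt_mu_mul_Hfun (hMQ : |Q| < M) (x : Space) :
    Real.sqrt (mu M Q) * Hfun M Q x = areaRadius M Q x := by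
  have h1 := Real.sqrt_pos.2 (mu_pos hMQ)
  rw [Hfun, areaRadius]
  field_simp

/-- The factor `μ + Mρ` in the denominator of `Ω` is the numerator of `H`. It cancels, and up to the
constant `√μ` the product no longer depends on mass and charge. -/
lemma Omega_mul_Hfun (hMQ : |Q| < M) {x : Space} (hx : x ≠ 0) :
    Omega M Q x * Hfun M Q x = Real.sqrt (mu M Q) * (Real.sqrt (1 - ‖x‖ ^ 2) / ‖x‖) := by
  have h1 := mu_pos hMQ
  have h2 := mass_pos hMQ
  have h3 := norm_pos_iff.2 hx
  have h4 := Real.sqrt_pos.2 h1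
  have h5 : Real.sqrt (mu M Q) ^ 2 = mu M Q := Real.sq_sqrt h1.le
  have h6 : 0 < mu M Q + M * ‖x‖ := by positivity
  have h7 : Hfun M Q x = (mu M Q + M * ‖x‖) / (Real.sqrt (mu M Q) * ‖x‖) := by
    rw [Hfun]; field_simp; ring
  rw [Omega, h7]
  have h8 : mu M Q * Real.sqrt (1 - ‖x‖ ^ 2) / (mu M Q + M * ‖x‖)
      * ((mu M Q + M * ‖x‖) / (Real.sqrt (mu M Q) * ‖x‖))
      = mu M Q * Real.sqrt (1 - ‖x‖ ^ 2) / (Real.sqrt (mu M Q) * ‖x‖) := by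
    field_simp
  rw [h8, div_eq_iff (by positivity)]
  have h9 : ‖x‖ ≠ 0 := h3.ne'
  rw [show Real.sqrt (mu M Q) * (Real.sqrt (1 - ‖x‖ ^ 2) / ‖x‖) * (Real.sqrt (mu M Q) * ‖x‖)
    = Real.sqrt (mu M Q) ^ 2 * Real.sqrt (1 - ‖x‖ ^ 2) * (‖x‖ / ‖x‖) by ring, h5, div_self h9,
    mul_one]

/-- The centre is excluded because division by zero gives `M / (4πμ)` on the left there and `0` on
the right. -/
lemma PhiO_eq (hMQ : |Q| < M) {x : Space} (hx : x ≠ 0) : PhiO M Q x = greenO x := by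
  have h4 := Real.sqrt_pos.2 (mu_pos hMQ)
  have hpi := Real.pi_pos
  rw [PhiO, Omega_mul_Hfun hMQ hx, greenO]
  field_simp

lemma PhiO_congr_norm {x y : Space} (h : ‖x‖ = ‖y‖) : PhiO M Q x = PhiO M Q y := by
  simp only [PhiO, Omega, Hfun, h]

lemma contDiffOn_sqrt : ContDiffOn ℝ ∞ (fun x : Space => Real.sqrt (1 - ‖x‖ ^ 2)) hypBall :=
  ContDiffOn.sqrt (contDiff_const.sub (contDiff_norm_sq ℝ)).contDiffOn
    fun _ hx => (one_sub_norm_sq_pos hx).ne'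

lemma contDiffOn_norm : ContDiffOn ℝ ∞ (fun x : Space => ‖x‖) {0}ᶜ := fun _ hx =>
  (contDiffAt_norm ℝ hx).contDiffWithinAt

lemma contDiffOn_sqrt_div_norm :
    ContDiffOn ℝ ∞ (fun x : Space => Real.sqrt (1 - ‖x‖ ^ 2) / ‖x‖) (hypBall \ {0}) :=
  (contDiffOn_sqrt.mono Set.sdiff_subset).div (contDiffOn_norm.mono fun _ hx => hx.2)
    fun _ hx => norm_ne_zero_iff.2 hx.2

lemma contDiffOn_greenO : ContDiffOn ℝ ∞ greenO (hypBall \ {0}) :=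
  contDiffOn_const.mul contDiffOn_sqrt_div_norm

lemma isOpen_hypBall_diff (p : Space) : IsOpen (hypBall \ {p}) :=
  isOpen_hypBall.sdiff isClosed_singleton

lemma solvesHelmholtz_PhiO (hMQ : |Q| < M) : SolvesHelmholtz (PhiO M Q) 0 (-1) :=
  solvesHelmholtz_greenO.congr_off 0 fun _ _ hx => (PhiO_eq hMQ hx).symm

lemma regularAtHorizon_PhiO (hMQ : |Q| < M) : RegularAtHorizon M Q (PhiO M Q) := by
  refine ⟨0, 1 / (4 * Real.pi * Real.sqrt (mu M Q)), fun x hx _ => ?_⟩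
  have h1 := Omega_pos hMQ hx
  have h2 := Hfun_pos hMQ x
  have h4 := Real.sqrt_pos.2 (mu_pos hMQ)
  have hpi := Real.pi_pos
  rw [PhiO, abs_of_pos (by positivity)]
  apply le_of_eq
  field_simp

lemma boundedAtInfinity_PhiO (hMQ : |Q| < M) : BoundedAtInfinity (PhiO M Q) := by
  refine ⟨Real.artanh (1 / 2), 1, fun x hx hR => ?_⟩
  have hn : 1 / 2 ≤ ‖x‖ := le_norm_of_le_hypDist hx (by norm_num) hR
  have hx0 : 0 < ‖x‖ := by linarith
  have hx' : x ≠ 0 := norm_pos_iff.1 hx0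
  have hq := one_sub_norm_sq_pos hx
  have hs := Real.sqrt_pos.2 hq
  have hs1 : Real.sqrt (1 - ‖x‖ ^ 2) ≤ 1 := Real.sqrt_le_one.2 (by nlinarith)
  have hs2 := Real.sq_sqrt hq.le
  have hpi := Real.pi_gt_three
  have hE : PhiO M Q =ᶠ[𝓝 x] fun y =>
      (fun r : ℝ => (4 * Real.pi)⁻¹ * (Real.sqrt (1 - r ^ 2) / r)) ‖y‖ := by
    filter_upwards [isOpen_compl_singleton.mem_nhds hx'] with y hy
    exact PhiO_eq hMQ hy
  have hU : HasDerivAt (fun r : ℝ => (4 * Real.pi)⁻¹ * (Real.sqrt (1 - r ^ 2) / r))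
      (-((4 * Real.pi)⁻¹ / (Real.sqrt (1 - ‖x‖ ^ 2) * ‖x‖ ^ 2))) ‖x‖ := by
    have h1 : HasDerivAt (fun r : ℝ => 1 - r ^ 2) (-(2 * ‖x‖)) ‖x‖ := by
      simpa using (hasDerivAt_pow 2 ‖x‖).const_sub 1
    refine (((h1.sqrt hq.ne').div (hasDerivAt_id _) hx0.ne').const_mul _).congr_deriv ?_
    simp only [id_eq]
    generalize Real.sqrt (1 - ‖x‖ ^ 2) = s at *
    generalize ‖x‖ = r at *
    have : r ^ 2 = 1 - s ^ 2 := by linarith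
    field_simp
    linear_combination (-1 : ℝ) * this
  refine ⟨?_, ?_, ?_⟩
  · rw [PhiO_eq hMQ hx', greenO, abs_of_pos (by positivity), inv_mul_eq_div, div_div,
      div_le_iff₀ (by positivity)]
    nlinarith
  · exact (((contDiffOn_greenO.contDiffAt ((isOpen_hypBall_diff 0).mem_nhds ⟨hx, hx'⟩)
      ).differentiableAt (by simp)).congr_of_eventuallyEq hE)
  · have hnsq := norm_sq_eq_three x
    have hval : ∑ i, ∑ j, (hypMetric x)⁻¹ i j * partialDeriv i (PhiO M Q) x
        * partialDeriv j (PhiO M Q) x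
        = ((4 * Real.pi)⁻¹ * Real.sqrt (1 - ‖x‖ ^ 2) / ‖x‖ ^ 2) ^ 2 := by
      simp only [partialDeriv_congr hE, partialDeriv_radial hx' hU, inv_hypMetric hx, hypCometric,
        Matrix.of_apply]
      generalize (4 * Real.pi)⁻¹ = c
      have hc : ∑ i, ∑ j, (1 - ‖x‖ ^ 2) * ((if i = j then 1 else 0) - x i * x j)
          * (-(c / (Real.sqrt (1 - ‖x‖ ^ 2) * ‖x‖ ^ 2)) * (x i / ‖x‖))
          * (-(c / (Real.sqrt (1 - ‖x‖ ^ 2) * ‖x‖ ^ 2)) * (x j / ‖x‖))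
          = (1 - ‖x‖ ^ 2) * (c / (Real.sqrt (1 - ‖x‖ ^ 2) * ‖x‖ ^ 2)) ^ 2 / ‖x‖ ^ 2
            * ((x 0 ^ 2 + x 1 ^ 2 + x 2 ^ 2) - (x 0 ^ 2 + x 1 ^ 2 + x 2 ^ 2) ^ 2) := by
        simp only [Fin.sum_univ_three]
        simp
        ring
      rw [hc, ← hnsq]
      generalize Real.sqrt (1 - ‖x‖ ^ 2) = s at *
      rw [← hs2]
      generalize ‖x‖ = r at *
      have : r ^ 2 = 1 - s ^ 2 := by linarith
      field_simp
      rw [this]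
      ring
    rw [differentialNorm, hval, Real.sqrt_sq (by positivity), div_le_iff₀ (by positivity),
      inv_mul_le_iff₀ (by positivity)]
    nlinarith

/-! ### Superposition, constants, and uniqueness under regularity at the horizon. -/

lemma SolvesHelmholtz.sub {Φ Ψ : Space → ℝ} {a : Space} {c d : ℝ} (hΦ : SolvesHelmholtz Φ a c)
    (hΨ : SolvesHelmholtz Ψ a d) : SolvesHelmholtz (fun x => Φ x - Ψ x) a (c - d) := by
  refine ⟨hΦ.1.sub hΨ.1, fun φ hφ => ?_⟩
  rw [sub_mul, ← hΦ.2 φ hφ, ← hΨ.2 φ hφ]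
  have i1 := (hφ.helmholtz.integrable_mul hΦ.1).integrableOn (s := hypBall)
  have i2 := (hφ.helmholtz.integrable_mul hΨ.1).integrableOn (s := hypBall)
  have e : ∀ u : Space → ℝ, (fun x => u x * (laplaceBeltrami hypMetric φ x + φ x)
      * volDensity hypMetric x) = fun x => u x *
        (volDensity hypMetric x * (laplaceBeltrami hypMetric φ x + φ x)) := fun u => by
    ext x; ring
  rw [e Φ, e Ψ, ← integral_sub i1 i2]
  refine integral_congr_ae (.of_forall fun x => ?_)
  simp only
  ring

lemma SolvesHelmholtz.const_mul {Φ : Space → ℝ} {a : Space} {c : ℝ} (hΦ : SolvesHelmholtz Φ a c)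
    (b : ℝ) : SolvesHelmholtz (fun x => b * Φ x) a (b * c) := by
  refine ⟨?_, fun φ hφ => ?_⟩
  · have := hΦ.1
    rw [locallyIntegrableOn_iff isOpen_hypBall.isLocallyClosed] at this ⊢
    exact fun K hKb hK => (this K hKb hK).const_mul b
  · rw [mul_assoc, ← hΦ.2 φ hφ, ← integral_const_mul]
    refine integral_congr_ae (.of_forall fun x => ?_)
    simp only
    ring

/-- Tested with a nonnegative bump `b`, the Laplacian integrates to zero and `A ∫ b √h = 0` remains.
-/
lemma solvesHelmholtz_const_iff (a : Space) (A : ℝ) :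
    SolvesHelmholtz (fun _ => A) a 0 ↔ A = 0 := by
  constructor
  · intro h
    let b : ContDiffBump (0 : Space) := ⟨1 / 4, 1 / 2, by norm_num, by norm_num⟩
    have hb : IsTestFunction hypBall (b : Space → ℝ) :=
      ⟨b.contDiff, b.hasCompactSupport, by
        rw [b.tsupport_eq]
        exact Metric.closedBall_subset_ball (by norm_num [b])⟩
    have hbv := hb.mul_contDiffOn isOpen_hypBall contDiffOn_volDensity
    have e := h.2 _ hb
    have i1 := (hb.laplacian.mul_contDiffOn isOpen_hypBall contDiffOn_volDensity).integrable
    have e1 : ∫ x in hypBall, A * (laplaceBeltrami hypMetric b x + b x) * volDensity hypMetric x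
        = A * ((∫ x in hypBall, volDensity hypMetric x * laplaceBeltrami hypMetric b x)
          + ∫ x in hypBall, volDensity hypMetric x * b x) := by
      rw [← integral_add i1.integrableOn hbv.integrable.integrableOn, ← integral_const_mul]
      refine integral_congr_ae (.of_forall fun x => ?_)
      simp only
      ring
    rw [e1, hb.integral_laplaceBeltrami, hbv.setIntegral_eq, zero_add, zero_mul] at e
    refine (mul_eq_zero.1 e).resolve_right (ne_of_gt ?_)
    refine hbv.1.continuous.integral_pos_of_hasCompactSupport_nonneg_nonzero hbv.2.1
      (fun x => ?_) (x := 0) ?_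
    · by_cases hx : x ∈ hypBall
      · exact mul_nonneg (volDensity_pos hx).le b.nonneg
      · have : b x = 0 := image_eq_zero_of_notMem_tsupport fun h => hx (hb.2.2 h)
        simp [this]
    · have h0 : b (0 : Space) = 1 := b.one_of_mem_closedBall (by simp [b])
      rw [h0, mul_one]
      exact (volDensity_pos zero_mem_hypBall).ne'
  · rintro rfl
    exact ⟨locallyIntegrableOn_const _, fun φ _ => by simp⟩

lemma solvesHelmholtz_PhiO_add_const_iff (hMQ : |Q| < M) (A : ℝ) :
    SolvesHelmholtz (fun x => PhiO M Q x + A) 0 (-1) ↔ A = 0 := by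
  constructor
  · intro h
    have := h.sub (solvesHelmholtz_PhiO hMQ)
    simp only [add_sub_cancel_left, sub_self] at this
    exact (solvesHelmholtz_const_iff 0 A).1 this
  · rintro rfl
    simpa using solvesHelmholtz_PhiO hMQ

/-- Regularity bounds `Φ` by a multiple of `ΩH = √μ √(1-ρ²)/ρ`. Restricting to `ρ ≥ 1/2` turns `1/ρ`
into a factor `2`. -/
lemma RegularAtHorizon.decay (hMQ : |Q| < M) {Φ : Space → ℝ} (h : RegularAtHorizon M Q Φ) :
    ∃ r₀ C : ℝ, r₀ < 1 ∧ ∀ x ∈ hypBall, r₀ ≤ ‖x‖ → |Φ x| ≤ C * Real.sqrt (1 - ‖x‖ ^ 2) := by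
  obtain ⟨R, C, hC⟩ := h
  refine ⟨max (Real.tanh R) (1 / 2), |C| * Real.sqrt (mu M Q) * 2,
    max_lt (Real.tanh_lt_one R) (by norm_num), fun x hx hr => ?_⟩
  have h1 := hC x hx (le_hypDist_of_le_norm hx ((le_max_left _ _).trans hr))
  have hn : 1 / 2 ≤ ‖x‖ := (le_max_right _ _).trans hr
  have hx0 : 0 < ‖x‖ := by linarith
  have hΩ := Omega_pos hMQ hx
  have hH := Hfun_pos hMQ x
  rw [abs_div, abs_of_pos (mul_pos hΩ hH), div_le_iff₀ (mul_pos hΩ hH),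
    Omega_mul_Hfun hMQ (norm_pos_iff.1 hx0)] at h1
  refine h1.trans ?_
  have h2 : Real.sqrt (1 - ‖x‖ ^ 2) / ‖x‖ ≤ 2 * Real.sqrt (1 - ‖x‖ ^ 2) := by
    rw [div_le_iff₀ hx0]
    nlinarith [Real.sqrt_nonneg (1 - ‖x‖ ^ 2)]
  calc C * (Real.sqrt (mu M Q) * (Real.sqrt (1 - ‖x‖ ^ 2) / ‖x‖))
      ≤ |C| * (Real.sqrt (mu M Q) * (2 * Real.sqrt (1 - ‖x‖ ^ 2))) := by
        gcongr
        exact le_abs_self C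
    _ = _ := by ring

/-- Solutions with prescribed source that are regular at the horizon are unique. -/
lemma eqOn_of_solvesHelmholtz (hMQ : |Q| < M) {Φ Ψ : Space → ℝ} {a : Space} {c : ℝ}
    (ha : a ∈ hypBall) (hΦc : ContinuousOn Φ (hypBall \ {a})) (hΨc : ContinuousOn Ψ (hypBall \ {a}))
    (hΦ : SolvesHelmholtz Φ a c) (hΨ : SolvesHelmholtz Ψ a c)
    (hΦr : RegularAtHorizon M Q Φ) (hΨr : RegularAtHorizon M Q Ψ) :
    Set.EqOn Φ Ψ (hypBall \ {a}) := by
  intro p hp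
  obtain ⟨r₁, C₁, hr₁, h₁⟩ := hΦr.decay hMQ
  obtain ⟨r₂, C₂, hr₂, h₂⟩ := hΨr.decay hMQ
  have hd := hΦ.sub hΨ
  rw [sub_self] at hd
  have hnhds := (isOpen_hypBall_diff a).mem_nhds hp
  have hz := hd.eq_zero ha hp.1 ((hΦc.continuousAt hnhds).sub (hΨc.continuousAt hnhds))
    (r₀ := max r₁ r₂) (C := C₁ + C₂) (max_lt hr₁ hr₂) fun x hx hr => by
      rw [add_mul]
      exact (abs_sub _ _).trans (add_le_add (h₁ x hx ((le_max_left _ _).trans hr))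
        (h₂ x hx ((le_max_right _ _).trans hr)))
  exact sub_eq_zero.1 hz

lemma continuousOn_PhiO (hMQ : |Q| < M) : ContinuousOn (PhiO M Q) (hypBall \ {0}) :=
  contDiffOn_greenO.continuousOn.congr fun _ hx => PhiO_eq hMQ hx.2

end RN

/-! ### The field of a charge -/

/-- The quantity `(1 - x₀·x)² - (1-|x₀|²)(1-|x|²)`, a multiple of `sinh² D(x, x₀)`. -/
def sepSq (x₀ x : Space) : ℝ := (1 - inner ℝ x₀ x) ^ 2 - (1 - ‖x₀‖ ^ 2) * (1 - ‖x‖ ^ 2)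

lemma norm_boostNum {x₀ : Space} (hx₀ : x₀ ∈ hypBall) (x : Space) :
    ‖boostNum x₀ x‖ = Real.sqrt (sepSq x₀ x) := by
  rw [sepSq, ← norm_boostNum_sq hx₀, Real.sqrt_sq (norm_nonneg _)]

lemma boost_ne_zero {x₀ x : Space} (hx₀ : x₀ ∈ hypBall) (hx : x ∈ hypBall) (hne : x ≠ x₀) :
    boost x₀ x ≠ 0 := fun h =>
  hne ((bijOn_boost hx₀).injOn hx hx₀ (by rw [h, boost_self hx₀]))

lemma sepSq_pos {x₀ x : Space} (hx₀ : x₀ ∈ hypBall) (hx : x ∈ hypBall) (hne : x ≠ x₀) :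
    0 < sepSq x₀ x := by
  rw [← Real.sqrt_pos, ← norm_boostNum hx₀, norm_pos_iff]
  intro h
  exact boost_ne_zero hx₀ hx hne (by rw [boost, h, smul_zero])

/-- This is `1 / (4π sinh D(x, x₀))`, as `sinh² D(x, x₀) = sepSq x₀ x / ((1-‖x₀‖²)(1-‖x‖²))`. -/
lemma greenO_boost {x₀ x : Space} (hx₀ : x₀ ∈ hypBall) (hx : x ∈ hypBall) (hne : x ≠ x₀) :
    greenO (boost x₀ x) = (4 * Real.pi)⁻¹ *
      (Real.sqrt (1 - ‖x₀‖ ^ 2) * Real.sqrt (1 - ‖x‖ ^ 2) / Real.sqrt (sepSq x₀ x)) := by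
  have hd : 0 < 1 - inner ℝ x₀ x := sub_pos.2 (inner_lt_one hx₀ hx)
  have hN := Real.sqrt_pos.2 (sepSq_pos hx₀ hx hne)
  have hn : ‖boost x₀ x‖ = Real.sqrt (sepSq x₀ x) / (1 - inner ℝ x₀ x) := by
    rw [boost, norm_smul, norm_boostNum hx₀, norm_inv, Real.norm_of_nonneg hd.le, inv_mul_eq_div]
  have hq₀ := one_sub_norm_sq_pos hx₀
  rw [greenO, one_sub_norm_boost_sq hx₀ hx, hn, Real.sqrt_div (by
    have := one_sub_norm_sq_pos hx; positivity), Real.sqrt_mul hq₀.le, Real.sqrt_sq hd.le]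
  congr 1
  field_simp

section Charge

variable {M Q : ℝ} {T : Space → Space} {x₀ : Space}

lemma PhiO_isometry (hMQ : |Q| < M) (hT : IsHypIsometry T) (hx₀ : x₀ ∈ hypBall) (hT0 : T x₀ = 0)
    {x : Space} (hx : x ∈ hypBall) (hne : x ≠ x₀) :
    PhiO M Q (T x) = (4 * Real.pi)⁻¹ *
      (Real.sqrt (1 - ‖x₀‖ ^ 2) * Real.sqrt (1 - ‖x‖ ^ 2) / Real.sqrt (sepSq x₀ x)) := by
  rw [PhiO_congr_norm (hT.norm_eq_norm_boost hx₀ hT0 hx), PhiO_eq hMQ (boost_ne_zero hx₀ hx hne),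
    greenO_boost hx₀ hx hne]

/-- The root `√(1-‖x‖²)` cancels against the weight. What depends on `x` makes sense even for `‖x₀‖
= 1`, and the vanishing at the horizon is isolated in the prefactor. -/
lemma chargeField_eq (hMQ : |Q| < M) (hT : IsHypIsometry T) (hx₀ : x₀ ∈ hypBall) (hT0 : T x₀ = 0)
    {x : Space} (hx : x ∈ hypBall) (hx0 : x ≠ 0) (hne : x ≠ x₀) :
    chargeField M Q T x₀ x = Real.sqrt (1 - ‖x₀‖ ^ 2) / (4 * Real.pi * areaRadius M Q x₀)
      * (‖x‖ / Real.sqrt (sepSq x₀ x)) := by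
  have hN := Real.sqrt_pos.2 (sepSq_pos hx₀ hx hne)
  have hs := Real.sqrt_pos.2 (one_sub_norm_sq_pos hx)
  have hmu := Real.sqrt_pos.2 (mu_pos hMQ)
  have hH := Hfun_pos hMQ x₀
  have hn := norm_pos_iff.2 hx0
  have hpi := Real.pi_pos
  rw [chargeField, PhiO_isometry hMQ hT hx₀ hT0 hx hne, ← sqrt_mu_mul_Hfun hMQ x₀,
    show Hfun M Q x * Hfun M Q x₀ * Omega M Q x = Omega M Q x * Hfun M Q x * Hfun M Q x₀ by ring,
    Omega_mul_Hfun hMQ hx0]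
  field_simp

lemma areaRadius_pos (hMQ : |Q| < M) (x : Space) : 0 < areaRadius M Q x := by
  have h1 := mu_pos hMQ
  have h2 := mass_pos hMQ
  rw [areaRadius]
  positivity

lemma chargeField_congr {T' : Space → Space} (hT : IsHypIsometry T) (hT' : IsHypIsometry T')
    (hx₀ : x₀ ∈ hypBall) (hT0 : T x₀ = 0) (hT0' : T' x₀ = 0) :
    Set.EqOn (chargeField M Q T' x₀) (chargeField M Q T x₀) hypBall := fun x hx => by
  rw [chargeField, chargeField, PhiO_congr_norm ((hT'.norm_eq_norm_boost hx₀ hT0' hx).trans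
    (hT.norm_eq_norm_boost hx₀ hT0 hx).symm)]

lemma contDiff_sepSq (x₀ : Space) : ContDiff ℝ ∞ (sepSq x₀) :=
  ((contDiff_const.sub (contDiff_const.inner ℝ contDiff_id)).pow 2).sub
    (contDiff_const.mul (contDiff_const.sub (contDiff_norm_sq ℝ)))

lemma contDiffOn_norm_div_sepSq (hx₀ : x₀ ∈ hypBall) :
    ContDiffOn ℝ ∞ (fun x => ‖x‖ / Real.sqrt (sepSq x₀ x)) (hypBall \ {0, x₀}) := by
  have hne : ∀ x ∈ hypBall \ {0, x₀}, x ≠ 0 ∧ x ≠ x₀ := fun x hx => by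
    simpa using hx.2
  have hpos : ∀ x ∈ hypBall \ {0, x₀}, 0 < sepSq x₀ x := fun x hx =>
    sepSq_pos hx₀ hx.1 (hne x hx).2
  exact (contDiffOn_norm.mono fun x hx => (hne x hx).1).div
    ((contDiff_sepSq x₀).contDiffOn.sqrt fun x hx => (hpos x hx).ne')
    fun x hx => (Real.sqrt_pos.2 (hpos x hx)).ne'

lemma contDiffOn_chargeField (hMQ : |Q| < M) (hT : IsHypIsometry T) (hx₀ : x₀ ∈ hypBall)
    (hT0 : T x₀ = 0) : ContDiffOn ℝ ∞ (chargeField M Q T x₀) (hypBall \ {0, x₀}) := by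
  refine ((contDiffOn_norm_div_sepSq hx₀).const_smul (Real.sqrt (1 - ‖x₀‖ ^ 2)
    / (4 * Real.pi * areaRadius M Q x₀))).congr fun x hx => ?_
  have hne : x ≠ 0 ∧ x ≠ x₀ := by simpa using hx.2
  exact chargeField_eq hMQ hT hx₀ hT0 hx.1 hne.1 hne.2

/-- The boost moves the pole from `O` to `x₀`, and rigidity replaces the boost by `T`. -/
lemma solvesHelmholtz_charge (hMQ : |Q| < M) (hT : IsHypIsometry T) (hx₀ : x₀ ∈ hypBall)
    (hT0 : T x₀ = 0) :
    SolvesHelmholtz (fun x => PhiO M Q (T x) / Hfun M Q x₀) x₀ (-(Hfun M Q x₀)⁻¹) := by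
  have h := (isometryPair_boost hx₀).solvesHelmholtz_comp zero_mem_hypBall (solvesHelmholtz_PhiO hMQ)
  rw [boost_zero, neg_neg] at h
  have h2 := h.const_mul (Hfun M Q x₀)⁻¹
  rw [mul_neg_one] at h2
  refine h2.congr_off x₀ fun x hx _ => ?_
  rw [PhiO_congr_norm (hT.norm_eq_norm_boost hx₀ hT0 hx)]
  ring

lemma regularAtHorizon_charge (hMQ : |Q| < M) (hT : IsHypIsometry T) (hx₀ : x₀ ∈ hypBall)
    (hT0 : T x₀ = 0) : RegularAtHorizon M Q (fun x => PhiO M Q (T x) / Hfun M Q x₀) := by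
  have hq₀ := one_sub_norm_sq_pos hx₀
  have hn₀ := mem_hypBall.1 hx₀
  have hpi := Real.pi_pos
  -- Since `1 - ⟨x₀, x⟩ ≥ κ`, one has `sepSq x₀ x ≥ κ² - (1-‖x‖²)`. This is at least `κ²/2` once
  -- `1-‖x‖² ≤ κ²/2`.
  set κ := 1 - ‖x₀‖ with hκ
  have hκ0 : 0 < κ := by rw [hκ]; linarith
  have hκ1 : κ ≤ 1 := by rw [hκ]; linarith [norm_nonneg x₀]
  set A := Real.sqrt (1 - ‖x₀‖ ^ 2) / (4 * Real.pi * areaRadius M Q x₀) with hA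
  have hA0 : 0 < A := by
    have := areaRadius_pos hMQ x₀
    have := Real.sqrt_pos.2 hq₀
    positivity
  have hr1 : Real.sqrt (1 - κ ^ 2 / 2) < 1 := by
    rw [Real.sqrt_lt' one_pos]; nlinarith
  have hr0 : 0 < Real.sqrt (1 - κ ^ 2 / 2) := Real.sqrt_pos.2 (by nlinarith)
  refine ⟨Real.artanh (Real.sqrt (1 - κ ^ 2 / 2)), A * (1 / Real.sqrt (κ ^ 2 / 2)),
    fun x hx hR => ?_⟩
  have hr := le_norm_of_le_hypDist hx hr1 hR
  have hn1 := mem_hypBall.1 hx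
  have hx0 : 0 < ‖x‖ := hr0.trans_le hr
  have hx2 : 1 - κ ^ 2 / 2 ≤ ‖x‖ ^ 2 := by
    rw [← Real.sq_sqrt (show 0 ≤ 1 - κ ^ 2 / 2 by nlinarith)]
    exact pow_le_pow_left₀ hr0.le hr 2
  have hin : κ ≤ 1 - inner ℝ x₀ x := by
    have h1 := real_inner_le_norm x₀ x
    rw [hκ]
    nlinarith [norm_nonneg x₀, norm_nonneg x]
  have hN : κ ^ 2 / 2 ≤ sepSq x₀ x := by
    have h1 : κ ^ 2 ≤ (1 - inner ℝ x₀ x) ^ 2 := pow_le_pow_left₀ hκ0.le hin 2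
    have h2 : (1 - ‖x₀‖ ^ 2) * (1 - ‖x‖ ^ 2) ≤ 1 - ‖x‖ ^ 2 :=
      mul_le_of_le_one_left (one_sub_norm_sq_pos hx).le (by nlinarith [norm_nonneg x₀])
    rw [sepSq]
    linarith
  have hne : x ≠ x₀ := fun h => by
    have h3 : sepSq x₀ x = 0 := by
      rw [h, sepSq, real_inner_self_eq_norm_sq]; ring
    have : 0 < κ ^ 2 / 2 := by positivity
    linarith
  have hval : PhiO M Q (T x) / Hfun M Q x₀ / (Omega M Q x * Hfun M Q x)
      = A * (‖x‖ / Real.sqrt (sepSq x₀ x)) := by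
    rw [hA, ← chargeField_eq hMQ hT hx₀ hT0 hx (norm_pos_iff.1 hx0) hne, chargeField, div_div]
    congr 1
    ring
  rw [hval, abs_of_nonneg (by positivity)]
  gcongr

lemma continuousOn_charge (hMQ : |Q| < M) (hT : IsHypIsometry T) (hx₀ : x₀ ∈ hypBall)
    (hT0 : T x₀ = 0) :
    ContinuousOn (fun x => PhiO M Q (T x) / Hfun M Q x₀) (hypBall \ {x₀}) := by
  refine ContinuousOn.div_const ((continuousOn_PhiO hMQ).comp
    (hT.2.1.continuousOn.mono Set.sdiff_subset) fun x hx => ⟨hT.1.mapsTo hx.1, fun h => ?_⟩) _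
  exact hx.2 (hT.1.injOn hx.1 hx₀ (by rw [hT0]; exact h))

lemma charge_unique (hMQ : |Q| < M) (hT : IsHypIsometry T) (hx₀ : x₀ ∈ hypBall)
    (hT0 : T x₀ = 0) {Φ : Space → ℝ} (hΦc : ContinuousOn Φ (hypBall \ {x₀}))
    (hΦ : SolvesHelmholtz Φ x₀ (-(Hfun M Q x₀)⁻¹)) (hΦr : RegularAtHorizon M Q Φ) {x : Space}
    (hx : x ∈ hypBall \ {0, x₀}) :
    Φ x / (Omega M Q x * Hfun M Q x) = chargeField M Q T x₀ x := by
  have hne : x ≠ 0 ∧ x ≠ x₀ := by simpa using hx.2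
  have h := eqOn_of_solvesHelmholtz hMQ hx₀ hΦc (continuousOn_charge hMQ hT hx₀ hT0) hΦ
    (solvesHelmholtz_charge hMQ hT hx₀ hT0) hΦr (regularAtHorizon_charge hMQ hT hx₀ hT0)
    (show x ∈ hypBall \ {x₀} from ⟨hx.1, hne.2⟩)
  rw [h, chargeField, div_div]
  congr 1
  ring

/-- In `r G` the factor `‖x‖` of `G` turns `r` into `M‖x‖ + μ`, which tends to `μ`, while `sepSq x₀
x` tends to `‖x₀‖²`. -/
lemma tendsto_monopole (hMQ : |Q| < M) (hT : IsHypIsometry T) (hx₀ : x₀ ∈ hypBall)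
    (hx₀0 : x₀ ≠ 0) (hT0 : T x₀ = 0) :
    Tendsto (fun x => areaRadius M Q x * chargeField M Q T x₀ x) (𝓝[≠] 0)
      (𝓝 (Omega M Q x₀ / (4 * Real.pi))) := by
  have hmu := mu_pos hMQ
  have hM := mass_pos hMQ
  have hpi := Real.pi_pos
  have hn₀ := norm_pos_iff.2 hx₀0
  have hN0 : sepSq x₀ 0 = ‖x₀‖ ^ 2 := by simp [sepSq]
  have hc : ContinuousAt (fun x : Space => Real.sqrt (1 - ‖x₀‖ ^ 2)
      / (4 * Real.pi * areaRadius M Q x₀) * ((M * ‖x‖ + mu M Q) / Real.sqrt (sepSq x₀ x))) 0 := by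
    refine continuousAt_const.mul (ContinuousAt.div (by fun_prop)
      (contDiff_sepSq x₀).continuous.continuousAt.sqrt ?_)
    rw [hN0, Real.sqrt_sq hn₀.le]
    exact hn₀.ne'
  have hlim := hc.tendsto.mono_left (nhdsWithin_le_nhds (s := {(0 : Space)}ᶜ))
  have hval : Real.sqrt (1 - ‖x₀‖ ^ 2) / (4 * Real.pi * areaRadius M Q x₀)
      * ((M * ‖(0 : Space)‖ + mu M Q) / Real.sqrt (sepSq x₀ 0)) = Omega M Q x₀ / (4 * Real.pi) := by
    rw [hN0, Real.sqrt_sq hn₀.le, norm_zero, mul_zero, zero_add, areaRadius, Omega]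
    have : 0 < mu M Q + M * ‖x₀‖ := by positivity
    rw [show M + mu M Q / ‖x₀‖ = (mu M Q + M * ‖x₀‖) / ‖x₀‖ by field_simp; ring]
    field_simp
  rw [hval] at hlim
  refine hlim.congr' ?_
  filter_upwards [self_mem_nhdsWithin,
    mem_nhdsWithin_of_mem_nhds (isOpen_hypBall.mem_nhds zero_mem_hypBall),
    mem_nhdsWithin_of_mem_nhds (isOpen_compl_singleton.mem_nhds hx₀0.symm)] with x h1 h2 h3
  have hn : 0 < ‖x‖ := norm_pos_iff.2 h1
  rw [chargeField_eq hMQ hT hx₀ hT0 h2 h1 h3]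
  have hr : areaRadius M Q x = (M * ‖x‖ + mu M Q) / ‖x‖ := by
    rw [areaRadius]; field_simp
  rw [hr]
  field_simp

/-- The monopole moment decays as the charge approaches the horizon. -/
lemma Omega_decay (hMQ : |Q| < M) : ∃ R C : ℝ, ∀ x₀ ∈ hypBall, R ≤ hypDist x₀ 0 →
    |Omega M Q x₀ / (4 * Real.pi)| ≤ C * Real.exp (-hypDist x₀ 0) := by
  refine ⟨0, 1, fun x₀ hx₀ _ => ?_⟩
  have hmu := mu_pos hMQ
  have hM := mass_pos hMQ
  have hpi := Real.pi_gt_three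
  have hΩ := Omega_pos hMQ hx₀
  have h1 : Omega M Q x₀ ≤ Real.sqrt (1 - ‖x₀‖ ^ 2) := by
    have hp : 0 ≤ M * ‖x₀‖ := by positivity
    rw [Omega, div_le_iff₀ (by positivity)]
    nlinarith [Real.sqrt_nonneg (1 - ‖x₀‖ ^ 2)]
  have h2 := sqrt_le_two_mul_exp hx₀
  rw [abs_of_pos (by positivity), div_le_iff₀ (by positivity)]
  nlinarith [Real.exp_pos (-hypDist x₀ 0)]

end Charge

/-! ### Decay of the field as the charge approaches the horizon -/

/-- Derivatives in the first variable of a jointly smooth function are bounded on compact sets. -/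
lemma exists_bound_iteratedFDeriv_left {E F : Type*} [NormedAddCommGroup E] [NormedSpace ℝ E]
    [NormedAddCommGroup F] [NormedSpace ℝ F] {f : E × F → ℝ} {U S : Set (E × F)} (hU : IsOpen U)
    (hf : ContDiffOn ℝ ∞ f U) (hS : IsCompact S) (hSU : S ⊆ U) (k : ℕ) :
    ∃ C, ∀ x y, (x, y) ∈ S → ‖iteratedFDeriv ℝ k (fun z => f (z, y)) x‖ ≤ C := by
  have hcont : ContinuousOn (iteratedFDeriv ℝ k f) U :=
    (hf.continuousOn_iteratedFDerivWithin (m := k) (by exact_mod_cast le_top)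
      hU.uniqueDiffOn).congr fun p hp => (iteratedFDerivWithin_of_isOpen k hU hp).symm
  obtain ⟨C, hC⟩ := hS.exists_bound_of_continuousOn (hcont.mono hSU)
  refine ⟨C, fun x y hxy => ?_⟩
  -- After a translation by `(0, y)` the slice is a composition with the linear map `inl`, of norm
  -- at most `1`, so its derivatives are restrictions of the full ones.
  set τ : E × F → E × F := fun p => p + (0, y) with hτ
  have hV : IsOpen (τ ⁻¹' U) := hU.preimage (by fun_prop)
  have hfτ : ContDiffOn ℝ ∞ (fun p => f (p + (0, y))) (τ ⁻¹' U) :=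
    hf.comp (by fun_prop) fun p hp => hp
  have hmem : ContinuousLinearMap.inl ℝ E F x ∈ τ ⁻¹' U := by
    simpa [hτ] using hSU hxy
  have hW : IsOpen (ContinuousLinearMap.inl ℝ E F ⁻¹' (τ ⁻¹' U)) :=
    hV.preimage (ContinuousLinearMap.inl ℝ E F).continuous
  have h1 := (ContinuousLinearMap.inl ℝ E F).iteratedFDerivWithin_comp_right (i := k) hfτ
    hV.uniqueDiffOn hW.uniqueDiffOn hmem (by exact_mod_cast le_top)
  rw [iteratedFDerivWithin_of_isOpen k hW hmem, iteratedFDerivWithin_of_isOpen k hV hmem,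
    iteratedFDeriv_comp_add_right] at h1
  have h2 : (fun p => f (p + (0, y))) ∘ ContinuousLinearMap.inl ℝ E F = fun z => f (z, y) := by
    ext z; simp
  rw [h2] at h1
  rw [h1]
  refine (ContinuousMultilinearMap.norm_compContinuousLinearMap_le _ _).trans ?_
  have h3 : ∏ _i : Fin k, ‖ContinuousLinearMap.inl ℝ E F‖ ≤ 1 :=
    Finset.prod_le_one (fun _ _ => norm_nonneg _)
      fun _ _ => ContinuousLinearMap.norm_inl_le_one ℝ E F
  have h4 : ContinuousLinearMap.inl ℝ E F x + (0, y) = (x, y) := by simp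
  rw [h4]
  calc _ ≤ ‖iteratedFDeriv ℝ k f (x, y)‖ * 1 := by gcongr
    _ ≤ C := by rw [mul_one]; exact hC _ hxy

lemma contDiff_sepSq_uncurry : ContDiff ℝ ∞ (fun p : Space × Space => sepSq p.2 p.1) :=
  ((contDiff_const.sub (contDiff_snd.inner ℝ contDiff_fst)).pow 2).sub
    ((contDiff_const.sub (contDiff_snd.norm_sq ℝ)).mul
      (contDiff_const.sub (contDiff_fst.norm_sq ℝ)))

section Decay

variable {M Q : ℝ} {K : Set Space}

/-- The case `‖y‖ = 1` is included: a point of a compact set stays away from the ideal boundary, so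
the horizon can be added to the range of `y`. -/
lemma sepSq_lower {r : ℝ} {x y : Space} (hr : 0 < r) (hr1 : r < 1) (hx : ‖x‖ < r) (hy1 : ‖y‖ ≤ 1)
    (hy : 1 - (1 - r) ^ 2 / 2 ≤ ‖y‖ ^ 2) : 0 < sepSq y x := by
  have h1 : 1 - r ≤ 1 - inner ℝ y x := by
    have := real_inner_le_norm y x
    nlinarith [norm_nonneg x, norm_nonneg y]
  have h2 : (1 - r) ^ 2 ≤ (1 - inner ℝ y x) ^ 2 := pow_le_pow_left₀ (by linarith) h1 2
  have h3 : (1 - ‖y‖ ^ 2) * (1 - ‖x‖ ^ 2) ≤ 1 - ‖y‖ ^ 2 :=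
    mul_le_of_le_one_right (by nlinarith [norm_nonneg y]) (by nlinarith [norm_nonneg x])
  have h4 : 0 < (1 - r) ^ 2 := by nlinarith
  rw [sepSq]
  linarith

lemma exists_horizon_radius {r : ℝ} (hr : 0 < r) (hr1 : r < 1) :
    ∃ r₁, 0 < r₁ ∧ r₁ < 1 ∧ ∀ t, r₁ ≤ t → 1 - (1 - r) ^ 2 / 2 ≤ t ^ 2 := by
  have h0 : 0 < 1 - (1 - r) ^ 2 / 2 := by nlinarith
  refine ⟨Real.sqrt (1 - (1 - r) ^ 2 / 2), Real.sqrt_pos.2 h0, ?_, fun t ht => ?_⟩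
  · rw [Real.sqrt_lt' one_pos]; nlinarith
  · rw [← Real.sq_sqrt h0.le]
    exact pow_le_pow_left₀ (Real.sqrt_nonneg _) ht 2

/-- The kernel `‖x‖ / √(sepSq y x)` is jointly smooth near `K × {r₁ ≤ ‖y‖ ≤ 1}`, a compact set
containing the horizon sphere. Its `x`-derivatives are therefore bounded uniformly, and the
prefactor `A` supplies `e^{-D}`, with `r(x₀) ≥ M` in its denominator. -/
lemma chargeField_decay (hMQ : |Q| < M) (hK : IsCompact K) (hKb : K ⊆ hypBall \ {0}) (k : ℕ) :
    ∃ R C : ℝ, ∀ x₀ ∈ hypBall, R ≤ hypDist x₀ 0 →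
      ∀ T : Space → Space, IsHypIsometry T → T x₀ = 0 → ∀ x ∈ K,
        ‖iteratedFDeriv ℝ k (chargeField M Q T x₀) x‖ ≤ C * Real.exp (-hypDist x₀ 0) := by
  have hM := mass_pos hMQ
  have hmu := mu_pos hMQ
  have hpi := Real.pi_pos
  obtain ⟨r, hr0, hr1, hr⟩ := exists_radius hK (hKb.trans Set.sdiff_subset)
  obtain ⟨r₁, hr₁0, hr₁1, hr₁⟩ := exists_horizon_radius hr0 hr1
  set U : Set (Space × Space) := {p | p.1 ≠ 0} ∩ {p | 0 < sepSq p.2 p.1} with hUdef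
  have hU : IsOpen U := (isOpen_ne_fun continuous_fst continuous_const).inter
    (isOpen_lt continuous_const contDiff_sepSq_uncurry.continuous)
  have hf : ContDiffOn ℝ ∞ (fun p : Space × Space => ‖p.1‖ / Real.sqrt (sepSq p.2 p.1)) U :=
    (contDiffOn_norm.comp contDiff_fst.contDiffOn fun p hp => hp.1).div
      (contDiff_sepSq_uncurry.contDiffOn.sqrt fun p hp => ne_of_gt hp.2)
      fun p hp => (Real.sqrt_pos.2 hp.2).ne'
  set L : Set Space := (fun y : Space => ‖y‖) ⁻¹' Set.Icc r₁ 1 with hLdef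
  have hL : IsCompact L := by
    refine (isCompact_closedBall (0 : Space) 1).of_isClosed_subset
      (isClosed_Icc.preimage continuous_norm) fun x hx => ?_
    rw [mem_closedBall_zero_iff]
    exact hx.2
  have hSU : K ×ˢ L ⊆ U := fun p hp =>
    ⟨(hKb hp.1).2, sepSq_lower hr0 hr1 (hr _ hp.1) hp.2.2 (hr₁ _ hp.2.1)⟩
  obtain ⟨C, hC⟩ := exists_bound_iteratedFDeriv_left hU hf (hK.prod hL) hSU k
  refine ⟨Real.artanh r₁, 2 / (4 * Real.pi * M) * |C|, fun x₀ hx₀ hR T hT hT0 x hx => ?_⟩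
  have hxr := le_norm_of_le_hypDist hx₀ hr₁1 hR
  have hx₀1 := (mem_hypBall.1 hx₀).le
  have hmem : (x, x₀) ∈ K ×ˢ L := ⟨hx, hxr, hx₀1⟩
  have hbd := hC x x₀ hmem
  set A := Real.sqrt (1 - ‖x₀‖ ^ 2) / (4 * Real.pi * areaRadius M Q x₀) with hA
  have har : M ≤ areaRadius M Q x₀ := by
    rw [areaRadius]
    have : 0 ≤ mu M Q / ‖x₀‖ := by positivity
    linarith
  have hA0 : 0 ≤ A := by
    have := areaRadius_pos hMQ x₀
    positivity
  have hA1 : A ≤ 2 / (4 * Real.pi * M) * Real.exp (-hypDist x₀ 0) := by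
    rw [hA, div_mul_eq_mul_div]
    have := sqrt_le_two_mul_exp hx₀
    gcongr
  have hE : chargeField M Q T x₀ =ᶠ[𝓝 x]
      A • fun z => ‖z‖ / Real.sqrt (sepSq x₀ z) := by
    have hnear : ∀ᶠ z in 𝓝 x, 0 < sepSq x₀ z :=
      (contDiff_sepSq x₀).continuous.continuousAt.eventually_const_lt (hSU hmem).2
    filter_upwards [hnear, (isOpen_hypBall_diff 0).mem_nhds (hKb hx)] with z hz hzb
    refine chargeField_eq hMQ hT hx₀ hT0 hzb.1 hzb.2 fun h => ?_
    rw [h, sepSq, real_inner_self_eq_norm_sq] at hz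
    nlinarith
  have hcd : ContDiffAt ℝ k (fun z => ‖z‖ / Real.sqrt (sepSq x₀ z)) x := by
    have h1 := (hf.contDiffAt (hU.mem_nhds (hSU hmem))).of_le
      (show (k : WithTop ℕ∞) ≤ ∞ by exact_mod_cast le_top)
    exact h1.comp (f := fun z : Space => (z, x₀)) x (by fun_prop)
  rw [hE.iteratedFDeriv ℝ k |>.eq_of_nhds, iteratedFDeriv_const_smul_apply hcd, norm_smul,
    Real.norm_of_nonneg hA0]
  calc A * _ ≤ (2 / (4 * Real.pi * M) * Real.exp (-hypDist x₀ 0)) * |C| := by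
        gcongr
        exact hbd.trans (le_abs_self C)
    _ = _ := by ring

lemma chargeField_lower (hMQ : |Q| < M) (hK : IsCompact K) (hKb : K ⊆ hypBall \ {0}) :
    ∃ R c : ℝ, 0 < c ∧ ∀ x₀ ∈ hypBall, R ≤ hypDist x₀ 0 →
      ∀ T : Space → Space, IsHypIsometry T → T x₀ = 0 → ∀ x ∈ K,
        c * Real.exp (-hypDist x₀ 0) ≤ chargeField M Q T x₀ x := by
  have hM := mass_pos hMQ
  have hmu := mu_pos hMQ
  have hpi := Real.pi_pos
  obtain ⟨r, hr0, hr1, hr⟩ := exists_radius hK (hKb.trans Set.sdiff_subset)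
  obtain ⟨r₁, hr₁0, hr₁1, hr₁⟩ := exists_horizon_radius hr0 hr1
  obtain ⟨d, hd0, hd⟩ : ∃ d, 0 < d ∧ ∀ x ∈ K, d ≤ ‖x‖ := by
    rcases K.eq_empty_or_nonempty with rfl | hne
    · exact ⟨1, one_pos, by simp⟩
    obtain ⟨z, hz, hmin⟩ := hK.exists_isMinOn hne continuous_norm.continuousOn
    exact ⟨‖z‖, norm_pos_iff.2 (hKb hz).2, fun x hx => hmin hx⟩
  -- The constant combines `r(x₀) ≤ M + μ/r₁`, `‖x‖ ≥ d` on `K`, and `√(sepSq x₀ x) ≤ 2`.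
  refine ⟨Real.artanh r₁, (4 * Real.pi * (M + mu M Q / r₁))⁻¹ * (d / 2), by positivity,
    fun x₀ hx₀ hR T hT hT0 x hx => ?_⟩
  have hxr := le_norm_of_le_hypDist hx₀ hr₁1 hR
  have hN := sepSq_lower hr0 hr1 (hr x hx) (mem_hypBall.1 hx₀).le (hr₁ _ hxr)
  have hxb := hKb hx
  have hne : x ≠ x₀ := fun h => by
    rw [h, sepSq, real_inner_self_eq_norm_sq] at hN
    nlinarith
  rw [chargeField_eq hMQ hT hx₀ hT0 hxb.1 hxb.2 hne]
  have hx1 := mem_hypBall.1 hxb.1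
  have hx₀1 := mem_hypBall.1 hx₀
  have hsq : Real.sqrt (sepSq x₀ x) ≤ 2 := by
    rw [Real.sqrt_le_left (by norm_num), sepSq]
    have h1 := abs_real_inner_le_norm x₀ x
    have h2 : ‖x₀‖ * ‖x‖ ≤ 1 := by nlinarith [norm_nonneg x₀, norm_nonneg x]
    have h3 := abs_le.1 (h1.trans h2)
    have h4 := mul_pos (one_sub_norm_sq_pos hx₀) (one_sub_norm_sq_pos hxb.1)
    nlinarith
  have har := areaRadius_pos hMQ x₀
  have har2 : areaRadius M Q x₀ ≤ M + mu M Q / r₁ := by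
    rw [areaRadius]
    gcongr
  have hN' := Real.sqrt_pos.2 hN
  calc (4 * Real.pi * (M + mu M Q / r₁))⁻¹ * (d / 2) * Real.exp (-hypDist x₀ 0)
      = Real.exp (-hypDist x₀ 0) / (4 * Real.pi * (M + mu M Q / r₁)) * (d / 2) := by ring
    _ ≤ Real.sqrt (1 - ‖x₀‖ ^ 2) / (4 * Real.pi * areaRadius M Q x₀)
        * (‖x‖ / Real.sqrt (sepSq x₀ x)) := by
        have h5 := exp_neg_hypDist_le hx₀
        have h6 := hd x hx
        gcongr

end Decay

/-! ### The wave operator on static fields -/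

lemma partialDeriv_mul {u v : Space → ℝ} {x : Space} (hu : DifferentiableAt ℝ u x)
    (hv : DifferentiableAt ℝ v x) (i : Fin 3) :
    partialDeriv i (fun y => u y * v y) x = u x * partialDeriv i v x + v x * partialDeriv i u x := by
  have h := hu.hasFDerivAt.mul hv.hasFDerivAt
  have h' : HasFDerivAt (fun y => u y * v y) _ x := h
  rw [partialDeriv, h'.fderiv]
  simp [partialDeriv]

lemma partialDeriv_add {u v : Space → ℝ} {x : Space} (hu : DifferentiableAt ℝ u x)
    (hv : DifferentiableAt ℝ v x) (i : Fin 3) :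
    partialDeriv i (fun y => u y + v y) x = partialDeriv i u x + partialDeriv i v x := by
  have h : HasFDerivAt (fun y => u y + v y) _ x := hu.hasFDerivAt.add hv.hasFDerivAt
  rw [partialDeriv, h.fderiv]
  simp [partialDeriv]

lemma hypFlux_mul {u v : Space → ℝ} {x : Space} (hu : DifferentiableAt ℝ u x)
    (hv : DifferentiableAt ℝ v x) (i : Fin 3) :
    hypFlux (fun y => u y * v y) i x = u x * hypFlux v i x + v x * hypFlux u i x := by
  simp only [hypFlux, partialDeriv_mul hu hv, Fin.sum_univ_three]
  ring

/-- For a solution `w` of `Δw + w = 0`, the operator `∂ᵢ(w² √h h^{ij} ∂ⱼ)` is conjugate to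
`√h (Δ + 1)`. -/
lemma sum_partialDeriv_sq_mul_hypFlux {U : Set Space} (hU : IsOpen U) (hUb : U ⊆ hypBall)
    {w ψ : Space → ℝ} (hw : ContDiffOn ℝ ∞ w U) (hψ : ContDiffOn ℝ ∞ ψ U) {x : Space} (hx : x ∈ U)
    (hsol : volDensity hypMetric x * (laplaceBeltrami hypMetric w x + w x) = 0) :
    ∑ i, partialDeriv i (fun y => w y ^ 2 * hypFlux ψ i y) x
      = w x * (volDensity hypMetric x *
        (laplaceBeltrami hypMetric (fun y => w y * ψ y) x + w x * ψ x)) := by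
  have hd : ∀ {u : Space → ℝ}, ContDiffOn ℝ ∞ u U → ∀ y ∈ U, DifferentiableAt ℝ u y :=
    fun hu y hy => (hu.contDiffAt (hU.mem_nhds hy)).differentiableAt (by simp)
  have hwd := hd hw
  have hψd := hd hψ
  have hfw : ∀ i, ∀ y ∈ U, DifferentiableAt ℝ (hypFlux w i) y := fun i =>
    hd (contDiffOn_hypFlux hU hUb hw i)
  have hfψ : ∀ i, ∀ y ∈ U, DifferentiableAt ℝ (hypFlux ψ i) y := fun i =>
    hd (contDiffOn_hypFlux hU hUb hψ i)
  have e1 : ∀ i, partialDeriv i (fun y => w y ^ 2 * hypFlux ψ i y) x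
      = w x ^ 2 * partialDeriv i (hypFlux ψ i) x
        + hypFlux ψ i x * (2 * w x * partialDeriv i w x) := fun i => by
    have h2 : (fun y => w y ^ 2) = fun y => w y * w y := by ext y; ring
    have hd2 : DifferentiableAt ℝ (fun y => w y ^ 2) x := (hwd x hx).pow 2
    rw [partialDeriv_mul hd2 (hfψ i x hx), h2, partialDeriv_mul (hwd x hx) (hwd x hx)]
    ring
  have e2 : ∀ i, partialDeriv i (hypFlux (fun y => w y * ψ y) i) x
      = w x * partialDeriv i (hypFlux ψ i) x + hypFlux ψ i x * partialDeriv i w x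
        + (ψ x * partialDeriv i (hypFlux w i) x + hypFlux w i x * partialDeriv i ψ x) := fun i => by
    have hE : hypFlux (fun y => w y * ψ y) i =ᶠ[𝓝 x]
        fun y => w y * hypFlux ψ i y + ψ y * hypFlux w i y := by
      filter_upwards [hU.mem_nhds hx] with y hy
      exact hypFlux_mul (hwd y hy) (hψd y hy) i
    have d1 : DifferentiableAt ℝ (fun y => w y * hypFlux ψ i y) x := (hwd x hx).mul (hfψ i x hx)
    have d2 : DifferentiableAt ℝ (fun y => ψ y * hypFlux w i y) x := (hψd x hx).mul (hfw i x hx)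
    rw [partialDeriv_congr hE, partialDeriv_add d1 d2, partialDeriv_mul (hwd x hx) (hfψ i x hx),
      partialDeriv_mul (hψd x hx) (hfw i x hx)]
  -- The two sides differ by `w` times the antisymmetric part of the energy of `w` and `ψ`, which is
  -- zero, and by `w ψ` times the equation for `w`.
  have hen := hypEnergy_comm (ψ := w) (φ := ψ) (hUb hx)
  rw [mul_add, volDensity_mul_laplaceBeltrami (hUb hx)] at hsol ⊢
  simp only [e1, e2]
  simp only [hypEnergy, Fin.sum_univ_three] at hen hsol ⊢
  linear_combination w x * hen - w x * ψ x * hsol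

section Weight

variable {M Q : ℝ}

lemma contDiffOn_Omega (hMQ : |Q| < M) : ContDiffOn ℝ ∞ (Omega M Q) (hypBall \ {0}) := by
  have h1 := mu_pos hMQ
  have h2 := mass_pos hMQ
  refine (contDiffOn_const.mul (contDiffOn_sqrt.mono Set.sdiff_subset)).div
    (contDiffOn_const.add (contDiffOn_const.mul (contDiffOn_norm.mono fun _ hx => hx.2)))
    fun x hx => ?_
  positivity

lemma contDiffOn_Hfun : ContDiffOn ℝ ∞ (Hfun M Q) (hypBall \ {0}) := by
  refine (contDiffOn_const.add (contDiffOn_const.div (contDiffOn_norm.mono fun _ hx => hx.2)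
    fun x hx => norm_ne_zero_iff.2 hx.2)).div_const _

/-- The conformal weight `ΩH`. -/
def weight (M Q : ℝ) (x : Space) : ℝ := Omega M Q x * Hfun M Q x

lemma contDiffOn_weight (hMQ : |Q| < M) : ContDiffOn ℝ ∞ (weight M Q) (hypBall \ {0}) :=
  (contDiffOn_Omega hMQ).mul contDiffOn_Hfun

lemma weight_pos (hMQ : |Q| < M) {x : Space} (hx : x ∈ hypBall) : 0 < weight M Q x :=
  mul_pos (Omega_pos hMQ hx) (Hfun_pos hMQ x)

/-- This is `helmholtz_radial` with constant `g`. -/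
lemma helmholtz_weight (hMQ : |Q| < M) {x : Space} (hx : x ∈ hypBall \ {0}) :
    volDensity hypMetric x * (laplaceBeltrami hypMetric (weight M Q) x + weight M Q x) = 0 := by
  have hE : weight M Q =ᶠ[𝓝 x] fun y => Real.sqrt (1 - ‖y‖ ^ 2) *
      ((fun _ : ℝ => Real.sqrt (mu M Q)) ‖y‖ / ‖y‖) := by
    filter_upwards [isOpen_compl_singleton.mem_nhds hx.2] with y hy
    rw [weight, Omega_mul_Hfun hMQ hy]
    ring
  rw [laplaceBeltrami_congr hE, hE.eq_of_nhds, helmholtz_radial (g₁ := fun _ => 0) (g₂ := 0) hx.2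
    hx.1 (.of_forall fun r => hasDerivAt_const r _) (hasDerivAt_const _ _)]
  simp

lemma chargeField_mul_weight (hMQ : |Q| < M) {T : Space → Space} {x₀ x : Space} (hx : x ∈ hypBall) :
    chargeField M Q T x₀ x * weight M Q x = PhiO M Q (T x) / Hfun M Q x₀ := by
  have h1 := Omega_pos hMQ hx
  have h2 := Hfun_pos hMQ x
  have h3 := Hfun_pos hMQ x₀
  rw [chargeField, weight]
  field_simp

/-- The spatial part of the field equation, tested on a time slice. -/
lemma integral_chargeField_mul (hMQ : |Q| < M) {T : Space → Space} {x₀ : Space}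
    (hT : IsHypIsometry T) (hx₀ : x₀ ∈ hypBall) (hT0 : T x₀ = 0) {ψ : Space → ℝ}
    (hψ : IsTestFunction (hypBall \ {0}) ψ) :
    ∫ x in hypBall, chargeField M Q T x₀ x *
        ∑ i, partialDeriv i (fun y => weight M Q y ^ 2 * hypFlux ψ i y) x
      = -(Omega M Q x₀ * ψ x₀) := by
  have hwψ : IsTestFunction hypBall (fun x => weight M Q x * ψ x) :=
    (hψ.mul_contDiffOn (isOpen_hypBall_diff 0) (contDiffOn_weight hMQ)).mono Set.sdiff_subset
  have h := (solvesHelmholtz_charge hMQ hT hx₀ hT0).2 _ hwψ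
  have hH := Hfun_pos hMQ x₀
  -- The source strength `1/H(x₀)` times the weight leaves `Ω(x₀)`, the rate `dτ/dt` of the static
  -- particle.
  have hr : -(Hfun M Q x₀)⁻¹ * (weight M Q x₀ * ψ x₀) = -(Omega M Q x₀ * ψ x₀) := by
    rw [weight]; field_simp
  rw [← hr, ← h]
  refine setIntegral_congr_ae isOpen_hypBall.measurableSet ?_
  filter_upwards [ae_ne 0] with x hx0 hx
  rw [sum_partialDeriv_sq_mul_hypFlux (isOpen_hypBall_diff 0) Set.sdiff_subset
    (contDiffOn_weight hMQ) hψ.1.contDiffOn ⟨hx, hx0⟩ (helmholtz_weight hMQ ⟨hx, hx0⟩),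
    ← chargeField_mul_weight hMQ hx]
  ring

end Weight

/-! ### Time slices of the spacetime -/

@[simp] lemma spaceOf_event (t : ℝ) (x : Space) : spaceOf (event t x) = x := rfl

lemma event_timeOf_spaceOf (X : Spacetime) : event (timeOf X) (spaceOf X) = X := by
  ext i
  rcases i with i | i
  · fin_cases i; rfl
  · rfl

lemma contDiff_spaceOf : ContDiff ℝ ∞ spaceOf :=
  contDiff_euclidean.2 fun i => contDiff_piLp_apply (p := 2) (i := Sum.inr i)

lemma contDiff_timeOf : ContDiff ℝ ∞ timeOf := contDiff_piLp_apply (p := 2) (i := Sum.inl 0)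

lemma contDiff_event : ContDiff ℝ ∞ (fun p : ℝ × Space => event p.1 p.2) := by
  refine contDiff_euclidean.2 fun i => ?_
  rcases i with i | i
  · exact contDiff_fst
  · exact (contDiff_coord i).comp contDiff_snd

/-- The splitting of the spacetime into time and space. -/
def eventHomeomorph : ℝ × Space ≃ₜ Spacetime where
  toFun p := event p.1 p.2
  invFun X := (timeOf X, spaceOf X)
  left_inv _ := rfl
  right_inv X := event_timeOf_spaceOf X
  continuous_toFun := contDiff_event.continuous
  continuous_invFun := contDiff_timeOf.continuous.prodMk contDiff_spaceOf.continuous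

lemma measurableEmbedding_event : MeasurableEmbedding (fun p : ℝ × Space => event p.1 p.2) :=
  eventHomeomorph.measurableEmbedding

lemma measurePreserving_event :
    MeasurePreserving (fun p : ℝ × Space => event p.1 p.2) volume volume := by
  have h1 : MeasurePreserving (fun p : ℝ × Space =>
      ((MeasurableEquiv.funUnique (Fin 1) ℝ).symm p.1, WithLp.ofLp p.2)) volume volume :=
    (MeasurePreserving.symm _ (volume_preserving_funUnique (Fin 1) ℝ)).prod
      (PiLp.volume_preserving_ofLp (Fin 3))
  have h2 := volume_measurePreserving_sumPiEquivProdPi_symm (fun _ : Fin 1 ⊕ Fin 3 => ℝ)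
  have h3 := PiLp.volume_preserving_toLp (Fin 1 ⊕ Fin 3)
  have h : (fun p : ℝ × Space => event p.1 p.2) = (WithLp.toLp 2 ∘
      (MeasurableEquiv.sumPiEquivProdPi fun _ : Fin 1 ⊕ Fin 3 => ℝ).symm) ∘ fun p : ℝ × Space =>
        ((MeasurableEquiv.funUnique (Fin 1) ℝ).symm p.1, WithLp.ofLp p.2) := by
    funext p
    ext i
    rcases i with i | i <;> rfl
  rw [h]
  exact (h3.comp h2).comp h1

lemma isOpen_exterior : IsOpen exterior :=
  (isOpen_hypBall_diff 0).preimage contDiff_spaceOf.continuous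

lemma hasDerivAt_comp_event_time {u : Spacetime → ℝ} {t : ℝ} {x : Space}
    (hu : DifferentiableAt ℝ u (event t x)) :
    HasDerivAt (fun s => u (event s x)) (partialDeriv (Sum.inl 0) u (event t x)) t := by
  have he : HasDerivAt (fun s => event s x) (EuclideanSpace.single (Sum.inl 0) 1) t := by
    have h : (fun s => event s x)
        = fun s => event 0 x + s • EuclideanSpace.single (Sum.inl 0) (1 : ℝ) := by
      funext s
      ext i
      rcases i with i | i
      · fin_cases i; simp [event]
      · simp [event]
    rw [h]
    simpa using ((hasDerivAt_id t).smul_const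
      (EuclideanSpace.single (Sum.inl 0 : Fin 1 ⊕ Fin 3) (1 : ℝ))).const_add (event 0 x)
  exact hu.hasFDerivAt.comp_hasDerivAt t he

lemma partialDeriv_comp_event {u : Spacetime → ℝ} {t : ℝ} {x : Space}
    (hu : DifferentiableAt ℝ u (event t x)) (i : Fin 3) :
    partialDeriv i (fun y => u (event t y)) x = partialDeriv (Sum.inr i) u (event t x) := by
  have he : DifferentiableAt ℝ (fun y => event t y) x :=
    ((contDiff_event.comp (contDiff_prodMk_right t)).differentiable (by simp)) x
  have hl : HasLineDerivAt ℝ (fun y => event t y) (EuclideanSpace.single (Sum.inr i) 1) x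
      (EuclideanSpace.single i 1) := by
    have h : (fun s : ℝ => event t (x + s • EuclideanSpace.single i 1))
        = fun s => event t x + s • EuclideanSpace.single (Sum.inr i) (1 : ℝ) := by
      funext s
      ext j
      rcases j with j | j
      · simp [event]
      · simp [event]
    rw [HasLineDerivAt, h]
    simpa using ((hasDerivAt_id (0 : ℝ)).smul_const
      (EuclideanSpace.single (Sum.inr i : Fin 1 ⊕ Fin 3) (1 : ℝ))).const_add (event t x)
  have hc : HasFDerivAt (fun y => u (event t y)) _ x := hu.hasFDerivAt.comp x he.hasFDerivAt
  rw [partialDeriv, hc.fderiv, ContinuousLinearMap.comp_apply, partialDeriv]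
  congr 1
  rw [← he.lineDeriv_eq_fderiv, hl.lineDeriv]

lemma IsTestFunction.slice {φ : Spacetime → ℝ} (hφ : IsTestFunction exterior φ) (t : ℝ) :
    IsTestFunction (hypBall \ {0}) (fun x => φ (event t x)) := by
  refine isTestFunction_of_contDiffOn (K := spaceOf '' tsupport φ) (isOpen_hypBall_diff 0)
    (hφ.1.comp (contDiff_event.comp (contDiff_prodMk_right t))).contDiffOn
    (hφ.isCompact.image contDiff_spaceOf.continuous) ?_ fun x hx => ?_
  · rintro _ ⟨X, hX, rfl⟩
    exact hφ.2.2 hX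
  · by_contra h
    exact hx ⟨event t x, subset_tsupport _ h, rfl⟩

lemma IsTestFunction.integrable_time {φ : Spacetime → ℝ} (hφ : IsTestFunction exterior φ)
    (x : Space) : Integrable (fun t => φ (event t x)) := by
  refine Continuous.integrable_of_hasCompactSupport
    (hφ.1.continuous.comp (contDiff_event.continuous.comp (by fun_prop : Continuous fun t : ℝ => (t, x))))
    (HasCompactSupport.intro (hφ.isCompact.image contDiff_timeOf.continuous) fun t ht => ?_)
  by_contra h
  exact ht ⟨event t x, subset_tsupport _ h, rfl⟩

lemma IsTestFunction.integral_time_partialDeriv {φ : Spacetime → ℝ} (hφ : IsTestFunction exterior φ)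
    (x : Space) : ∫ t : ℝ, partialDeriv (Sum.inl 0) φ (event t x) = 0 :=
  integral_eq_zero_of_hasDerivAt_of_integrable
    (fun t => hasDerivAt_comp_event_time (hφ.1.differentiable (by simp) _))
    ((hφ.pderiv _).integrable_time x) (hφ.integrable_time x)

lemma locallyIntegrableOn_comp_spaceOf {G : Space → ℝ}
    (hG : LocallyIntegrableOn G (hypBall \ {0})) :
    LocallyIntegrableOn (fun X => G (spaceOf X)) exterior := by
  intro X hX
  obtain ⟨N, hN, hGN⟩ := hG (spaceOf X) hX
  set J := Set.Ioo (timeOf X - 1) (timeOf X + 1) with hJ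
  refine ⟨timeOf ⁻¹' J ∩ spaceOf ⁻¹' N, inter_mem ?_ ?_, ?_⟩
  · exact mem_nhdsWithin_of_mem_nhds (contDiff_timeOf.continuous.continuousAt.preimage_mem_nhds
      (isOpen_Ioo.mem_nhds ⟨by linarith, by linarith⟩))
  · exact (contDiff_spaceOf.continuous.continuousWithinAt.tendsto_nhdsWithin
      (fun Y hY => hY)) hN
  · refine (measurePreserving_event.integrableOn_comp_preimage measurableEmbedding_event).1 ?_
    have h : Integrable (fun p : ℝ × Space => G p.2)
        ((volume.restrict J).prod (volume.restrict N)) := by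
      have : IsFiniteMeasure ((volume : Measure ℝ).restrict J) :=
        ⟨by rw [Measure.restrict_apply_univ, hJ]; exact measure_Ioo_lt_top⟩
      exact Integrable.comp_snd hGN _
    rw [Measure.prod_restrict] at h
    exact h

/-! ### The wave operator in optical form -/

section Wave

variable {M Q : ℝ}

lemma volDensity_opticalFormMetric (hMQ : |Q| < M) {X : Spacetime} (hX : X ∈ exterior) :
    volDensity (opticalFormMetric M Q) X
      = Omega M Q (spaceOf X) ^ 4 * Hfun M Q (spaceOf X) ^ 6 * volDensity hypMetric (spaceOf X) := by
  have h1 := Omega_pos hMQ hX.1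
  have h2 := Hfun_pos hMQ (spaceOf X)
  have hdet : (opticalFormMetric M Q X).det
      = -((Omega M Q (spaceOf X) ^ 4 * Hfun M Q (spaceOf X) ^ 6) ^ 2 * (hypMetric (spaceOf X)).det) := by
    rw [opticalFormMetric, Matrix.det_smul, Matrix.det_fromBlocks_zero₂₁, Matrix.det_smul]
    simp
    ring
  rw [volDensity, hdet, abs_neg, abs_mul, abs_of_nonneg (sq_nonneg _), Real.sqrt_mul (sq_nonneg _),
    Real.sqrt_sq (by positivity), volDensity]

lemma inv_opticalFormMetric (hMQ : |Q| < M) {X : Spacetime} (hX : X ∈ exterior) :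
    (opticalFormMetric M Q X)⁻¹ = (Omega M Q (spaceOf X) ^ 2)⁻¹ •
      Matrix.fromBlocks (-1) 0 0 ((Hfun M Q (spaceOf X) ^ 4)⁻¹ • (hypMetric (spaceOf X))⁻¹) := by
  have h1 := Omega_pos hMQ hX.1
  have h2 := Hfun_pos hMQ (spaceOf X)
  refine Matrix.inv_eq_right_inv ?_
  have h3 : hypMetric (spaceOf X) * (hypMetric (spaceOf X))⁻¹ = 1 := by
    rw [inv_hypMetric hX.1, hypMetric_mul_hypCometric hX.1]
  rw [opticalFormMetric, Matrix.smul_mul, Matrix.mul_smul, smul_smul,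
    mul_inv_cancel₀ (by positivity), one_smul, Matrix.fromBlocks_multiply]
  simp only [Matrix.smul_mul, Matrix.mul_smul, h3, smul_smul]
  have h4 : Hfun M Q (spaceOf X) ^ 4 ≠ 0 := pow_ne_zero 4 h2.ne'
  simp [inv_mul_cancel₀ h4]

/-- The time component of the flux of `φ`. -/
def timeFlux (M Q : ℝ) (φ : Spacetime → ℝ) (X : Spacetime) : ℝ :=
  Omega M Q (spaceOf X) ^ 2 * Hfun M Q (spaceOf X) ^ 6 * volDensity hypMetric (spaceOf X) *
    partialDeriv (Sum.inl 0) φ X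

/-- The spatial components of the flux of `φ`. -/
def spaceFlux (M Q : ℝ) (φ : Spacetime → ℝ) (i : Fin 3) (X : Spacetime) : ℝ :=
  weight M Q (spaceOf X) ^ 2 * (volDensity hypMetric (spaceOf X) *
    ∑ j, (hypMetric (spaceOf X))⁻¹ i j * partialDeriv (Sum.inr j) φ X)

/-- The density `Ω⁴ H⁶ √h` times the inverse spatial metric `Ω⁻² H⁻⁴ h⁻¹` is `(ΩH)² √h h⁻¹`, exactly
the operator that is conjugate to `√h (Δ_h + 1)`. -/
lemma volDensity_mul_wave (hMQ : |Q| < M) {φ : Spacetime → ℝ} {X : Spacetime} (hX : X ∈ exterior) :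
    laplaceBeltrami (opticalFormMetric M Q) φ X * volDensity (opticalFormMetric M Q) X
      = -partialDeriv (Sum.inl 0) (timeFlux M Q φ) X
        + ∑ i, partialDeriv (Sum.inr i) (spaceFlux M Q φ i) X := by
  have hv : volDensity (opticalFormMetric M Q) X ≠ 0 := by
    have h1 := Omega_pos hMQ hX.1
    have h2 := Hfun_pos hMQ (spaceOf X)
    have h3 := volDensity_pos hX.1
    rw [volDensity_opticalFormMetric hMQ hX]
    positivity
  have hn := isOpen_exterior.mem_nhds hX
  have ht : (fun Y => volDensity (opticalFormMetric M Q) Y *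
      ∑ j, (opticalFormMetric M Q Y)⁻¹ (Sum.inl 0) j * partialDeriv j φ Y)
      =ᶠ[𝓝 X] fun Y => -timeFlux M Q φ Y := by
    filter_upwards [hn] with Y hY
    have h1 := Omega_pos hMQ hY.1
    rw [volDensity_opticalFormMetric hMQ hY, inv_opticalFormMetric hMQ hY, Fintype.sum_sum_type]
    simp [timeFlux]
    field_simp
  have hs : ∀ i, (fun Y => volDensity (opticalFormMetric M Q) Y *
      ∑ j, (opticalFormMetric M Q Y)⁻¹ (Sum.inr i) j * partialDeriv j φ Y)
      =ᶠ[𝓝 X] spaceFlux M Q φ i := fun i => by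
    filter_upwards [hn] with Y hY
    have h1 := Omega_pos hMQ hY.1
    have h2 := Hfun_pos hMQ (spaceOf Y)
    rw [volDensity_opticalFormMetric hMQ hY, inv_opticalFormMetric hMQ hY, Fintype.sum_sum_type]
    simp only [Matrix.smul_apply, Matrix.fromBlocks_apply₂₁, Matrix.fromBlocks_apply₂₂,
      Matrix.zero_apply, smul_eq_mul, mul_zero, zero_mul, Finset.sum_const_zero, zero_add,
      spaceFlux, weight, Fin.sum_univ_three]
    field_simp
  rw [laplaceBeltrami, mul_comm, mul_inv_cancel_left₀ hv, Fintype.sum_sum_type]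
  simp only [Fin.sum_univ_one, partialDeriv_congr ht, fun i => partialDeriv_congr (hs i)]
  congr 1
  rw [partialDeriv, fderiv_fun_neg]
  rfl

lemma isTestFunction_timeFlux (hMQ : |Q| < M) {φ : Spacetime → ℝ} (hφ : IsTestFunction exterior φ) :
    IsTestFunction exterior (timeFlux M Q φ) := by
  have hm : Set.MapsTo spaceOf exterior (hypBall \ {0}) := fun X hX => hX
  refine (hφ.pderiv (Sum.inl 0)).mul_contDiffOn isOpen_exterior (f := fun X =>
    Omega M Q (spaceOf X) ^ 2 * Hfun M Q (spaceOf X) ^ 6 * volDensity hypMetric (spaceOf X)) ?_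
  exact ((((contDiffOn_Omega hMQ).pow 2).mul (contDiffOn_Hfun.pow 6)).mul
    (contDiffOn_volDensity.mono Set.sdiff_subset)).comp contDiff_spaceOf.contDiffOn hm

lemma isTestFunction_spaceFlux (hMQ : |Q| < M) {φ : Spacetime → ℝ} (hφ : IsTestFunction exterior φ)
    (i : Fin 3) : IsTestFunction exterior (spaceFlux M Q φ i) := by
  have hm : Set.MapsTo spaceOf exterior (hypBall \ {0}) := fun X hX => hX
  refine isTestFunction_of_contDiffOn isOpen_exterior ?_ hφ.isCompact hφ.2.2 fun X hX => ?_
  · refine (((contDiffOn_weight hMQ).pow 2).comp contDiff_spaceOf.contDiffOn hm).mul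
      (((contDiffOn_volDensity.mono Set.sdiff_subset).comp contDiff_spaceOf.contDiffOn hm).mul
        (ContDiffOn.sum fun j _ => ?_))
    exact (((contDiffOn_hypMetric_inv i j).mono Set.sdiff_subset).comp
      contDiff_spaceOf.contDiffOn hm).mul (contDiffOn_partialDeriv isOpen_exterior hφ.1.contDiffOn _)
  · simp [spaceFlux, partialDeriv_eq_zero_of_notMem hX]

lemma spaceFlux_event {φ : Spacetime → ℝ} (hφ : Differentiable ℝ φ) (i : Fin 3) (t : ℝ) (x : Space) :
    spaceFlux M Q φ i (event t x)
      = weight M Q x ^ 2 * hypFlux (fun y => φ (event t y)) i x := by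
  simp only [spaceFlux, hypFlux, spaceOf_event, partialDeriv_comp_event (hφ _)]

lemma locallyIntegrableOn_chargeField (hMQ : |Q| < M) {T : Space → Space} {x₀ : Space}
    (hT : IsHypIsometry T) (hx₀ : x₀ ∈ hypBall) (hT0 : T x₀ = 0) :
    LocallyIntegrableOn (chargeField M Q T x₀) (hypBall \ {0}) := by
  have h := (solvesHelmholtz_charge hMQ hT hx₀ hT0).1.mono_set
    (Set.sdiff_subset : hypBall \ {0} ⊆ hypBall)
  have hw : ContinuousOn (fun x => (weight M Q x)⁻¹) (hypBall \ {0}) :=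
    (contDiffOn_weight hMQ).continuousOn.inv₀ fun x hx => (weight_pos hMQ hx.1).ne'
  have h2 := h.continuousOn_mul hw (isOpen_hypBall_diff 0).isLocallyClosed
  convert h2 using 2 with x
  rw [chargeField, weight]
  simp only [div_eq_mul_inv, mul_inv]
  ring

lemma integral_slice_chargeField (hMQ : |Q| < M) {T : Space → Space} {x₀ : Space}
    (hT : IsHypIsometry T) (hx₀ : x₀ ∈ hypBall) (hT0 : T x₀ = 0) {φ : Spacetime → ℝ}
    (hφ : IsTestFunction exterior φ) (t : ℝ) :
    ∫ x, chargeField M Q T x₀ x *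
        ∑ i, partialDeriv (Sum.inr i) (spaceFlux M Q φ i) (event t x)
      = -(Omega M Q x₀ * φ (event t x₀)) := by
  have hφd : Differentiable ℝ φ := hφ.1.differentiable (by simp)
  have hd : ∀ i, Differentiable ℝ (spaceFlux M Q φ i) := fun i =>
    (isTestFunction_spaceFlux hMQ hφ i).1.differentiable (by simp)
  rw [← integral_chargeField_mul hMQ hT hx₀ hT0 (hφ.slice t),
    ← setIntegral_eq_integral_of_forall_compl_eq_zero (s := hypBall)]
  · refine setIntegral_congr_fun isOpen_hypBall.measurableSet fun x _ => ?_
    have h : ∀ i, (fun y => weight M Q y ^ 2 * hypFlux (fun z => φ (event t z)) i y)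
        = fun y => spaceFlux M Q φ i (event t y) := fun i =>
      funext fun y => (spaceFlux_event hφd i t y).symm
    simp only [h, fun i => partialDeriv_comp_event (hd i (event t x))]
  · intro x hx
    have h : event t x ∉ exterior := fun h => hx h.1
    have h0 : ∀ i, partialDeriv (Sum.inr i) (spaceFlux M Q φ i) (event t x) = 0 := fun i =>
      partialDeriv_eq_zero_of_notMem (fun h' => h ((isTestFunction_spaceFlux hMQ hφ i).2.2 h')) _
    simp [h0]

/-- Fubini in two orders. The time part vanishes when integrated over `t` first, as `G` and the
coefficients are static. The space part is integrated over slices first, each giving `-Ω(x₀) φ(t,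
x₀)`. The substitution `t = τ/Ω(x₀)` then absorbs `Ω(x₀)`. -/
theorem isStaticChargeField_chargeField (hMQ : |Q| < M) {T : Space → Space} {x₀ : Space}
    (hT : IsHypIsometry T) (hx₀ : x₀ ∈ hypBall) (hT0 : T x₀ = 0) :
    IsStaticChargeField M Q x₀ (chargeField M Q T x₀) := by
  have hG := locallyIntegrableOn_comp_spaceOf (locallyIntegrableOn_chargeField hMQ hT hx₀ hT0)
  refine ⟨hG, fun φ hφ => ?_⟩
  generalize hGdef : chargeField M Q T x₀ = G at hG
  have hW1 : IsTestFunction exterior (partialDeriv (Sum.inl 0) (timeFlux M Q φ)) :=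
    (isTestFunction_timeFlux hMQ hφ).pderiv _
  have hVs := fun i => isTestFunction_spaceFlux hMQ hφ i
  have hW2 : IsTestFunction exterior
      (fun X => ∑ i, partialDeriv (Sum.inr i) (spaceFlux M Q φ i) X) := by
    simp only [Fin.sum_univ_three]
    exact (((hVs 0).pderiv _).add ((hVs 1).pderiv _)).add ((hVs 2).pderiv _)
  have i1 := hW1.integrable_mul hG
  have i2 := hW2.integrable_mul hG
  have hz : ∀ {W : Spacetime → ℝ}, IsTestFunction exterior W → ∀ X ∉ exterior, W X = 0 :=
    fun hW X hX => image_eq_zero_of_notMem_tsupport fun h => hX (hW.2.2 h)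
  have hsplit : ∫ X in exterior, G (spaceOf X) * laplaceBeltrami (opticalFormMetric M Q) φ X *
        volDensity (opticalFormMetric M Q) X
      = -(∫ X, G (spaceOf X) * partialDeriv (Sum.inl 0) (timeFlux M Q φ) X)
        + ∫ X, G (spaceOf X) * ∑ i, partialDeriv (Sum.inr i) (spaceFlux M Q φ i) X := by
    rw [← integral_neg, ← integral_add i1.fun_neg i2]
    refine Eq.trans ?_ (setIntegral_eq_integral_of_forall_compl_eq_zero (s := exterior) ?_)
    · refine setIntegral_congr_fun isOpen_exterior.measurableSet fun X hX => ?_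
      rw [mul_assoc, volDensity_mul_wave hMQ hX]
      ring
    · intro X hX
      simp only [hz hW1 X hX, hz hW2 X hX, mul_zero, neg_zero, add_zero]
  have e1 : ∫ X, G (spaceOf X) * partialDeriv (Sum.inl 0) (timeFlux M Q φ) X = 0 := by
    rw [← measurePreserving_event.integral_comp measurableEmbedding_event, Measure.volume_eq_prod,
      integral_prod_symm]
    · simp only [spaceOf_event, integral_const_mul,
        (isTestFunction_timeFlux hMQ hφ).integral_time_partialDeriv, mul_zero, integral_zero]
    · exact (measurePreserving_event.integrable_comp_emb measurableEmbedding_event).2 i1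
  have e2 : ∫ X, G (spaceOf X) * ∑ i, partialDeriv (Sum.inr i) (spaceFlux M Q φ i) X
      = ∫ t : ℝ, -(Omega M Q x₀ * φ (event t x₀)) := by
    rw [← measurePreserving_event.integral_comp measurableEmbedding_event, Measure.volume_eq_prod,
      integral_prod]
    · refine integral_congr_ae (μ := volume) (.of_forall fun t => ?_)
      subst hGdef
      exact integral_slice_chargeField hMQ hT hx₀ hT0 hφ t
    · exact (measurePreserving_event.integrable_comp_emb measurableEmbedding_event).2 i2
  have hΩ := Omega_pos hMQ hx₀
  rw [hsplit, e1, e2, neg_zero, zero_add, integral_neg, integral_const_mul]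
  simp only [staticWorldline]
  rw [Measure.integral_comp_div (fun t => φ (event t x₀)), abs_of_pos hΩ, smul_eq_mul]

end Wave

/-! ### The Reissner–Nordström chart -/

section Chart

variable {M Q : ℝ}

/-- The spatial part of the coordinate change. -/
def radialChart (M Q : ℝ) (x : Space) : Space := (areaRadius M Q x / ‖x‖) • x

lemma norm_radialChart (hMQ : |Q| < M) {x : Space} (hx : x ≠ 0) :
    ‖radialChart M Q x‖ = areaRadius M Q x := by
  have h := areaRadius_pos hMQ x
  have hn := norm_pos_iff.2 hx
  rw [radialChart, norm_smul, Real.norm_of_nonneg (by positivity), div_mul_cancel₀ _ hn.ne']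

lemma contDiffOn_areaRadius : ContDiffOn ℝ ∞ (areaRadius M Q) {0}ᶜ :=
  contDiffOn_const.add (contDiffOn_const.div contDiffOn_norm fun _ hx => norm_ne_zero_iff.2 hx)

lemma contDiffOn_radialChart : ContDiffOn ℝ ∞ (radialChart M Q) {0}ᶜ :=
  (contDiffOn_areaRadius.div contDiffOn_norm fun _ hx => norm_ne_zero_iff.2 hx).smul contDiffOn_id

lemma bijOn_rnChart (hMQ : |Q| < M) : Set.BijOn (rnChart M Q) exterior (rnExterior M Q) := by
  have hμ := mu_pos hMQ
  have hM := mass_pos hMQ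
  refine ⟨fun X hX => ?_, fun X hX Y hY hXY => ?_, fun Y hY => ?_⟩
  · have hn := norm_pos_iff.2 hX.2
    have hlt : ‖spaceOf X‖ < 1 := mem_hypBall.1 hX.1
    change M + mu M Q < ‖radialChart M Q (spaceOf X)‖
    rw [norm_radialChart hMQ hX.2, areaRadius, add_lt_add_iff_left, lt_div_iff₀ hn]
    nlinarith
  · have ht : timeOf (rnChart M Q X) = timeOf (rnChart M Q Y) := by rw [hXY]
    change timeOf X = timeOf Y at ht
    have hs : spaceOf (rnChart M Q X) = spaceOf (rnChart M Q Y) := by rw [hXY]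
    change radialChart M Q (spaceOf X) = radialChart M Q (spaceOf Y) at hs
    have hr : areaRadius M Q (spaceOf X) = areaRadius M Q (spaceOf Y) := by
      rw [← norm_radialChart hMQ hX.2, hs, norm_radialChart hMQ hY.2]
    have hX0 := norm_pos_iff.2 hX.2
    have hY0 := norm_pos_iff.2 hY.2
    have hn : ‖spaceOf X‖ = ‖spaceOf Y‖ := by
      have h := hr
      rw [areaRadius, areaRadius, add_right_inj, div_eq_div_iff hX0.ne' hY0.ne'] at h
      exact (mul_left_cancel₀ hμ.ne' h).symm
    rw [radialChart, radialChart, hr, hn] at hs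
    have hxy : spaceOf X = spaceOf Y :=
      smul_right_injective _ (div_pos (areaRadius_pos hMQ _) hY0).ne' hs
    rw [← event_timeOf_spaceOf X, ← event_timeOf_spaceOf Y, ht, hxy]
  · have hr : M + mu M Q < ‖spaceOf Y‖ := hY
    set r := ‖spaceOf Y‖ with hrdef
    have hrM : 0 < r - M := by linarith
    have hr0 : 0 < r := by linarith
    have hρ : 0 < mu M Q / (r - M) := div_pos hμ hrM
    -- The inverse of `r = M + μ/ρ` is `ρ = μ/(r - M)`, and `r > M + μ` means `ρ < 1`.
    set x : Space := (mu M Q / (r - M) / r) • spaceOf Y with hx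
    have hxn : ‖x‖ = mu M Q / (r - M) := by
      rw [hx, norm_smul, Real.norm_of_nonneg (by positivity), ← hrdef, div_mul_cancel₀ _ hr0.ne']
    refine ⟨event (timeOf Y) x, ⟨?_, ?_⟩, ?_⟩
    · rw [spaceOf_event, mem_hypBall, hxn, div_lt_one hrM]
      linarith
    · rw [spaceOf_event, ← norm_pos_iff, hxn]
      exact hρ
    · have hrad : radialChart M Q x = spaceOf Y := by
        rw [radialChart, areaRadius, hxn, hx, smul_smul]
        convert one_smul ℝ (spaceOf Y) using 2
        field_simp
        ring
      change event (timeOf Y) (radialChart M Q x) = Y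
      rw [hrad, event_timeOf_spaceOf]

lemma contDiffOn_rnChart : ContDiffOn ℝ ∞ (rnChart M Q) exterior :=
  contDiff_event.comp_contDiffOn (contDiff_timeOf.contDiffOn.prodMk
    (contDiffOn_radialChart.comp contDiff_spaceOf.contDiffOn fun _ hX => hX.2))

lemma fderiv_radialChart_apply {x : Space} (hx : x ≠ 0) (v : Space) :
    fderiv ℝ (radialChart M Q) x v = (areaRadius M Q x / ‖x‖) • v
      + (-(M / ‖x‖ ^ 3 + 2 * mu M Q / ‖x‖ ^ 4) * inner ℝ x v) • x := by
  have hn := norm_pos_iff.2 hx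
  have hk : HasDerivAt (fun s : ℝ => (M + mu M Q / s) / s)
      (-(M / ‖x‖ ^ 2 + 2 * mu M Q / ‖x‖ ^ 3)) ‖x‖ := by
    have h := (((hasDerivAt_const ‖x‖ (mu M Q)).fun_div (hasDerivAt_id' ‖x‖)
      hn.ne').const_add M).fun_div (hasDerivAt_id' ‖x‖) hn.ne'
    refine h.congr_deriv ?_
    field_simp
    ring
  have h1 : HasFDerivAt (fun y : Space => areaRadius M Q y / ‖y‖) _ x :=
    hk.comp_hasFDerivAt x (hasFDerivAt_norm_of_ne_zero hx)
  have h2 : HasFDerivAt (radialChart M Q) _ x := h1.fun_smul (hasFDerivAt_id x)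
  rw [h2.fderiv]
  simp only [add_apply, smul_apply,
    ContinuousLinearMap.smulRight_apply, ContinuousLinearMap.id_apply, innerSL_apply_apply, smul_eq_mul]
  congr 2
  field_simp

lemma timeOf_fderiv_rnChart {X : Spacetime} (hX : X ∈ exterior) (v : Spacetime) :
    timeOf (fderiv ℝ (rnChart M Q) X v) = timeOf v := by
  have hd : DifferentiableAt ℝ (rnChart M Q) X :=
    (contDiffOn_rnChart.contDiffAt (isOpen_exterior.mem_nhds hX)).differentiableAt (by simp)
  let L : Spacetime →L[ℝ] ℝ := EuclideanSpace.proj (Sum.inl 0)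
  have h1 : HasFDerivAt (fun Y => L (rnChart M Q Y)) _ X := L.hasFDerivAt.comp X hd.hasFDerivAt
  have h2 : HasFDerivAt (fun Y => L (rnChart M Q Y)) L X := L.hasFDerivAt
  exact DFunLike.congr_fun (h1.unique h2) v

lemma spaceOf_fderiv_rnChart {X : Spacetime} (hX : X ∈ exterior) (v : Spacetime) :
    spaceOf (fderiv ℝ (rnChart M Q) X v) = fderiv ℝ (radialChart M Q) (spaceOf X) (spaceOf v) := by
  have hd : DifferentiableAt ℝ (rnChart M Q) X :=
    (contDiffOn_rnChart.contDiffAt (isOpen_exterior.mem_nhds hX)).differentiableAt (by simp)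
  have hr : DifferentiableAt ℝ (radialChart M Q) (spaceOf X) :=
    (contDiffOn_radialChart.contDiffAt (isOpen_compl_singleton.mem_nhds hX.2)).differentiableAt
      (by simp)
  let L : Spacetime →L[ℝ] Space := LinearMap.toContinuousLinearMap
    { toFun := spaceOf, map_add' := fun _ _ => rfl, map_smul' := fun _ _ => rfl }
  have h1 : HasFDerivAt (fun Y => L (rnChart M Q Y)) _ X := L.hasFDerivAt.comp X hd.hasFDerivAt
  have h2 : HasFDerivAt (fun Y => L (rnChart M Q Y)) _ X :=
    HasFDerivAt.comp X (g := radialChart M Q) (f := L) hr.hasFDerivAt L.hasFDerivAt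
  exact DFunLike.congr_fun (h1.unique h2) v

lemma metricForm_rnMetric (Y v w : Spacetime) :
    metricForm (rnMetric M Q) Y v w = -(rnLapse M Q ‖spaceOf Y‖ * (timeOf v * timeOf w))
      + inner ℝ (spaceOf v) (spaceOf w) + ((rnLapse M Q ‖spaceOf Y‖)⁻¹ - 1) *
        (inner ℝ (spaceOf Y) (spaceOf v) * inner ℝ (spaceOf Y) (spaceOf w)) / ‖spaceOf Y‖ ^ 2 := by
  have hv : ∀ i, v (Sum.inr i) = spaceOf v i := fun _ => rfl
  have hw : ∀ i, w (Sum.inr i) = spaceOf w i := fun _ => rfl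
  have hv0 : v (Sum.inl 0) = timeOf v := rfl
  have hw0 : w (Sum.inl 0) = timeOf w := rfl
  simp only [metricForm, rnMetric, Fintype.sum_sum_type, Fin.sum_univ_one, Fin.sum_univ_three,
    Matrix.fromBlocks_apply₁₁, Matrix.fromBlocks_apply₁₂, Matrix.fromBlocks_apply₂₁,
    Matrix.fromBlocks_apply₂₂, Matrix.zero_apply, Matrix.neg_apply, Matrix.smul_apply,
    Matrix.one_apply_eq, Matrix.of_apply, inner_eq_three, hv, hw, hv0, hw0, smul_eq_mul]
  simp
  ring

lemma metricForm_opticalFormMetric (X v w : Spacetime) :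
    metricForm (opticalFormMetric M Q) X v w = Omega M Q (spaceOf X) ^ 2 *
      (-(timeOf v * timeOf w) + Hfun M Q (spaceOf X) ^ 4 *
        metricForm hypMetric (spaceOf X) (spaceOf v) (spaceOf w)) := by
  have hv : ∀ i, v (Sum.inr i) = spaceOf v i := fun _ => rfl
  have hw : ∀ i, w (Sum.inr i) = spaceOf w i := fun _ => rfl
  have hv0 : v (Sum.inl 0) = timeOf v := rfl
  have hw0 : w (Sum.inl 0) = timeOf w := rfl
  simp only [metricForm, opticalFormMetric, Fintype.sum_sum_type, Fin.sum_univ_one,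
    Fin.sum_univ_three, Matrix.fromBlocks_apply₁₁, Matrix.fromBlocks_apply₁₂,
    Matrix.fromBlocks_apply₂₁, Matrix.fromBlocks_apply₂₂, Matrix.zero_apply, Matrix.neg_apply,
    Matrix.smul_apply, Matrix.one_apply_eq, hv, hw, hv0, hw0, smul_eq_mul]
  ring

/-- `f = ((r-M)² - μ²)/r²`, and `r - M = μ/ρ`. -/
lemma rnLapse_areaRadius (hMQ : |Q| < M) {x : Space} (hx : x ∈ hypBall) (hx0 : x ≠ 0) :
    rnLapse M Q (areaRadius M Q x) = Omega M Q x ^ 2 := by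
  have hμ := mu_pos hMQ
  have hM := mass_pos hMQ
  have hn := norm_pos_iff.2 hx0
  have h1 := one_sub_norm_sq_pos hx
  have hsq := mu_sq hMQ
  have hr : areaRadius M Q x = (mu M Q + M * ‖x‖) / ‖x‖ := by
    rw [areaRadius]; field_simp; ring
  have hq : Q ^ 2 = M ^ 2 - mu M Q ^ 2 := by linarith
  have hd : 0 < mu M Q + M * ‖x‖ := by positivity
  rw [rnLapse, Omega, div_pow, mul_pow, Real.sq_sqrt h1.le, hr, hq]
  field_simp
  ring

/-- Since `f = Ω²` and `Ω² H⁴ = r² (1-ρ²)/ρ²`, both spatial metrics equal `r² (dω² +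
dρ²/(ρ²(1-ρ²)))`. -/
lemma metricForm_rnChart (hMQ : |Q| < M) {X : Spacetime} (hX : X ∈ exterior) (v w : Spacetime) :
    metricForm (rnMetric M Q) (rnChart M Q X)
        (fderiv ℝ (rnChart M Q) X v) (fderiv ℝ (rnChart M Q) X w)
      = metricForm (opticalFormMetric M Q) X v w := by
  have hs : spaceOf (rnChart M Q X) = radialChart M Q (spaceOf X) := rfl
  rw [metricForm_rnMetric, metricForm_opticalFormMetric, timeOf_fderiv_rnChart hX,
    timeOf_fderiv_rnChart hX, spaceOf_fderiv_rnChart hX, spaceOf_fderiv_rnChart hX, hs,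
    norm_radialChart hMQ hX.2, rnLapse_areaRadius hMQ hX.1 hX.2,
    fderiv_radialChart_apply hX.2, fderiv_radialChart_apply hX.2,
    metricForm_hypMetric]
  obtain ⟨hx, hx0⟩ := hX
  generalize spaceOf X = x at *
  generalize spaceOf v = a
  generalize spaceOf w = b
  generalize timeOf v * timeOf w = τ
  have hμ := mu_pos hMQ
  have hM := mass_pos hMQ
  have hn := norm_pos_iff.2 hx0
  have h1 := one_sub_norm_sq_pos hx
  have hH : Hfun M Q x ^ 4 = areaRadius M Q x ^ 4 / mu M Q ^ 2 := by
    rw [← sqrt_mu_mul_Hfun hMQ, mul_pow, show Real.sqrt (mu M Q) ^ 4 = mu M Q ^ 2 by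
      rw [show (4 : ℕ) = 2 * 2 from rfl, pow_mul, Real.sq_sqrt hμ.le]]
    field_simp
  have hΩ : Omega M Q x ^ 2
      = mu M Q ^ 2 * (1 - ‖x‖ ^ 2) / (mu M Q + M * ‖x‖) ^ 2 := by
    rw [Omega, div_pow, mul_pow, Real.sq_sqrt h1.le]
  have hr : areaRadius M Q x = (mu M Q + M * ‖x‖) / ‖x‖ := by
    rw [areaRadius]; field_simp; ring
  rw [hH, hΩ, radialChart, hr]
  simp only [inner_add_left, inner_add_right, real_inner_smul_left, real_inner_smul_right,
    real_inner_self_eq_norm_sq, real_inner_comm x a]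
  -- With `s = μ + Mρ` as a variable and `M` eliminated, the claim is a rational identity in `s`,
  -- `μ`, `ρ` and the inner products.
  generalize hs : mu M Q + M * ‖x‖ = s
  have hs0 : 0 < s := by rw [← hs]; positivity
  have hMs : M = (s - mu M Q) / ‖x‖ := by rw [← hs]; field_simp; ring
  generalize mu M Q = m at *
  generalize ‖x‖ = ρ at *
  rw [hMs]
  field_simp
  ring

end Chart

end StaticScalar

end

theorem mainTheorem2 (M Q : ℝ) (hMQ : |Q| < M) :
    -- the exterior of the Reissner–Nordström black hole, in the form `Ω² (-dt² + H⁴ h)`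
    (Set.BijOn (rnChart M Q) exterior (rnExterior M Q) ∧
      ContDiffOn ℝ ∞ (rnChart M Q) exterior ∧
      ∀ X ∈ exterior, ∀ v w : Spacetime,
        metricForm (rnMetric M Q) (rnChart M Q X)
            (fderiv ℝ (rnChart M Q) X v) (fderiv ℝ (rnChart M Q) X w)
          = metricForm (opticalFormMetric M Q) X v w) ∧
    -- `Φ_O` is the solution with pole at `O`; there is no free constant
    SolvesHelmholtz (PhiO M Q) 0 (-1) ∧
    BoundedAtInfinity (PhiO M Q) ∧
    RegularAtHorizon M Q (PhiO M Q) ∧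
    (∀ A : ℝ, SolvesHelmholtz (fun x => PhiO M Q x + A) 0 (-1) ↔ A = 0) ∧
    (∀ Φ : Space → ℝ, ContinuousOn Φ (hypBall \ {0}) → SolvesHelmholtz Φ 0 (-1) →
      RegularAtHorizon M Q Φ → Set.EqOn Φ (PhiO M Q) (hypBall \ {0})) ∧
    -- the field of a static unit charge at `x₀`
    (∀ x₀ ∈ hypBall, x₀ ≠ 0 →
      (∃ T : Space → Space, IsHypIsometry T ∧ T x₀ = 0) ∧
      ∀ T : Space → Space, IsHypIsometry T → T x₀ = 0 →
        (∀ T' : Space → Space, IsHypIsometry T' → T' x₀ = 0 →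
          Set.EqOn (chargeField M Q T' x₀) (chargeField M Q T x₀) hypBall) ∧
        IsStaticChargeField M Q x₀ (chargeField M Q T x₀) ∧
        ContDiffOn ℝ ∞ (chargeField M Q T x₀) (hypBall \ {0, x₀}) ∧
        SolvesHelmholtz (fun x => PhiO M Q (T x) / Hfun M Q x₀) x₀ (-(Hfun M Q x₀)⁻¹) ∧
        RegularAtHorizon M Q (fun x => PhiO M Q (T x) / Hfun M Q x₀) ∧
        (∀ Φ : Space → ℝ, ContinuousOn Φ (hypBall \ {x₀}) →
          SolvesHelmholtz Φ x₀ (-(Hfun M Q x₀)⁻¹) → RegularAtHorizon M Q Φ →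
          ∀ x ∈ hypBall \ {0, x₀},
            Φ x / (Omega M Q x * Hfun M Q x) = chargeField M Q T x₀ x) ∧
        -- the monopole moment `lim r G` seen from spatial infinity
        Filter.Tendsto (fun x => areaRadius M Q x * chargeField M Q T x₀ x)
          (nhdsWithin 0 {0}ᶜ) (nhds (Omega M Q x₀ / (4 * Real.pi)))) ∧
    -- decay of the field and of all its derivatives, locally uniformly, as `x₀` nears the horizon
    (∀ K : Set Space, IsCompact K → K ⊆ hypBall \ {0} →
      (∀ k : ℕ, ∃ R C : ℝ, ∀ x₀ ∈ hypBall, R ≤ hypDist x₀ 0 →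
        ∀ T : Space → Space, IsHypIsometry T → T x₀ = 0 → ∀ x ∈ K,
          ‖iteratedFDeriv ℝ k (chargeField M Q T x₀) x‖ ≤ C * Real.exp (-hypDist x₀ 0)) ∧
      ∃ R c : ℝ, 0 < c ∧ ∀ x₀ ∈ hypBall, R ≤ hypDist x₀ 0 →
        ∀ T : Space → Space, IsHypIsometry T → T x₀ = 0 → ∀ x ∈ K,
          c * Real.exp (-hypDist x₀ 0) ≤ chargeField M Q T x₀ x) ∧
    -- no monopole hair remains
    (∃ R C : ℝ, ∀ x₀ ∈ hypBall, R ≤ hypDist x₀ 0 →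
      |Omega M Q x₀ / (4 * Real.pi)| ≤ C * Real.exp (-hypDist x₀ 0)) := by
  refine ⟨⟨bijOn_rnChart hMQ, contDiffOn_rnChart, fun X hX v w => metricForm_rnChart hMQ hX v w⟩,
    solvesHelmholtz_PhiO hMQ, boundedAtInfinity_PhiO hMQ, regularAtHorizon_PhiO hMQ,
    solvesHelmholtz_PhiO_add_const_iff hMQ, fun Φ hc hs hr => ?_, fun x₀ hx₀ hne => ⟨?_, ?_⟩,
    fun K hK hKb => ⟨chargeField_decay hMQ hK hKb, chargeField_lower hMQ hK hKb⟩,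
    Omega_decay hMQ⟩
  · exact eqOn_of_solvesHelmholtz hMQ zero_mem_hypBall hc (continuousOn_PhiO hMQ) hs
      (solvesHelmholtz_PhiO hMQ) hr (regularAtHorizon_PhiO hMQ)
  · exact ⟨boost x₀, isHypIsometry_boost hx₀, boost_self hx₀⟩
  · exact fun T hT hT0 => ⟨fun T' hT' hT0' => chargeField_congr hT hT' hx₀ hT0 hT0',
      isStaticChargeField_chargeField hMQ hT hx₀ hT0, contDiffOn_chargeField hMQ hT hx₀ hT0,
      solvesHelmholtz_charge hMQ hT hx₀ hT0, regularAtHorizon_charge hMQ hT hx₀ hT0,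
      fun Φ hc hs hr x hx => charge_unique hMQ hT hx₀ hT0 hc hs hr hx,
      tendsto_monopole hMQ hT hx₀ hne hT0⟩
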